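/- \textbf{Setting.} Let $\mathbb H$ be a separable complex Hilbert space with inner product $\langle\cdot,\cdot\rangle$ linear in the first argument, and put $(x\otimes y)z=\langle z,y\rangle x$. Fix a complete orthonormal system (CONS) $\{r_j\}$ of $\mathbb H$ and let $\overline{x}=\sum_j\overline{\langle x,r_j\rangle}\,r_j$. Let $\mathbb X$ be the Hilbert space of Hilbert--Schmidt operators on $\mathbb H$ with $\langle A,B\rangle_{\rm HS}=\operatorname{trace}(B^*A)$, and for $A,B\in\mathbb X$ let $A\otimes_{\rm HS}B$ be the operator $D\mapsto\langle D,B\rangle_{\rm HS}A$ on $\mathbb X$; $\|\cdot\|_{\rm tr}$ is the trace norm. Let $X=\{X(t),t\in\mathbb R\}$ be a zero-mean Gaussian process in $\mathbb H$ which is stationary, i.e. $\mathbb E[X(t)\otimes X(s)]$ and $\mathbb E[X(t)\otimes\overline{X(s)}]$ depend only on $t-s$; write $C(h)=\mathbb E[X(h)\otimes X(0)]$ and $\check C(h)=\mathbb E[X(h)\otimes\overline{X(0)}]$. For $\delta>0$ put $$f(\theta;\delta)=\frac{\delta}{2\pi}\sum_{k\in\mathbb Z}e^{\mathrm i k\theta\delta}C(k\delta),\qquad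 \check f(\theta;\delta)=\frac{\delta}{2\pi}\sum_{k\in\mathbb Z}e^{-\mathrm i k\theta\delta}\check C(k\delta),$$ and $f(\theta;0)=\frac1{2\pi}\int_{\mathbb R}e^{\mathrm i\theta x}C(x)\,dx$, $\check f(\theta;0)=\frac1{2\pi}\int_{\mathbb R}e^{-\mathrm i\theta x}\check C(x)\,dx$ (Bochner integrals). \textbf{Assumptions.} Let $K\ge0$ be a symmetric kernel on $\mathbb R$ with compact support and of bounded variation, and $\|K\|_2^2=\int K^2(x)\,dx$. Let $\delta_n,\Delta_n,L_n>0$ with $\delta_n\to\delta_\infty\in[0,\infty)$, $n\delta_n/\Delta_n\to\infty$, $L_n\delta_n\to\infty$, $L_n/\Delta_n\to0$. Let $\theta\in\mathbb R$, with $|\theta|\le\pi/\delta_\infty$ if $\delta_\infty>0$. Assume that $C$ and $\check C$ are Bochner integrable in trace norm if $\delta_\infty=0$, and that $\sum_k\|C(k\delta_\infty)\|_{\rm tr}$ and $\sum_k\|\check C(k\delta_\infty)\|_{\rm tr}$ are finite if $\delta_\infty>0$ (so that $f(\theta;\delta_\infty)$ and $\check f(\theta;\delta_\infty)$ are well defined),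 and that, for some CONS $\{u_k\}$ of $\mathbb H$: (a) $\sup_n\delta_n\sum_{x\in\mathbb Z}\|C(\delta_nx)\|_{\rm tr}<\infty$ and $\delta_n\sum_{|x|>L_n}\|C(\delta_nx)\|_{\rm tr}\to0$; (b) $\|f(\theta;\delta_n)-f(\theta;\delta_\infty)\|_{\rm tr}\to0$; (c) and (d): the same as (a) and (b) with $\check C,\check f$ in place of $C,f$; (e) $\delta_n^2\sum_{x_1,x_2\in\mathbb Z}|\langle C(\delta_nx_1)u_k,u_k\rangle|\,|\langle C(\delta_nx_2)u_\ell,u_\ell\rangle|\le a_{k,\ell}$ for all $n,k,\ell$, with $\sum_{k,\ell}a_{k,\ell}<\infty$; (f) $\delta_n^2\sum_{x_1,x_2\in\mathbb Z}|\langle\check C(\delta_nx_1)\overline{u_k},u_\ell\rangle|\,|\langle\check C(\delta_nx_2)\overline{u_k},u_\ell\rangle|\le b_{k,\ell}$ for all $n,k,\ell$, with $\sum_{k,\ell}b_{k,\ell}<\infty$. Finally assume $c(\theta)=0$, where $c(\theta)=\mathbf 1\{\theta=0\}$ if $\delta_\infty=0$ and $c(\theta)=\mathbf 1\{\theta\in\{0,\pm\pi/\delta_\infty\}\}$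 if $\delta_\infty>0$. \textbf{Objects.} Let $$\hat f_n(\theta)=\frac{\delta_n}{2\pi n}\sum_{i,j=1}^ne^{\mathrm i(i-j)\delta_n\theta}K\!\Big(\frac{i-j}{\Delta_n}\delta_n\Big)X(\delta_ni)\otimes X(\delta_nj),\qquad \mathcal T_n(\theta)=\sqrt{\frac{n\delta_n}{\Delta_n}}\,\big[\hat f_n(\theta)-\mathbb E\hat f_n(\theta)\big].$$ Let $\{e_i\}$ be a CONS of $\mathbb H$ and $\lambda_i\in\mathbb R$ with $f(\theta;\delta_\infty)=\sum_i\lambda_i\,e_i\otimes e_i$. Let $Z_{i,j}=\xi_{i,j}+\mathrm i\,\eta_{i,j}$ and $Z_{j,i}=\overline{Z_{i,j}}$ for $i<j$, where $\xi_{i,j},\eta_{i,j}$ are $N(0,1/2)$, and let $Z_{i,i}$ be real $N(0,1)$, all the variables $\xi_{i,j},\eta_{i,j}$ ($i<j$) and $Z_{i,i}$ being independent. \textbf{Claim.} The series $\sum_{i,j}\sqrt{\lambda_i\lambda_j}\,Z_{i,j}\,e_i\otimes e_j$ converges (unconditionally) in $\mathbb X$ almost surely, $\mathcal T_n(\theta)$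 converges in distribution in $\mathbb X$, and its limit $\mathcal T(\theta)$ is a zero-mean square-integrable Gaussian element of $\mathbb X$ with $$\mathcal T(\theta)\stackrel{d}{=}\|K\|_2\sum_{i,j}\sqrt{\lambda_i\lambda_j}\,Z_{i,j}\,e_i\otimes e_j .$$ Its covariance operator is $$\mathbb E[\mathcal T(\theta)\otimes_{\rm HS}\mathcal T(\theta)]=\|K\|_2^2\sum_{i,j}\lambda_i\lambda_j\,(e_i\otimes e_j)\otimes_{\rm HS}(e_i\otimes e_j).$$ The family $\{e_i\otimes e_j\}_{i,j}$ is a CONS of $\mathbb X$ that diagonalizes this operator: $e_i\otimes e_j$ is an eigenvector with eigenvalue $\|K\|_2^2\lambda_i\lambda_j$. -/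

import Mathlib

open MeasureTheory ProbabilityTheory Filter Topology
open scoped ENNReal NNReal ComplexConjugate InnerProductSpace

noncomputable section

namespace FunctionalCLT

section HilbertSchmidt

variable (H : Type*) [NormedAddCommGroup H] [InnerProductSpace ℂ H] [CompleteSpace H]

/-- Index set of a fixed (arbitrarily chosen) complete orthonormal system of `H`. -/
def StdIndex : Set H := (exists_hilbertBasis ℂ H).choose

/-- A fixed (arbitrarily chosen) complete orthonormal system of `H`. The notions defined with it
do not depend on the choice, see `tsum_enorm_sq_eq`, `HS.hasSum_norm_sq` and `traceNorm_eq`. -/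
def stdBasis : HilbertBasis (StdIndex H) ℂ H := (exists_hilbertBasis ℂ H).choose_spec.choose

variable {H}

theorem enorm_sq_eq_tsum {ι : Type*} (b : HilbertBasis ι ℂ H) (x : H) :
    ‖x‖ₑ ^ 2 = ∑' i, ‖⟪b i, x⟫_ℂ‖ₑ ^ 2 := by
  have h1 : HasSum (fun i => ‖⟪b i, x⟫_ℂ‖ ^ 2) (‖x‖ ^ 2) := by
    have h := lp.hasSum_norm (p := 2) (by norm_num) (b.repr x)
    simpa [b.repr_apply_apply] using h
  rw [← ofReal_norm, ← ENNReal.ofReal_pow (norm_nonneg _), ← h1.tsum_eq,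
    ENNReal.ofReal_tsum_of_nonneg (fun _ => by positivity) h1.summable]
  refine tsum_congr fun i => ?_
  rw [← ofReal_norm, ENNReal.ofReal_pow (norm_nonneg _)]

theorem tsum_enorm_sq_adjoint {ι κ : Type*} (b : HilbertBasis ι ℂ H) (c : HilbertBasis κ ℂ H)
    (A : H →L[ℂ] H) : ∑' i, ‖A (b i)‖ₑ ^ 2 = ∑' j, ‖A.adjoint (c j)‖ₑ ^ 2 := by
  calc ∑' i, ‖A (b i)‖ₑ ^ 2 = ∑' i, ∑' j, ‖⟪c j, A (b i)⟫_ℂ‖ₑ ^ 2 :=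
        tsum_congr fun i => enorm_sq_eq_tsum c _
    _ = ∑' j, ∑' i, ‖⟪c j, A (b i)⟫_ℂ‖ₑ ^ 2 := ENNReal.tsum_comm
    _ = ∑' j, ∑' i, ‖⟪b i, A.adjoint (c j)⟫_ℂ‖ₑ ^ 2 := by
        refine tsum_congr fun j => tsum_congr fun i => ?_
        rw [← ContinuousLinearMap.adjoint_inner_left, ← inner_conj_symm, ← ofReal_norm,
          RCLike.norm_conj, ofReal_norm]
    _ = ∑' j, ‖A.adjoint (c j)‖ₑ ^ 2 := tsum_congr fun j => (enorm_sq_eq_tsum b _).symm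

/-- `∑ ‖A bᵢ‖²` is the same for all complete orthonormal systems `b`. -/
theorem tsum_enorm_sq_eq {ι κ : Type*} (b : HilbertBasis ι ℂ H) (c : HilbertBasis κ ℂ H)
    (A : H →L[ℂ] H) : ∑' i, ‖A (b i)‖ₑ ^ 2 = ∑' j, ‖A (c j)‖ₑ ^ 2 := by
  rw [tsum_enorm_sq_adjoint b c A, tsum_enorm_sq_adjoint c c A]

variable (H) in
/-- The Hilbert-Schmidt operators on `H`, as a subspace of the bounded operators. -/
def hsSubmodule : Submodule ℂ (H →L[ℂ] H) where
  carrier := {A | Summable fun i => ‖A (stdBasis H i)‖ ^ 2}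
  zero_mem' := by simp
  add_mem' := by
    intro A B hA hB
    refine Summable.of_nonneg_of_le (fun _ => by positivity) (fun i => ?_)
      ((hA.add hB).mul_left 2)
    have h1 : ‖(A + B) (stdBasis H i)‖ ≤ ‖A (stdBasis H i)‖ + ‖B (stdBasis H i)‖ := by
      simpa using norm_add_le (A (stdBasis H i)) (B (stdBasis H i))
    nlinarith [sq_nonneg (‖A (stdBasis H i)‖ - ‖B (stdBasis H i)‖),
      norm_nonneg ((A + B) (stdBasis H i)), norm_nonneg (A (stdBasis H i)),
      norm_nonneg (B (stdBasis H i))]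
  smul_mem' := by
    intro c A hA
    have h : (fun i => ‖(c • A) (stdBasis H i)‖ ^ 2)
        = fun i => ‖c‖ ^ 2 * ‖A (stdBasis H i)‖ ^ 2 := by
      funext i
      simp [norm_smul, mul_pow]
    simp only [Set.mem_ofPred_eq, h]
    exact hA.mul_left _

variable (H) in
/-- The space `𝕏` of Hilbert-Schmidt operators on `H`. It carries the Hilbert-Schmidt inner product
`⟪A, B⟫ = ∑ ⟪A bᵢ, B bᵢ⟫ = trace (A* B)`, not the operator norm. -/
def HS : Type _ := hsSubmodule H

instance : AddCommGroup (HS H) := inferInstanceAs (AddCommGroup (hsSubmodule H))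

instance : Module ℂ (HS H) := inferInstanceAs (Module ℂ (hsSubmodule H))

/-- The bounded operator underlying a Hilbert-Schmidt operator. -/
def HS.toCLM : HS H →ₗ[ℂ] (H →L[ℂ] H) := (hsSubmodule H).subtype

theorem HS.toCLM_injective : Function.Injective (HS.toCLM (H := H)) :=
  (hsSubmodule H).injective_subtype

theorem HS.memℓp (A : HS H) : Memℓp (fun i => A.toCLM (stdBasis H i)) 2 := by
  refine memℓp_gen ?_
  have h : Summable fun i => ‖A.toCLM (stdBasis H i)‖ ^ 2 := A.2
  simpa using h

/-- `A ↦ (A bᵢ)ᵢ`, from the Hilbert-Schmidt operators to the Hilbert sum of copies of `H`. -/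
def HS.toLp : HS H →ₗ[ℂ] lp (fun _ : StdIndex H => H) 2 where
  toFun A := ⟨fun i => A.toCLM (stdBasis H i), A.memℓp⟩
  map_add' A B := by
    ext i
    simp only [map_add]
    rfl
  map_smul' c A := by
    ext i
    simp only [map_smul]
    rfl

theorem HS.toLp_apply (A : HS H) (i : StdIndex H) : HS.toLp A i = A.toCLM (stdBasis H i) := rfl

theorem HS.toLp_injective : Function.Injective (HS.toLp (H := H)) := by
  intro A B h
  apply HS.toCLM_injective
  refine ContinuousLinearMap.ext_on
    (Submodule.dense_iff_topologicalClosure_eq_top.mpr (stdBasis H).dense_span) ?_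
  rintro _ ⟨i, rfl⟩
  have := congrArg (fun f : lp (fun _ : StdIndex H => H) 2 => f i) h
  simpa [HS.toLp_apply] using this

theorem HS.toLp_surjective : Function.Surjective (HS.toLp (H := H)) := by
  intro f
  have hf : Summable fun i => ‖f i‖ ^ (2 : ℝ) := by
    have := lp.memℓp f
    simpa using this.summable (by norm_num)
  have hx : ∀ x : H, HasSum (fun i => ‖(stdBasis H).repr x i‖ ^ (2 : ℝ)) (‖x‖ ^ (2 : ℝ)) := by
    intro x
    have := lp.hasSum_norm (p := 2) (by norm_num) ((stdBasis H).repr x)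
    simpa using this
  have hc : (2 : ℝ).HolderConjugate 2 := Real.holderConjugate_iff.mpr ⟨by norm_num, by norm_num⟩
  have hs : ∀ x : H, Summable fun i => ‖(stdBasis H).repr x i‖ * ‖f i‖ := fun x =>
    Real.summable_mul_of_Lp_Lq_of_nonneg hc
      (fun _ => norm_nonneg _) (fun _ => norm_nonneg _) (hx x).summable hf
  have hle : ∀ x : H, ∑' i, ‖(stdBasis H).repr x i‖ * ‖f i‖
      ≤ (∑' i, ‖f i‖ ^ (2 : ℝ)) ^ (1 / (2 : ℝ)) * ‖x‖ := by
    intro x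
    have h := Real.inner_le_Lp_mul_Lq_tsum_of_nonneg hc
      (fun _ => norm_nonneg _) (fun _ => norm_nonneg _) (hx x).summable hf
    rw [(hx x).tsum_eq, ← Real.rpow_mul (norm_nonneg _)] at h
    rw [mul_comm]
    simpa using h
  have hs' : ∀ x : H, Summable fun i => (stdBasis H).repr x i • f i := fun x =>
    Summable.of_norm (by simpa [norm_smul] using hs x)
  let L : H →ₗ[ℂ] H :=
    { toFun := fun x => ∑' i, (stdBasis H).repr x i • f i
      map_add' := by
        intro x y
        rw [← (hs' x).tsum_add (hs' y)]
        refine tsum_congr fun i => ?_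
        simp [add_smul]
      map_smul' := by
        intro c x
        rw [RingHom.id_apply, ← (hs' x).tsum_const_smul]
        refine tsum_congr fun i => ?_
        simp [mul_smul] }
  let A : H →L[ℂ] H := L.mkContinuous ((∑' i, ‖f i‖ ^ (2 : ℝ)) ^ (1 / (2 : ℝ))) (by
    intro x
    refine le_trans (norm_tsum_le_tsum_norm (by simpa [norm_smul] using hs x)) ?_
    simpa [norm_smul] using hle x)
  have hA : ∀ i, A (stdBasis H i) = f i := by
    classical
    intro i
    change ∑' j, (stdBasis H).repr (stdBasis H i) j • f j = f i
    rw [(stdBasis H).repr_self]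
    rw [tsum_eq_single i]
    · simp
    · intro j hj
      simp [lp.single_apply, hj]
  have hmem : A ∈ hsSubmodule H := by
    change Summable fun i => ‖A (stdBasis H i)‖ ^ 2
    simpa [hA] using hf
  refine ⟨⟨A, hmem⟩, ?_⟩
  ext i
  exact hA i

instance : NormedAddCommGroup (HS H) :=
  NormedAddCommGroup.induced (HS H) (lp (fun _ : StdIndex H => H) 2) HS.toLp HS.toLp_injective

/-- The Hilbert-Schmidt inner product. -/
instance : InnerProductSpace ℂ (HS H) :=
  { NormedSpace.induced ℂ (HS H) (lp (fun _ : StdIndex H => H) 2) HS.toLp with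
    inner := fun A B => ⟪HS.toLp A, HS.toLp B⟫_ℂ
    norm_sq_eq_re_inner := fun A => norm_sq_eq_re_inner (𝕜 := ℂ) (HS.toLp A)
    conj_inner_symm := fun A B => inner_conj_symm (𝕜 := ℂ) (HS.toLp A) (HS.toLp B)
    add_left := fun A B C => by
      change ⟪HS.toLp (A + B), HS.toLp C⟫_ℂ = _
      rw [map_add, inner_add_left]
    smul_left := fun A B c => by
      change ⟪HS.toLp (c • A), HS.toLp B⟫_ℂ = _
      rw [map_smul, inner_smul_left] }

theorem HS.inner_def (A B : HS H) :
    ⟪A, B⟫_ℂ = ∑' i, ⟪A.toCLM (stdBasis H i), B.toCLM (stdBasis H i)⟫_ℂ :=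
  lp.inner_eq_tsum (HS.toLp A) (HS.toLp B)

/-- The Hilbert-Schmidt space is isometric to a Hilbert sum of copies of `H`. -/
def HS.equivLp : HS H ≃ₗᵢ[ℂ] lp (fun _ : StdIndex H => H) 2 where
  toLinearEquiv := LinearEquiv.ofBijective HS.toLp ⟨HS.toLp_injective, HS.toLp_surjective⟩
  norm_map' := fun _ => rfl

instance : CompleteSpace (HS H) :=
  (HS.equivLp (H := H)).toIsometryEquiv.completeSpace

instance : MeasurableSpace (HS H) := borel _

instance : BorelSpace (HS H) := ⟨rfl⟩

/-- `‖A‖² = ∑ ‖A bᵢ‖²` for every complete orthonormal system `b`. -/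
theorem HS.hasSum_norm_sq {ι : Type*} (b : HilbertBasis ι ℂ H) (A : HS H) :
    HasSum (fun i => ‖A.toCLM (b i)‖ ^ 2) (‖A‖ ^ 2) := by
  have h0 : HasSum (fun i => ‖A.toCLM (stdBasis H i)‖ ^ 2) (‖A‖ ^ 2) := by
    have h : HasSum (fun i => ‖HS.toLp A i‖ ^ 2) (‖HS.toLp A‖ ^ 2) := by
      simpa using lp.hasSum_norm (p := 2) (by norm_num) (HS.toLp A)
    exact h
  have e : ∀ x : H, ENNReal.ofReal (‖x‖ ^ 2) = ‖x‖ₑ ^ 2 := fun x => by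
    rw [ENNReal.ofReal_pow (norm_nonneg _), ofReal_norm]
  have h1 : ∑' i, ENNReal.ofReal (‖A.toCLM (b i)‖ ^ 2) = ENNReal.ofReal (‖A‖ ^ 2) := by
    simp_rw [← h0.tsum_eq]
    rw [ENNReal.ofReal_tsum_of_nonneg (fun _ => by positivity) h0.summable]
    simp_rw [e]
    exact tsum_enorm_sq_eq b (stdBasis H) A.toCLM
  have h2 : Summable fun i => ‖A.toCLM (b i)‖ ^ 2 := by
    have := ENNReal.summable_toReal (h1.trans_ne ENNReal.ofReal_ne_top)
    refine this.congr fun i => ?_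
    rw [ENNReal.toReal_ofReal (by positivity)]
  rw [← ENNReal.ofReal_tsum_of_nonneg (fun _ => by positivity) h2,
    ENNReal.ofReal_eq_ofReal_iff (tsum_nonneg fun _ => by positivity) (by positivity)] at h1
  exact h1 ▸ h2.hasSum

/-- The outer product `x ⊗ y : z ↦ ⟨z, y⟩ x` (inner product linear in its first argument),
as a Hilbert-Schmidt operator. -/
def HS.outer (x y : H) : HS H :=
  ⟨InnerProductSpace.rankOne ℂ x y, by
    change Summable fun i => ‖InnerProductSpace.rankOne ℂ x y (stdBasis H i)‖ ^ 2
    have := lp.hasSum_norm (p := 2) (by norm_num) ((stdBasis H).repr y)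
    have h : Summable fun i => ‖(stdBasis H).repr y i‖ ^ 2 := by simpa using this.summable
    refine (h.mul_right (‖x‖ ^ 2)).congr fun i => ?_
    rw [InnerProductSpace.rankOne_apply, norm_smul, mul_pow, (stdBasis H).repr_apply_apply,
      norm_inner_symm]⟩

/-- The trace norm `∑ ⟨(A* A)^{1/2} bᵢ, bᵢ⟩` of a bounded operator, infinite if the operator is
not of trace class. -/
def traceNorm (A : H →L[ℂ] H) : ℝ≥0∞ :=
  ∑' i, ENNReal.ofReal (⟪CFC.abs A (stdBasis H i), stdBasis H i⟫_ℂ).re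

/-- The trace norm can be computed in any complete orthonormal system. -/
theorem traceNorm_eq {ι : Type*} (b : HilbertBasis ι ℂ H) (A : H →L[ℂ] H) :
    traceNorm A = ∑' i, ENNReal.ofReal (⟪CFC.abs A (b i), b i⟫_ℂ).re := by
  have h : ∀ x : H, ENNReal.ofReal (⟪CFC.abs A x, x⟫_ℂ).re
      = ‖CFC.sqrt (CFC.abs A) x‖ₑ ^ 2 := by
    intro x
    have h1 : CFC.sqrt (CFC.abs A) * CFC.sqrt (CFC.abs A) = CFC.abs A :=
      CFC.sqrt_mul_sqrt_self _ (CFC.abs_nonneg A)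
    have h2 : IsSelfAdjoint (CFC.sqrt (CFC.abs A)) := (CFC.sqrt_nonneg _).isSelfAdjoint
    have h3 : ⟪CFC.abs A x, x⟫_ℂ
        = ⟪CFC.sqrt (CFC.abs A) x, CFC.sqrt (CFC.abs A) x⟫_ℂ := by
      conv_lhs => rw [← h1]
      rw [mul_apply_eq_comp, ← ContinuousLinearMap.adjoint_inner_right,
        h2.adjoint_eq]
    rw [h3, ← ofReal_norm, ← ENNReal.ofReal_pow (norm_nonneg _),
      norm_sq_eq_re_inner (𝕜 := ℂ)]
    rfl
  unfold traceNorm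
  simp_rw [h]
  exact tsum_enorm_sq_eq _ _ _

/-- Complex conjugation on `H` with respect to a designated `real` complete orthonormal system:
`x = ∑ xⱼ rⱼ ↦ ∑ conj(xⱼ) rⱼ`. -/
def conjVec {κ : Type*} (r : HilbertBasis κ ℂ H) (x : H) : H :=
  r.repr.symm (star (r.repr x))

end HilbertSchmidt

/-- `𝔼[Y ⊗ Z]`, where `(y ⊗ z) w = ⟨w, z⟩ y` (inner product linear in its first argument). -/
def crossCov {E : Type*} [NormedAddCommGroup E] [InnerProductSpace ℂ E] [CompleteSpace E]
    {Ω : Type*} [MeasurableSpace Ω] (P : Measure Ω) (Y Z : Ω → E) : E →L[ℂ] E :=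
  ∫ ω, InnerProductSpace.rankOne ℂ (Y ω) (Z ω) ∂P

section StationaryModel

variable {H : Type*} [NormedAddCommGroup H] [InnerProductSpace ℂ H] [CompleteSpace H]
  {Ω : Type*} [MeasurableSpace Ω]

/-- The stationary covariance operator `C(h) = 𝔼[X(h) ⊗ X(0)]`. -/
def covOp (P : Measure Ω) (X : ℝ → Ω → H) (h : ℝ) : H →L[ℂ] H :=
  crossCov P (X h) (X 0)

/-- The stationary pseudo-covariance operator `Č(h) = 𝔼[X(h) ⊗ conj X(0)]`. -/
def pseudoCovOp {κ : Type*} (P : Measure Ω) (r : HilbertBasis κ ℂ H) (X : ℝ → Ω → H) (h : ℝ) :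
    H →L[ℂ] H :=
  crossCov P (X h) (fun ω => conjVec r (X 0 ω))

/-- Zero-mean Gaussian process in the complex Hilbert space `H` (jointly Gaussian over `ℝ`) whose
covariance `C(t, s)` and pseudo-covariance `Č(t, s)` depend only on `t - s`. -/
structure IsStationaryGaussian [MeasurableSpace H] {κ : Type*} (P : Measure Ω)
    (r : HilbertBasis κ ℂ H) (X : ℝ → Ω → H) : Prop where
  gaussian : IsGaussianProcess X P
  zero_mean : ∀ t, ∫ ω, X t ω ∂P = 0
  cov_stationary : ∀ t s h, crossCov P (X (t + h)) (X (s + h)) = crossCov P (X t) (X s)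
  pseudoCov_stationary : ∀ t s h,
    crossCov P (X (t + h)) (fun ω => conjVec r (X (s + h) ω))
      = crossCov P (X t) (fun ω => conjVec r (X s ω))

/-- For an operator-valued function `G` on `ℝ`: the (folded, if `δ > 0`) Fourier transform
`(δ / 2π) ∑ₖ exp(𝕚 k θ δ) G(k δ)` if `δ ≠ 0` and `(1 / 2π) ∫ exp(𝕚 x θ) G(x) dx` if `δ = 0`. -/
def foldedFourier (G : ℝ → H →L[ℂ] H) (θ δ : ℝ) : H →L[ℂ] H :=
  if δ = 0 then
    ((1 / (2 * Real.pi) : ℝ) : ℂ) • ∫ x : ℝ, Complex.exp (Complex.I * (x * θ : ℝ)) • G x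
  else
    ((δ / (2 * Real.pi) : ℝ) : ℂ) • ∑' k : ℤ, Complex.exp (Complex.I * (k * θ * δ : ℝ)) • G (k * δ)

/-- The spectral density `f(θ; δ)`, with `f(θ; 0) = f(θ)`. -/
def specDensity (P : Measure Ω) (X : ℝ → Ω → H) (θ δ : ℝ) : H →L[ℂ] H :=
  foldedFourier (covOp P X) θ δ

/-- The pseudo-spectral density `f̌(θ; δ)`, with `f̌(θ; 0) = f̌(θ)`. -/
def pseudoSpecDensity {κ : Type*} (P : Measure Ω) (r : HilbertBasis κ ℂ H) (X : ℝ → Ω → H)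
    (θ δ : ℝ) : H →L[ℂ] H :=
  foldedFourier (pseudoCovOp P r X) (-θ) δ

/-- The condition under which `foldedFourier G θ δ` is well defined: `∑ₖ ‖G(k δ)‖_tr < ∞` if
`δ ≠ 0`, and Bochner integrability `∫ ‖G(x)‖_tr dx < ∞` if `δ = 0`. -/
def IsTraceIntegrable (G : ℝ → H →L[ℂ] H) (δ : ℝ) : Prop :=
  if δ = 0 then AEStronglyMeasurable G volume ∧ ∫⁻ x : ℝ, traceNorm (G x) < ⊤
  else ∑' k : ℤ, traceNorm (G (k * δ)) < ⊤

/-- The conditions on the process, on the grid sizes `δ n`, on the bandwidths `Δ n` and on the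
auxiliary constants `L n` under which the central limit theorem is considered; `r` is the real
complete orthonormal system and `e₀` an arbitrary fixed one. -/
structure CLTCondition {κ κ' : Type*} (P : Measure Ω) (r : HilbertBasis κ ℂ H)
    (e₀ : HilbertBasis κ' ℂ H) (X : ℝ → Ω → H) (δ Δ L : ℕ → ℝ) (δinf θ : ℝ) : Prop where
  grid_pos : ∀ n, 0 < δ n
  bandwidth_pos : ∀ n, 0 < Δ n
  L_pos : ∀ n, 0 < L n
  limit_nonneg : 0 ≤ δinf
  grid_tendsto : Tendsto δ atTop (𝓝 δinf)
  domain_tendsto : Tendsto (fun n => n * δ n / Δ n) atTop atTop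
  L_grid_tendsto : Tendsto (fun n => L n * δ n) atTop atTop
  L_bandwidth_tendsto : Tendsto (fun n => L n / Δ n) atTop (𝓝 0)
  cov_wellDefined : IsTraceIntegrable (covOp P X) δinf
  pseudoCov_wellDefined : IsTraceIntegrable (pseudoCovOp P r X) δinf
  cov_bdd : ⨆ n, ENNReal.ofReal (δ n) * ∑' x : ℤ, traceNorm (covOp P X (δ n * x)) < ⊤
  cov_tail : Tendsto (fun n => ENNReal.ofReal (δ n) *
    ∑' x : {x : ℤ // L n < |(x : ℝ)|}, traceNorm (covOp P X (δ n * (x : ℤ)))) atTop (𝓝 0)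
  specDensity_tendsto : Tendsto
    (fun n => traceNorm (specDensity P X θ (δ n) - specDensity P X θ δinf)) atTop (𝓝 0)
  pseudoCov_bdd :
    ⨆ n, ENNReal.ofReal (δ n) * ∑' x : ℤ, traceNorm (pseudoCovOp P r X (δ n * x)) < ⊤
  pseudoCov_tail : Tendsto (fun n => ENNReal.ofReal (δ n) *
    ∑' x : {x : ℤ // L n < |(x : ℝ)|}, traceNorm (pseudoCovOp P r X (δ n * (x : ℤ)))) atTop (𝓝 0)
  pseudoSpecDensity_tendsto : Tendsto
    (fun n => traceNorm (pseudoSpecDensity P r X θ (δ n) - pseudoSpecDensity P r X θ δinf))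
    atTop (𝓝 0)
  cov_coord : ∃ a : κ' → κ' → ℝ≥0∞, (∀ n k l, ENNReal.ofReal (δ n ^ 2) *
      ∑' (x₁ : ℤ) (x₂ : ℤ), ‖⟪e₀ k, covOp P X (δ n * x₁) (e₀ k)⟫_ℂ‖ₑ *
        ‖⟪e₀ l, covOp P X (δ n * x₂) (e₀ l)⟫_ℂ‖ₑ ≤ a k l) ∧ ∑' (k) (l), a k l < ⊤
  pseudoCov_coord : ∃ b : κ' → κ' → ℝ≥0∞, (∀ n k l, ENNReal.ofReal (δ n ^ 2) *
      ∑' (x₁ : ℤ) (x₂ : ℤ), ‖⟪e₀ l, pseudoCovOp P r X (δ n * x₁) (conjVec r (e₀ k))⟫_ℂ‖ₑ *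
        ‖⟪e₀ l, pseudoCovOp P r X (δ n * x₂) (conjVec r (e₀ k))⟫_ℂ‖ₑ ≤ b k l) ∧
      ∑' (k) (l), b k l < ⊤

/-- The conditions on the kernel. -/
structure IsCLTKernel (K : ℝ → ℝ) : Prop where
  nonneg : ∀ x, 0 ≤ K x
  compact_support : HasCompactSupport K
  even : ∀ x, K (-x) = K x
  boundedVariation : BoundedVariationOn K Set.univ

/-- `‖K‖₂`. -/
def kernelNorm (K : ℝ → ℝ) : ℝ := Real.sqrt (∫ x, K x ^ 2)

/-- The spectral density estimator
`f̂ₙ(θ) = δₙ / (2πn) ∑_{i,j=1}^n exp(𝕚 (i - j) δₙ θ) K((i - j) δₙ / Δₙ) X(δₙ i) ⊗ X(δₙ j)`. -/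
def specEstimator (X : ℝ → Ω → H) (K : ℝ → ℝ) (δ Δ : ℕ → ℝ) (θ : ℝ) (n : ℕ) (ω : Ω) : HS H :=
  ((δ n / (2 * Real.pi * n) : ℝ) : ℂ) • ∑ i ∈ Finset.Icc 1 n, ∑ j ∈ Finset.Icc 1 n,
    (Complex.exp (Complex.I * (((i : ℝ) - j) * δ n * θ : ℝ)) *
      (K (((i : ℝ) - j) / Δ n * δ n) : ℂ)) • HS.outer (X (δ n * i) ω) (X (δ n * j) ω)

/-- `𝒯ₙ(θ) = √(n δₙ / Δₙ) (f̂ₙ(θ) - 𝔼 f̂ₙ(θ))`, a random element of `𝕏`. -/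
def cltStat (P : Measure Ω) (X : ℝ → Ω → H) (K : ℝ → ℝ) (δ Δ : ℕ → ℝ) (θ : ℝ) (n : ℕ) (ω : Ω) :
    HS H :=
  ((Real.sqrt (n * δ n / Δ n) : ℝ) : ℂ) •
    (specEstimator X K δ Δ θ n ω - ∫ ω', specEstimator X K δ Δ θ n ω' ∂P)

end StationaryModel

/-- `c(θ)`: the indicator of `θ = 0` if `δinf = 0` and of `θ ∈ {0, ±π / δinf}` if `δinf > 0`. -/
def cIndicator (δinf θ : ℝ) : ℝ :=
  if δinf = 0 then (if θ = 0 then 1 else 0)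
  else (if θ = 0 ∨ θ = Real.pi / δinf ∨ θ = -(Real.pi / δinf) then 1 else 0)

/-- `Z i j = ξ i j + 𝕚 η i j` for `i < j` with `ξ i j`, `η i j` of law `N(0, 1/2)`, `Z i i` real of
law `N(0, 1)`, `Z j i = conj (Z i j)`, and all the real variables `ξ i j`, `η i j` (`i < j`) and
`Z i i` independent. -/
structure IsHermitianGaussianArray {ι : Type*} [LinearOrder ι] {Ω : Type*} [MeasurableSpace Ω]
    (P : Measure Ω) (Z : ι → ι → Ω → ℂ) : Prop where
  measurable : ∀ i j, Measurable (Z i j)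
  hermitian : ∀ i j ω, Z j i ω = conj (Z i j ω)
  law_re : ∀ i j, i < j → HasLaw (fun ω => (Z i j ω).re) (gaussianReal 0 (1 / 2)) P
  law_im : ∀ i j, i < j → HasLaw (fun ω => (Z i j ω).im) (gaussianReal 0 (1 / 2)) P
  law_diag : ∀ i, HasLaw (fun ω => (Z i i ω).re) (gaussianReal 0 1) P
  /-- The pair `p` with `p.1 ≤ p.2` stands for `Re (Z p.1 p.2)`, the pair `p` with `p.2 < p.1` for
  `Im (Z p.2 p.1)`; this lists every variable exactly once. -/
  indep : iIndepFun (fun (p : ι × ι) ω =>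
    if p.1 ≤ p.2 then (Z p.1 p.2 ω).re else (Z p.2 p.1 ω).im) P

section Limit

variable {H : Type*} [NormedAddCommGroup H] [InnerProductSpace ℂ H] [CompleteSpace H]
  {ι : Type*} {Ω : Type*}

/-- The terms `√(λᵢ λⱼ) Z i j eᵢ ⊗ eⱼ` of the expansion. -/
def klTerm (e : HilbertBasis ι ℂ H) (lam : ι → ℝ) (Z : ι → ι → Ω → ℂ) (ω : Ω) (p : ι × ι) : HS H :=
  ((Real.sqrt (lam p.1 * lam p.2) : ℂ) * Z p.1 p.2 ω) • HS.outer (e p.1) (e p.2)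

/-- The random element `‖K‖₂ ∑_{i,j} √(λᵢ λⱼ) Z i j eᵢ ⊗ eⱼ` of `𝕏`. -/
def klSeries (K : ℝ → ℝ) (e : HilbertBasis ι ℂ H) (lam : ι → ℝ) (Z : ι → ι → Ω → ℂ) (ω : Ω) :
    HS H :=
  (kernelNorm K : ℂ) • ∑' p : ι × ι, klTerm e lam Z ω p

end Limit

end FunctionalCLT

end

open FunctionalCLT

/-! The coordinate of the statistic along `u ⊗ v` is a normalized, centred bilinear form in the
jointly Gaussian scalars `⟪u, X(δi)⟫` and the conjugates of `⟪v, X(δj)⟫`. Everything follows from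
the second moments of these coordinates and from the smallness of the spectral radius of the forms.

Second moments. Wick's formula for four complex Gaussians leaves two pairings once the means are
subtracted. Sorted by time lags (`integral_inner_cltStat_mul_conj`), the first pairing involves only
the covariance; its weights are sums of `k(d + a - b) k(d)` over the sampled kernel `k`. Up to lag
`L` the shift is harmless, beyond it the covariance is negligible, and a Riemann sum produces `‖K‖₂²
⟪u, f u'⟫ conj ⟪v, f v'⟫` (`tendsto_lagSum_one`). The second pairing involves the pseudo-covariance,
and its weights keep the oscillating factor `exp(2𝕚θδ(i-j))`. Summation by parts, with `K` of
bounded variation, bounds it by a multiple of `(δ/Δ) / |1 - exp(2𝕚θδ)|`, which tends to zero exactly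
because `c(θ) = 0` (`tendsto_lagSum_osc`).

Gaussian limit. A real linear functional of finitely many coordinates is a quadratic form in a
centred Gaussian vector. Whitening and diagonalizing turn it into `∑ μᵢ (xᵢ² - 1)` with independent
standard normal `xᵢ`. Its characteristic function is a product of factors `exp(-μᵢ²) + o(μᵢ²)`, and
`∑ μᵢ²` is half the variance, so the law is nearly Gaussian once `max |μᵢ|` is small
(`norm_charFun_quadratic_sub_le`). Schur's test for the coefficient matrix and for the covariance
matrix gives `max |μᵢ| = O((nδ/Δ)^{-1/2})`. Together with the limit of the variances this determines
the finite-dimensional limits.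

Infinite dimension. The summability conditions in the system `e₀` dominate the second moments of all
coordinates by one summable family (`exists_summable_bound_cltStat`). Hence truncation to finitely
many coordinates is uniformly good, and testing against bounded Lipschitz functions lifts the
convergence to the Hilbert-Schmidt space (`tendstoInDistribution_of_truncate`).

The limit. The operator `f(θ; δinf)` is positive, as a limit of operators whose quadratic forms are
limits of Fejér sums of variances, and it has finite trace; so `λᵢ ≥ 0` and `∑ λᵢ < ∞`. The
coefficients `√(λᵢλⱼ) Zᵢⱼ` are then almost surely square summable along the orthonormal system `eᵢ ⊗
eⱼ`. The series is Gaussian as an almost sure limit of Gaussians, and its covariance is the limit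
found above (`integral_exp_klSeries`). Any other limit variable has the same law, so it inherits all
the stated properties. -/

namespace FunctionalCLT

/-! ### Outer products, bases and the trace norm -/

section HilbertSchmidtFacts

variable {H : Type*} [NormedAddCommGroup H] [InnerProductSpace ℂ H] [CompleteSpace H]

theorem HS.toCLM_outer (x y : H) : (HS.outer x y).toCLM = InnerProductSpace.rankOne ℂ x y := rfl

theorem HS.toCLM_outer_apply (x y z : H) : (HS.outer x y).toCLM z = ⟪y, z⟫_ℂ • x := by
  rw [HS.toCLM_outer, InnerProductSpace.rankOne_apply]

/-- Expand `y` in the standard system and apply the continuous functional `⟪x, A ·⟫`. Coordinates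
along outer products are therefore matrix entries of the operator. -/
theorem HS.inner_outer_left (x y : H) (A : HS H) :
    ⟪HS.outer x y, A⟫_ℂ = ⟪x, A.toCLM y⟫_ℂ := by
  rw [HS.inner_def]
  have h := ((stdBasis H).hasSum_repr y).mapL ((innerSL ℂ x).comp A.toCLM)
  simp only [ContinuousLinearMap.comp_apply, innerSL_apply_apply, map_smul] at h
  rw [← h.tsum_eq]
  refine tsum_congr fun i => ?_
  rw [HS.toCLM_outer_apply, inner_smul_left, inner_conj_symm, (stdBasis H).repr_apply_apply,
    smul_eq_mul]

theorem HS.inner_outer_outer (x y z w : H) :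
    ⟪HS.outer x y, HS.outer z w⟫_ℂ = ⟪x, z⟫_ℂ * ⟪w, y⟫_ℂ := by
  rw [HS.inner_outer_left, HS.toCLM_outer_apply, inner_smul_right, mul_comm]

theorem HS.norm_outer (x y : H) : ‖HS.outer x y‖ = ‖x‖ * ‖y‖ := by
  have h : (‖HS.outer x y‖ ^ 2 : ℝ) = (‖x‖ * ‖y‖) ^ 2 := by
    have := inner_self_eq_norm_sq_to_K (𝕜 := ℂ) (HS.outer x y)
    rw [HS.inner_outer_outer, inner_self_eq_norm_sq_to_K, inner_self_eq_norm_sq_to_K] at this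
    have h2 : ((‖HS.outer x y‖ ^ 2 : ℝ) : ℂ) = (((‖x‖ * ‖y‖) ^ 2 : ℝ) : ℂ) := by
      push_cast
      rw [mul_pow]
      exact this.symm
    exact_mod_cast h2
  exact (pow_left_inj₀ (norm_nonneg _) (by positivity) two_ne_zero).mp h

theorem HS.toCLM_ext {A B : HS H} (h : ∀ x, A.toCLM x = B.toCLM x) : A = B :=
  HS.toCLM_injective (ContinuousLinearMap.ext h)

/-- Bilinearity holds only over `ℝ`, the outer product being conjugate linear in its second
argument. This is enough for joint continuity, hence for measurability. -/
theorem HS.isBoundedBilinearMap_outer :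
    IsBoundedBilinearMap ℝ fun p : H × H => HS.outer p.1 p.2 where
  add_left x y z := HS.toCLM_ext fun w => by simp [HS.toCLM_outer_apply]
  smul_left c x y := HS.toCLM_ext fun w => by
    rw [← Complex.coe_smul, ← Complex.coe_smul, map_smul]
    simp [HS.toCLM_outer_apply, smul_comm _ c]
  add_right x y z := HS.toCLM_ext fun w => by simp [HS.toCLM_outer_apply, add_smul]
  smul_right c x y := HS.toCLM_ext fun w => by
    rw [← Complex.coe_smul, ← Complex.coe_smul, map_smul]
    simp [HS.toCLM_outer_apply, mul_smul]
  bound := ⟨1, one_pos, fun x y => by simp [HS.norm_outer]⟩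

theorem HS.continuous_outer : Continuous fun p : H × H => HS.outer p.1 p.2 :=
  HS.isBoundedBilinearMap_outer.continuous

theorem HS.orthonormal_outer {ι : Type*} (e : HilbertBasis ι ℂ H) :
    Orthonormal ℂ fun p : ι × ι => HS.outer (e p.1) (e p.2) := by
  classical
  rw [orthonormal_iff_ite]
  rintro ⟨i, j⟩ ⟨k, l⟩
  rw [HS.inner_outer_outer, orthonormal_iff_ite.mp e.orthonormal,
    orthonormal_iff_ite.mp e.orthonormal]
  by_cases h1 : i = k <;> by_cases h2 : l = j <;> simp [h1, h2, Prod.ext_iff]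
  exact fun h => (h2 h.symm).elim

/-- The complete orthonormal system `eᵢ ⊗ eⱼ` of the Hilbert-Schmidt operators. -/
noncomputable def HS.outerBasis {ι : Type*} (e : HilbertBasis ι ℂ H) :
    HilbertBasis (ι × ι) ℂ (HS H) :=
  HilbertBasis.mkOfOrthogonalEqBot (HS.orthonormal_outer e) (by
    -- Completeness: an operator orthogonal to every `eᵢ ⊗ eⱼ` has vanishing matrix entries, so it
    -- kills every basis vector.
    rw [Submodule.eq_bot_iff]
    intro A hA
    have h0 : ∀ i j, ⟪e i, A.toCLM (e j)⟫_ℂ = 0 := fun i j => by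
      rw [← HS.inner_outer_left]
      exact (Submodule.mem_orthogonal _ _).mp hA _ (Submodule.subset_span ⟨(i, j), rfl⟩)
    have h1 : ∀ j, A.toCLM (e j) = 0 := fun j => by
      apply e.repr.injective
      ext i
      rw [e.repr_apply_apply, h0]
      simp
    apply HS.toCLM_injective
    refine ContinuousLinearMap.ext_on
      (Submodule.dense_iff_topologicalClosure_eq_top.mpr e.dense_span) ?_
    rintro _ ⟨i, rfl⟩
    simp [h1])

theorem HS.outerBasis_apply {ι : Type*} (e : HilbertBasis ι ℂ H) (p : ι × ι) :
    HS.outerBasis e p = HS.outer (e p.1) (e p.2) := by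
  simp [HS.outerBasis]

-- Distinct basis vectors are at distance at least 1, so sending each one to a point of a countable
-- dense set within distance 1/2 is injective.
omit [CompleteSpace H] in
theorem _root_.HilbertBasis.countable [TopologicalSpace.SeparableSpace H] {ι : Type*}
    (e : HilbertBasis ι ℂ H) : Countable ι := by
  have hd : ∀ i j, i ≠ j → 1 ≤ dist (e i) (e j) := by
    intro i j hij
    have h := norm_sub_sq (𝕜 := ℂ) (e i) (e j)
    rw [e.orthonormal.2 hij, e.orthonormal.1, e.orthonormal.1] at h
    rw [dist_eq_norm]
    norm_num at h
    nlinarith [norm_nonneg (e i - e j)]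
  obtain ⟨s, hs, hsd⟩ := TopologicalSpace.exists_countable_dense H
  have hx : ∀ i, ∃ x ∈ s, dist (e i) x < 1 / 2 := fun i =>
    hsd.exists_dist_lt (e i) (by norm_num)
  choose f hf hfd using hx
  have := hs.to_subtype
  refine Function.Injective.countable (f := fun i => (⟨f i, hf i⟩ : s)) fun i j hij => ?_
  by_contra hne
  have h1 := hd i j hne
  have h2 : f i = f j := by simpa using hij
  have h3 := dist_triangle_right (e i) (e j) (f i)
  have h4 := hfd i
  have h5 := hfd j
  rw [← h2] at h5
  linarith

theorem _root_.HilbertBasis.separableSpace {E : Type*} [NormedAddCommGroup E]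
    [InnerProductSpace ℂ E] {ι : Type*} [Countable ι] (e : HilbertBasis ι ℂ E) :
    TopologicalSpace.SeparableSpace E := by
  have h : TopologicalSpace.IsSeparable (closure (Submodule.span ℂ (Set.range e) : Set E)) :=
    ((Set.countable_range e).isSeparable.span).closure
  have h2 : closure (Submodule.span ℂ (Set.range e) : Set E) = Set.univ := by
    rw [← Submodule.topologicalClosure_coe, e.dense_span, Submodule.top_coe]
  rw [h2] at h
  exact TopologicalSpace.isSeparable_univ_iff.mp h

instance [TopologicalSpace.SeparableSpace H] : TopologicalSpace.SeparableSpace (HS H) :=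
  have := (stdBasis H).countable
  (HS.outerBasis (stdBasis H)).separableSpace

instance [TopologicalSpace.SeparableSpace H] : SecondCountableTopology (HS H) :=
  UniformSpace.secondCountable_of_separable _

/-- Write `S` for the square root of `|A|`. The C*-identity gives `‖A‖ = ‖|A|‖ = ‖S‖²`, and the
operator norm of `S` is at most its Hilbert-Schmidt norm, whose square is the trace norm of `A`.
Trace norm hypotheses thereby become bounds on matrix entries. -/
theorem enorm_le_traceNorm (A : H →L[ℂ] H) : ‖A‖ₑ ≤ traceNorm A := by
  set S : H →L[ℂ] H := CFC.sqrt (CFC.abs A) with hS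
  have h1 : S * S = CFC.abs A := CFC.sqrt_mul_sqrt_self _ (CFC.abs_nonneg A)
  have h2 : IsSelfAdjoint S := (CFC.sqrt_nonneg _).isSelfAdjoint
  have h3 : ∀ x, ⟪CFC.abs A x, x⟫_ℂ = ⟪S x, S x⟫_ℂ := fun x => by
    rw [← h1, mul_apply_eq_comp, ← ContinuousLinearMap.adjoint_inner_right, h2.adjoint_eq]
  have h4 : traceNorm A = ∑' i, ‖S (stdBasis H i)‖ₑ ^ 2 := by
    refine tsum_congr fun i => ?_
    rw [h3, ← ofReal_norm, ← ENNReal.ofReal_pow (norm_nonneg _), norm_sq_eq_re_inner (𝕜 := ℂ)]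
    rfl
  have h5 : ‖A‖ = ‖S‖ ^ 2 := by
    have e1 : ‖A‖ * ‖A‖ = ‖CFC.abs A‖ * ‖CFC.abs A‖ := by
      rw [← CStarRing.norm_star_mul_self, ← CStarRing.norm_star_mul_self,
        ← CFC.abs_mul_abs A, (CFC.abs_nonneg A).isSelfAdjoint.star_eq]
    have e2 : ‖CFC.abs A‖ = ‖S‖ * ‖S‖ := by
      rw [← h1, ← CStarRing.norm_star_mul_self, h2.star_eq]
    have e3 := mul_self_inj_of_nonneg (norm_nonneg _) (norm_nonneg _) |>.mp e1
    rw [e3, e2, sq]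
  by_cases hfin : traceNorm A = ⊤
  · simp [hfin]
  have hsum : ∀ x, ‖S x‖ₑ ^ 2 ≤ traceNorm A * ‖x‖ₑ ^ 2 := by
    intro x
    have hx := enorm_sq_eq_tsum (stdBasis H) (S x)
    rw [hx, h4]
    have e : ∑' i, ‖S (stdBasis H i)‖ₑ ^ 2 * ‖x‖ₑ ^ 2
        = (∑' i, ‖S (stdBasis H i)‖ₑ ^ 2) * ‖x‖ₑ ^ 2 := ENNReal.tsum_mul_right
    rw [← e]
    refine ENNReal.tsum_le_tsum fun i => ?_
    rw [← ContinuousLinearMap.adjoint_inner_left, h2.adjoint_eq, ← mul_pow]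
    gcongr
    rw [← ofReal_norm, ← ofReal_norm, ← ofReal_norm, ← ENNReal.ofReal_mul (norm_nonneg _)]
    exact ENNReal.ofReal_le_ofReal (norm_inner_le_norm _ _)
  have hbound : ‖S‖ ≤ Real.sqrt (traceNorm A).toReal := by
    refine ContinuousLinearMap.opNorm_le_bound _ (Real.sqrt_nonneg _) fun x => ?_
    have h6 := ENNReal.toReal_mono (by finiteness) (hsum x)
    simp only [ENNReal.toReal_pow, ENNReal.toReal_mul, toReal_enorm] at h6
    rw [← Real.sqrt_sq (norm_nonneg x), ← Real.sqrt_mul ENNReal.toReal_nonneg]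
    exact Real.le_sqrt_of_sq_le h6
  rw [← ofReal_norm, h5]
  refine ENNReal.ofReal_le_of_le_toReal ?_
  calc ‖S‖ ^ 2 ≤ Real.sqrt (traceNorm A).toReal ^ 2 := by gcongr
    _ = _ := Real.sq_sqrt ENNReal.toReal_nonneg

/-! ### Complex conjugation of vectors -/

section Conj

variable {κ : Type*} (r : HilbertBasis κ ℂ H)

omit [CompleteSpace H]

/-- Conjugation is antiunitary. This is what makes `⟪u, Č(h) conj v⟫` the mean of the unconjugated
product `⟪u, X(h)⟫ ⟪v, X(0)⟫`. -/
theorem inner_conjVec_conjVec (x y : H) :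
    ⟪conjVec r x, conjVec r y⟫_ℂ = ⟪y, x⟫_ℂ := by
  unfold conjVec
  rw [LinearIsometryEquiv.inner_map_map, ← r.repr.inner_map_map, lp.inner_eq_tsum,
    lp.inner_eq_tsum]
  refine tsum_congr fun i => ?_
  simp [mul_comm]

theorem norm_conjVec (x : H) : ‖conjVec r x‖ = ‖x‖ := by
  unfold conjVec
  rw [LinearIsometryEquiv.norm_map, norm_star, LinearIsometryEquiv.norm_map]

theorem conjVec_sub (x y : H) : conjVec r (x - y) = conjVec r x - conjVec r y := by
  simp [conjVec]

theorem isometry_conjVec : Isometry (conjVec r) :=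
  Isometry.of_dist_eq fun x y => by
    rw [dist_eq_norm, dist_eq_norm, ← conjVec_sub, norm_conjVec]

end Conj

end HilbertSchmidtFacts

end FunctionalCLT

namespace FunctionalCLT

/-! ### Gaussian moments and Wick's formula -/

section GaussianMoments

/-- Each derivative of `exp(t²/2)` is a polynomial times the same exponential; the fourth polynomial
is `3 + 6t² + t⁴`. -/
theorem iteratedDeriv_four_mgf_standard :
    iteratedDeriv 4 (mgf id (gaussianReal 0 1)) 0 = 3 := by
  have h0 : mgf id (gaussianReal 0 1) = fun t : ℝ => Real.exp (t ^ 2 / 2) := by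
    rw [mgf_id_gaussianReal]; ext t; simp
  have hE : ∀ t : ℝ, HasDerivAt (fun t : ℝ => Real.exp (t ^ 2 / 2)) (t * Real.exp (t ^ 2 / 2)) t := by
    intro t
    have := (((hasDerivAt_id t).pow 2).div_const 2).exp
    simp only [id] at this
    convert! this using 1
    simp; ring
  have h1 : deriv (fun t : ℝ => Real.exp (t ^ 2 / 2)) = fun t => t * Real.exp (t ^ 2 / 2) :=
    funext fun t => (hE t).deriv
  have h2 : deriv (fun t : ℝ => t * Real.exp (t ^ 2 / 2))
      = fun t => (1 + t ^ 2) * Real.exp (t ^ 2 / 2) := by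
    funext t
    exact (((hasDerivAt_id' t).mul (hE t)).congr_deriv (by ring)).deriv
  have h3 : deriv (fun t : ℝ => (1 + t ^ 2) * Real.exp (t ^ 2 / 2))
      = fun t => (3 * t + t ^ 3) * Real.exp (t ^ 2 / 2) := by
    funext t
    exact (((((hasDerivAt_id' t).pow 2).const_add 1).mul (hE t)).congr_deriv (by simp; ring)).deriv
  have h4 : deriv (fun t : ℝ => (3 * t + t ^ 3) * Real.exp (t ^ 2 / 2))
      = fun t => (3 + 6 * t ^ 2 + t ^ 4) * Real.exp (t ^ 2 / 2) := by
    funext t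
    exact (((((hasDerivAt_id' t).const_mul 3).add ((hasDerivAt_id' t).pow 3)).mul
      (hE t)).congr_deriv (by simp; ring)).deriv
  rw [h0, iteratedDeriv_succ, iteratedDeriv_succ, iteratedDeriv_succ, iteratedDeriv_one, h1, h2,
    h3, h4]
  simp

theorem integral_pow_four_standard : ∫ x, x ^ 4 ∂(gaussianReal 0 1) = 3 := by
  have h := iteratedDeriv_mgf_zero (X := id) (μ := gaussianReal 0 1) (by simp) 4
  rw [iteratedDeriv_four_mgf_standard] at h
  simpa using h.symm

theorem integral_sq_gaussianReal (v : ℝ≥0) : ∫ x, x ^ 2 ∂(gaussianReal 0 v) = v := by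
  have h := variance_fun_id_gaussianReal (μ := 0) (v := v)
  rw [variance_eq_integral (by fun_prop)] at h
  simpa [integral_id_gaussianReal] using h

theorem integral_pow_four_gaussianReal (v : ℝ≥0) :
    ∫ x, x ^ 4 ∂(gaussianReal 0 v) = 3 * (v : ℝ) ^ 2 := by
  have h : (gaussianReal 0 1).map (fun x => Real.sqrt v * x) = gaussianReal 0 v := by
    rw [gaussianReal_map_const_mul]
    congr 1
    · simp
    · ext; simp
  rw [← h, integral_map (by fun_prop) (by fun_prop)]
  simp_rw [mul_pow]
  rw [integral_const_mul, integral_pow_four_standard]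
  have : Real.sqrt v ^ 4 = (v : ℝ) ^ 2 := by
    rw [show 4 = 2 * 2 by norm_num, pow_mul, Real.sq_sqrt v.coe_nonneg]
  rw [this, mul_comm]

variable {Ω : Type*} [MeasurableSpace Ω] {P : Measure Ω}

theorem integral_pow_four_of_hasGaussianLaw {Y : Ω → ℝ} (hY : HasGaussianLaw Y P)
    (h0 : ∫ ω, Y ω ∂P = 0) :
    ∫ ω, Y ω ^ 4 ∂P = 3 * (∫ ω, Y ω ^ 2 ∂P) ^ 2 := by
  have h := hY.map_eq_gaussianReal
  rw [h0] at h
  have h4 : ∫ ω, Y ω ^ 4 ∂P = ∫ x, x ^ 4 ∂(P.map Y) :=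
    (integral_map hY.aemeasurable (continuous_pow _).aestronglyMeasurable).symm
  have h2 : ∫ ω, Y ω ^ 2 ∂P = ∫ x, x ^ 2 ∂(P.map Y) :=
    (integral_map hY.aemeasurable (continuous_pow _).aestronglyMeasurable).symm
  rw [h4, h2, h, integral_pow_four_gaussianReal, integral_sq_gaussianReal]

/-- A real vector space of random variables all of which are centred Gaussian. -/
structure IsGaussianSpace (V : Submodule ℝ (Ω → ℝ)) (P : Measure Ω) : Prop where
  hasGaussianLaw : ∀ Y ∈ V, HasGaussianLaw Y P
  integral_eq_zero : ∀ Y ∈ V, ∫ ω, Y ω ∂P = 0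

/-- The complex valued random variables with real and imaginary parts in `V`. -/
def complexify (V : Submodule ℝ (Ω → ℝ)) : Submodule ℂ (Ω → ℂ) where
  carrier := {x | (fun ω => (x ω).re) ∈ V ∧ (fun ω => (x ω).im) ∈ V}
  zero_mem' := ⟨V.zero_mem, V.zero_mem⟩
  add_mem' hx hy := ⟨V.add_mem hx.1 hy.1, V.add_mem hx.2 hy.2⟩
  smul_mem' c x hx := by
    refine ⟨?_, ?_⟩
    · have := V.sub_mem (V.smul_mem c.re hx.1) (V.smul_mem c.im hx.2)
      convert! this using 1
    · have := V.add_mem (V.smul_mem c.re hx.2) (V.smul_mem c.im hx.1)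
      convert! this using 1

variable {V : Submodule ℝ (Ω → ℝ)}

omit [MeasurableSpace Ω] in
theorem conj_mem_complexify {x : Ω → ℂ} (hx : x ∈ complexify V) :
    (fun ω => conj (x ω)) ∈ complexify V := by
  refine ⟨by simpa using hx.1, ?_⟩
  have := V.neg_mem hx.2
  convert! this using 1

omit [MeasurableSpace Ω] in
theorem ofReal_mem_complexify {Y : Ω → ℝ} (hY : Y ∈ V) :
    (fun ω => (Y ω : ℂ)) ∈ complexify V :=
  ⟨by simpa using hY, V.zero_mem⟩

namespace IsGaussianSpace

variable (hV : IsGaussianSpace V P)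
include hV

theorem memLp {x : Ω → ℂ} (hx : x ∈ complexify V) {p : ℝ≥0∞} (hp : p ≠ ∞) : MemLp x p P := by
  have h1 := ((hV.hasGaussianLaw _ hx.1).memLp hp).ofReal (K := ℂ)
  have h2 := (((hV.hasGaussianLaw _ hx.2).memLp hp).ofReal (K := ℂ)).const_mul Complex.I
  refine (memLp_congr_ae (ae_of_all _ fun ω => ?_)).mp (h1.add h2)
  simp [mul_comm Complex.I]

theorem memLp_mul {x y : Ω → ℂ} (hx : x ∈ complexify V) (hy : y ∈ complexify V) :
    MemLp (fun ω => x ω * y ω) 2 P := by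
  have : ENNReal.HolderTriple 4 4 2 := ⟨by
    rw [← ENNReal.toReal_eq_toReal_iff' (by finiteness) (by finiteness),
      ENNReal.toReal_add (by finiteness) (by finiteness)]
    norm_num⟩
  exact (hV.memLp hy (p := 4) (by finiteness)).mul (hV.memLp hx (p := 4) (by finiteness))

theorem integrable_mul {x y : Ω → ℂ} (hx : x ∈ complexify V) (hy : y ∈ complexify V) :
    Integrable (fun ω => x ω * y ω) P :=
  (hV.memLp hx (p := 2) (by finiteness)).integrable_mul (q := 2) (hV.memLp hy (by finiteness))

theorem integrable_mul_mul {x y z w : Ω → ℂ} (hx : x ∈ complexify V) (hy : y ∈ complexify V)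
    (hz : z ∈ complexify V) (hw : w ∈ complexify V) :
    Integrable (fun ω => x ω * y ω * (z ω * w ω)) P :=
  (hV.memLp_mul hx hy).integrable_mul (hV.memLp_mul hz hw)


theorem integral_sq_sum (Y : Fin 4 → Ω → ℝ) (hY : ∀ i, Y i ∈ V) (t : Fin 4 → ℝ) :
    ∫ ω, (∑ i, t i * Y i ω) ^ 2 ∂P = ∑ i, ∑ j, t i * t j * ∫ ω, Y i ω * Y j ω ∂P := by
  have hm : ∀ i, MemLp (Y i) 2 P := fun i => (hV.hasGaussianLaw _ (hY i)).memLp_two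
  have e : ∀ ω, (∑ i, t i * Y i ω) ^ 2 = ∑ i, ∑ j, t i * t j * (Y i ω * Y j ω) := fun ω => by
    rw [sq, Finset.sum_mul_sum]
    exact Finset.sum_congr rfl fun i _ => Finset.sum_congr rfl fun j _ => by ring
  have hi : ∀ i j, Integrable (fun ω => t i * t j * (Y i ω * Y j ω)) P := fun i j =>
    ((hm i).integrable_mul (q := 2) (hm j)).const_mul _
  simp_rw [e]
  rw [integral_finsetSum _ fun i _ => integrable_finsetSum _ fun j _ => hi i j]
  refine Finset.sum_congr rfl fun i _ => ?_
  rw [integral_finsetSum _ fun j _ => hi i j]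
  exact Finset.sum_congr rfl fun j _ => integral_const_mul _ _

theorem integral_pow_four_sum (Y : Fin 4 → Ω → ℝ) (hY : ∀ i, Y i ∈ V) (t : Fin 4 → ℝ) :
    ∫ ω, (∑ i, t i * Y i ω) ^ 4 ∂P
      = 3 * (∑ i, ∑ j, t i * t j * ∫ ω, Y i ω * Y j ω ∂P) ^ 2 := by
  have hmem : (fun ω => ∑ i, t i * Y i ω) ∈ V := by
    have := V.sum_mem (t := Finset.univ) fun i _ => V.smul_mem (t i) (hY i)
    convert! this using 1
  rw [integral_pow_four_of_hasGaussianLaw (hV.hasGaussianLaw _ hmem) (hV.integral_eq_zero _ hmem),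
    hV.integral_sq_sum Y hY]

/-- Polarization: a product of four variables is a combination of fourth powers of signed sums,
whose means are known. -/
theorem wick_real (Y : Fin 4 → Ω → ℝ) (hY : ∀ i, Y i ∈ V) :
    ∫ ω, Y 0 ω * Y 1 ω * (Y 2 ω * Y 3 ω) ∂P
      = (∫ ω, Y 0 ω * Y 1 ω ∂P) * (∫ ω, Y 2 ω * Y 3 ω ∂P)
      + (∫ ω, Y 0 ω * Y 2 ω ∂P) * (∫ ω, Y 1 ω * Y 3 ω ∂P)
      + (∫ ω, Y 0 ω * Y 3 ω ∂P) * (∫ ω, Y 1 ω * Y 2 ω ∂P) := by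
  have hI : ∀ t : Fin 4 → ℝ, Integrable (fun ω => (∑ i, t i * Y i ω) ^ 4) P := fun t => by
    have hmem : (fun ω => ∑ i, t i * Y i ω) ∈ V := by
      have := V.sum_mem (t := Finset.univ) fun i _ => V.smul_mem (t i) (hY i)
      convert! this using 1
    have h4 := (hV.hasGaussianLaw _ hmem).memLp (p := 4) (by finiteness)
    refine (integrable_norm_iff (h4.1.pow 4)).mp ?_
    simpa using! MemLp.integrable_norm_pow (p := 4) h4 (by norm_num)
  -- The eight sign patterns with first sign `+`, weighted by the product of their signs, isolate
  -- the multilinear monomial. It has coefficient `4!` in each fourth power, and `192 = 8 · 4!`.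
  have hp : ∀ ω, Y 0 ω * Y 1 ω * (Y 2 ω * Y 3 ω) = (1 / 192) *
      ((∑ i, ![1, 1, 1, 1] i * Y i ω) ^ 4 - (∑ i, ![1, 1, 1, -1] i * Y i ω) ^ 4
      - (∑ i, ![1, 1, -1, 1] i * Y i ω) ^ 4 - (∑ i, ![1, -1, 1, 1] i * Y i ω) ^ 4
      + (∑ i, ![1, 1, -1, -1] i * Y i ω) ^ 4 + (∑ i, ![1, -1, 1, -1] i * Y i ω) ^ 4
      + (∑ i, ![1, -1, -1, 1] i * Y i ω) ^ 4 - (∑ i, ![1, -1, -1, -1] i * Y i ω) ^ 4) := by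
    intro ω
    simp only [Fin.sum_univ_four, Matrix.cons_val]
    ring
  simp_rw [hp]
  rw [integral_const_mul, integral_sub, integral_add, integral_add, integral_add, integral_sub,
    integral_sub, integral_sub]
  · simp_rw [hV.integral_pow_four_sum Y hY]
    simp only [Fin.sum_univ_four, Matrix.cons_val]
    simp_rw [fun ω => mul_comm (Y 1 ω) (Y 0 ω), fun ω => mul_comm (Y 2 ω) (Y 0 ω),
      fun ω => mul_comm (Y 3 ω) (Y 0 ω), fun ω => mul_comm (Y 2 ω) (Y 1 ω),
      fun ω => mul_comm (Y 3 ω) (Y 1 ω), fun ω => mul_comm (Y 3 ω) (Y 2 ω)]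
    ring
  all_goals
    repeat' first
      | exact hI _
      | apply Integrable.sub
      | apply Integrable.add

/-- The deviation from the Wick formula. -/
noncomputable def wickDefect (P : Measure Ω) (x y z w : Ω → ℂ) : ℂ :=
  ∫ ω, x ω * y ω * (z ω * w ω) ∂P
    - ((∫ ω, x ω * y ω ∂P) * (∫ ω, z ω * w ω ∂P) + (∫ ω, x ω * z ω ∂P) * (∫ ω, y ω * w ω ∂P)
      + (∫ ω, x ω * w ω ∂P) * (∫ ω, y ω * z ω ∂P))

/-- The defect is complex linear in its first slot, so the real and imaginary parts of `x` can be
treated separately. -/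
theorem wickDefect_eq_zero_of_left {y z w : Ω → ℂ} (hy : y ∈ complexify V)
    (hz : z ∈ complexify V) (hw : w ∈ complexify V)
    (h : ∀ Y ∈ V, wickDefect P (fun ω => (Y ω : ℂ)) y z w = 0) {x : Ω → ℂ}
    (hx : x ∈ complexify V) : wickDefect P x y z w = 0 := by
  have e : ∀ ω, x ω = ((x ω).re : ℂ) + Complex.I * ((x ω).im : ℂ) := fun ω => by
    rw [mul_comm]; exact (Complex.re_add_im _).symm
  have m1 := ofReal_mem_complexify hx.1
  have m2 := ofReal_mem_complexify hx.2
  have h2 : ∀ v : Ω → ℂ, v ∈ complexify V → ∫ ω, x ω * v ω ∂P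
      = ∫ ω, ((x ω).re : ℂ) * v ω ∂P + Complex.I * ∫ ω, ((x ω).im : ℂ) * v ω ∂P := by
    intro v hv
    rw [← integral_const_mul, ← integral_add (hV.integrable_mul m1 hv)
      ((hV.integrable_mul m2 hv).const_mul _)]
    refine integral_congr_ae (ae_of_all _ fun ω => ?_)
    linear_combination (v ω) * e ω
  have h4 : ∫ ω, x ω * y ω * (z ω * w ω) ∂P
      = ∫ ω, ((x ω).re : ℂ) * y ω * (z ω * w ω) ∂P
        + Complex.I * ∫ ω, ((x ω).im : ℂ) * y ω * (z ω * w ω) ∂P := by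
    rw [← integral_const_mul, ← integral_add (hV.integrable_mul_mul m1 hy hz hw)
      ((hV.integrable_mul_mul m2 hy hz hw).const_mul _)]
    refine integral_congr_ae (ae_of_all _ fun ω => ?_)
    linear_combination (y ω * (z ω * w ω)) * e ω
  have k1 := h _ hx.1
  have k2 := h _ hx.2
  unfold wickDefect at k1 k2 ⊢
  rw [h4, h2 y hy, h2 z hz, h2 w hw]
  linear_combination k1 + Complex.I * k2

omit hV in
theorem wickDefect_swap (x y z w : Ω → ℂ) : wickDefect P x y z w = wickDefect P y x z w := by
  unfold wickDefect
  simp_rw [fun ω => mul_comm (x ω) (y ω)]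
  ring

omit hV in
theorem wickDefect_swap_pairs (x y z w : Ω → ℂ) :
    wickDefect P x y z w = wickDefect P z w x y := by
  unfold wickDefect
  simp_rw [fun ω => mul_comm (x ω * y ω) (z ω * w ω), fun ω => mul_comm (x ω) (z ω),
    fun ω => mul_comm (x ω) (w ω), fun ω => mul_comm (y ω) (w ω), fun ω => mul_comm (y ω) (z ω)]
  ring

/-- **Wick's formula** for four jointly Gaussian centred complex random variables. -/
theorem wick {x y z w : Ω → ℂ} (hx : x ∈ complexify V) (hy : y ∈ complexify V)
    (hz : z ∈ complexify V) (hw : w ∈ complexify V) :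
    ∫ ω, x ω * y ω * (z ω * w ω) ∂P
      = (∫ ω, x ω * y ω ∂P) * (∫ ω, z ω * w ω ∂P) + (∫ ω, x ω * z ω ∂P) * (∫ ω, y ω * w ω ∂P)
      + (∫ ω, x ω * w ω ∂P) * (∫ ω, y ω * z ω ∂P) := by
  suffices wickDefect P x y z w = 0 from sub_eq_zero.mp this
  -- The symmetries of the defect bring each of the four arguments to the first slot in turn, where
  -- it may be taken real. The real arguments end up in the order `D, C, B, A`.
  refine hV.wickDefect_eq_zero_of_left hy hz hw (fun A hA => ?_) hx
  have mA := ofReal_mem_complexify hA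
  rw [wickDefect_swap]
  refine hV.wickDefect_eq_zero_of_left mA hz hw (fun B hB => ?_) hy
  have mB := ofReal_mem_complexify hB
  rw [wickDefect_swap_pairs]
  refine hV.wickDefect_eq_zero_of_left hw mB mA (fun C hC => ?_) hz
  have mC := ofReal_mem_complexify hC
  rw [wickDefect_swap]
  refine hV.wickDefect_eq_zero_of_left mC mB mA (fun D hD => ?_) hw
  have hr := hV.wick_real ![D, C, B, A] (by
    intro i
    fin_cases i <;> simp_all)
  simp only [Matrix.cons_val] at hr
  unfold wickDefect
  simp_rw [← Complex.ofReal_mul]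
  rw [integral_complex_ofReal, hr]
  simp_rw [integral_complex_ofReal]
  push_cast
  ring

end IsGaussianSpace

end GaussianMoments

end FunctionalCLT

namespace FunctionalCLT

/-! ### Gaussian approximation of quadratic forms -/

section QuadraticForm

/-- The characteristic function of a centred chi-square random variable. -/
noncomputable def chiSqCharFun (μ : ℝ) : ℂ :=
  ∫ x : ℝ, Complex.exp (Complex.I * (μ * (x ^ 2 - 1) : ℝ)) ∂(gaussianReal 0 1)

theorem norm_chiSqCharFun_le (μ : ℝ) : ‖chiSqCharFun μ‖ ≤ 1 := by
  refine (norm_integral_le_integral_norm _).trans ?_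
  simp_rw [mul_comm Complex.I, Complex.norm_exp_ofReal_mul_I]
  simp

theorem integrable_pow_gaussianReal (k : ℕ) : Integrable (fun x : ℝ => x ^ k) (gaussianReal 0 1) := by
  have h : MemLp (id : ℝ → ℝ) k (gaussianReal 0 1) := memLp_id_gaussianReal k
  refine (integrable_norm_iff (by fun_prop)).mp ?_
  simpa using! h.integrable_norm_pow'

theorem integral_sq_sub_one : ∫ x : ℝ, (x ^ 2 - 1) ∂(gaussianReal 0 1) = 0 := by
  rw [integral_sub (integrable_pow_gaussianReal 2) (integrable_const _), integral_sq_gaussianReal]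
  simp

theorem integral_sq_sub_one_sq : ∫ x : ℝ, (x ^ 2 - 1) ^ 2 ∂(gaussianReal 0 1) = 2 := by
  have e : ∀ x : ℝ, (x ^ 2 - 1) ^ 2 = x ^ 4 - 2 * x ^ 2 + 1 := fun x => by ring
  have i : Integrable (fun x : ℝ => x ^ 4 - 2 * x ^ 2) (gaussianReal 0 1) :=
    (integrable_pow_gaussianReal 4).sub ((integrable_pow_gaussianReal 2).const_mul 2)
  simp_rw [e]
  rw [integral_add i (integrable_const _), integral_sub (integrable_pow_gaussianReal 4)
    ((integrable_pow_gaussianReal 2).const_mul 2), integral_const_mul, integral_sq_gaussianReal,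
    integral_pow_four_standard]
  norm_num

theorem memLp_sq_sub_one : MemLp (fun x : ℝ => x ^ 2 - 1) 2 (gaussianReal 0 1) := by
  refine (memLp_two_iff_integrable_sq (by fun_prop)).mpr ?_
  refine .of_integral_ne_zero ?_
  rw [integral_sq_sub_one_sq]
  norm_num

/-- Both functions equal `1 - μ² + o(μ²)`: the first because `x² - 1` has mean 0 and variance 2, the
second by differentiating the exponential. -/
theorem chiSqCharFun_sub_exp_isLittleO :
    (fun μ : ℝ => chiSqCharFun μ - Complex.exp (-(μ ^ 2 : ℝ))) =o[𝓝 0] fun μ : ℝ => μ ^ 2 := by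
  have hs : Real.sqrt 2 ≠ 0 := by positivity
  have hs2 : Real.sqrt 2 ^ 2 = 2 := Real.sq_sqrt (by norm_num)
  -- The expansion is stated for unit variance, hence the division by `√2`, undone below by
  -- evaluating at `√2 μ`.
  have h := taylor_charFun_two (P := gaussianReal 0 1) (X := fun x : ℝ => (x ^ 2 - 1) / Real.sqrt 2)
    (by fun_prop) (by rw [integral_div, integral_sq_sub_one, zero_div])
    (by simp only [Pi.pow_apply, div_pow]; rw [integral_div, integral_sq_sub_one_sq, hs2]; norm_num)
  have ht : Tendsto (fun μ : ℝ => Real.sqrt 2 * μ) (𝓝 0) (𝓝 0) := by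
    have : Continuous fun μ : ℝ => Real.sqrt 2 * μ := by fun_prop
    simpa using this.tendsto 0
  have h1 := h.comp_tendsto ht
  have h2 : (fun μ : ℝ => chiSqCharFun μ - (1 - (μ : ℂ) ^ 2)) =o[𝓝 0] fun μ : ℝ => μ ^ 2 := by
    have e : ((fun t : ℝ => t ^ 2) ∘ fun μ : ℝ => Real.sqrt 2 * μ) = fun μ => 2 * μ ^ 2 := by
      funext μ
      simp [mul_pow, hs2]
    rw [e] at h1
    refine (h1.trans_isBigO (Asymptotics.isBigO_const_mul_self _ _ _)).congr_left fun μ => ?_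
    simp only [Function.comp_apply]
    congr 1
    · rw [charFun_apply_real, integral_map (by fun_prop) (by fun_prop)]
      unfold chiSqCharFun
      refine integral_congr_ae (ae_of_all _ fun x => ?_)
      have hsc : (Real.sqrt 2 : ℂ) ≠ 0 := by exact_mod_cast hs
      push_cast
      field_simp
    · have : ((Real.sqrt 2 : ℝ) : ℂ) ^ 2 = 2 := by exact_mod_cast hs2
      push_cast
      rw [mul_pow, this]
      ring
  have h3 : (fun μ : ℝ => Complex.exp (-(μ ^ 2 : ℝ)) - (1 - (μ : ℂ) ^ 2)) =o[𝓝 0]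
      fun μ : ℝ => μ ^ 2 := by
    have hd := (Complex.hasDerivAt_exp 0).isLittleO
    have ht2 : Tendsto (fun μ : ℝ => (-(μ ^ 2 : ℝ) : ℂ)) (𝓝 0) (𝓝 0) := by
      have : Continuous fun μ : ℝ => (-(μ ^ 2 : ℝ) : ℂ) := by fun_prop
      simpa using this.tendsto 0
    have := (hd.comp_tendsto ht2).norm_right
    refine (this.congr_left fun μ => ?_).congr_right (fun μ => ?_)
    · simp; ring
    · simp
  refine (h2.sub h3).congr_left fun μ => ?_
  ring

theorem exists_norm_chiSqCharFun_sub_exp_le {η : ℝ} (hη : 0 < η) :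
    ∃ ε > 0, ∀ μ : ℝ, |μ| < ε → ‖chiSqCharFun μ - Complex.exp (-(μ ^ 2 : ℝ))‖ ≤ η * μ ^ 2 := by
  have h := chiSqCharFun_sub_exp_isLittleO.def hη
  obtain ⟨ε, hε, h2⟩ := Metric.eventually_nhds_iff.mp h
  refine ⟨ε, hε, fun μ hμ => ?_⟩
  have := @h2 μ (by simpa [Real.dist_eq] using hμ)
  simpa using this

/-- Replace the factors one at a time; all the other factors have modulus at most 1. -/
theorem norm_prod_sub_prod_le {ι : Type*} (s : Finset ι) (a b : ι → ℂ) (ha : ∀ i, ‖a i‖ ≤ 1)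
    (hb : ∀ i, ‖b i‖ ≤ 1) : ‖∏ i ∈ s, a i - ∏ i ∈ s, b i‖ ≤ ∑ i ∈ s, ‖a i - b i‖ := by
  classical
  induction s using Finset.induction_on with
  | empty => simp
  | insert i s hi ih =>
    rw [Finset.prod_insert hi, Finset.prod_insert hi, Finset.sum_insert hi]
    have e : a i * ∏ j ∈ s, a j - b i * ∏ j ∈ s, b j
        = (a i - b i) * ∏ j ∈ s, a j + b i * (∏ j ∈ s, a j - ∏ j ∈ s, b j) := by ring
    rw [e]
    refine (norm_add_le _ _).trans ?_
    rw [norm_mul, norm_mul]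
    have h1 : ‖∏ j ∈ s, a j‖ ≤ 1 := by
      rw [norm_prod]
      exact Finset.prod_le_one (fun _ _ => norm_nonneg _) fun j _ => ha j
    gcongr
    · exact mul_le_of_le_one_right (norm_nonneg _) h1
    · exact (mul_le_of_le_one_left (norm_nonneg _) (hb i)).trans ih

section FiniteDimensional

variable {E : Type*} [NormedAddCommGroup E] [InnerProductSpace ℝ E] [FiniteDimensional ℝ E]

/-- Take square roots of the eigenvalues in an eigenbasis. Applied to a covariance operator, `T`
transports a standard Gaussian vector to the given one. -/
theorem exists_symmetric_sqrt (C : E →ₗ[ℝ] E) (hC : C.IsPositive) :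
    ∃ T : E →L[ℝ] E, (∀ x y, ⟪T x, y⟫_ℝ = ⟪x, T y⟫_ℝ) ∧ ∀ x y, ⟪T x, T y⟫_ℝ = ⟪C x, y⟫_ℝ := by
  set b := hC.isSymmetric.eigenvectorBasis rfl with hb
  set σ := hC.isSymmetric.eigenvalues rfl with hσ
  have hσ0 : ∀ i, 0 ≤ σ i := fun i => hC.nonneg_eigenvalues rfl i
  have hCb : ∀ i, C (b i) = σ i • b i := fun i => hC.isSymmetric.apply_eigenvectorBasis rfl i
  let T : E →ₗ[ℝ] E := ∑ i, Real.sqrt (σ i) • (innerₛₗ ℝ (b i)).smulRight (b i)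
  have hT : ∀ x, T x = ∑ i, (Real.sqrt (σ i) * ⟪b i, x⟫_ℝ) • b i := fun x => by
    simp [T, mul_smul]
  have hTi : ∀ x y, ⟪T x, y⟫_ℝ = ∑ i, Real.sqrt (σ i) * ⟪b i, x⟫_ℝ * ⟪b i, y⟫_ℝ := fun x y => by
    rw [hT, sum_inner]
    simp [real_inner_smul_left]
  have hbT : ∀ i y, ⟪b i, T y⟫_ℝ = Real.sqrt (σ i) * ⟪b i, y⟫_ℝ := fun i y => by
    rw [hT, inner_sum, Finset.sum_eq_single i]
    · rw [real_inner_smul_right, real_inner_self_eq_norm_sq, b.orthonormal.1]; simp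
    · intro j _ hj
      rw [real_inner_smul_right, b.orthonormal.2 (Ne.symm hj), mul_zero]
    · simp
  refine ⟨LinearMap.toContinuousLinearMap T, fun x y => ?_, fun x y => ?_⟩
  · simp only [LinearMap.coe_toContinuousLinearMap']
    rw [hTi, real_inner_comm, hTi]
    exact Finset.sum_congr rfl fun i _ => by ring
  · simp only [LinearMap.coe_toContinuousLinearMap']
    rw [hTi]
    have hCx : ⟪C x, y⟫_ℝ = ∑ i, σ i * ⟪b i, x⟫_ℝ * ⟪b i, y⟫_ℝ := by
      rw [← b.sum_inner_mul_inner]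
      refine Finset.sum_congr rfl fun i _ => ?_
      rw [hC.isSymmetric, hCb, real_inner_smul_right, real_inner_comm x]
    rw [hCx]
    refine Finset.sum_congr rfl fun i _ => ?_
    rw [hbT]
    linear_combination (⟪b i, x⟫_ℝ * ⟪b i, y⟫_ℝ) * Real.mul_self_sqrt (hσ0 i)

/-- A quadratic form sees only the symmetric part of `A`, which the spectral theorem diagonalizes.
The `μᵢ` are half the eigenvalues of `A + A*`. -/
theorem exists_orthonormalBasis_quadratic (A : E →ₗ[ℝ] E) :
    ∃ (b : OrthonormalBasis (Fin (Module.finrank ℝ E)) ℝ E) (μ : Fin (Module.finrank ℝ E) → ℝ),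
      ∀ x, ⟪A x, x⟫_ℝ = ∑ i, μ i * ⟪b i, x⟫_ℝ ^ 2 := by
  have hB : (A + LinearMap.adjoint A).IsSymmetric := by
    intro x y
    simp only [LinearMap.add_apply, inner_add_left, inner_add_right,
      LinearMap.adjoint_inner_left, LinearMap.adjoint_inner_right]
    ring
  set b := hB.eigenvectorBasis rfl with hb
  refine ⟨b, fun i => hB.eigenvalues rfl i / 2, fun x => ?_⟩
  have h1 : ⟪(A + LinearMap.adjoint A) x, x⟫_ℝ = 2 * ⟪A x, x⟫_ℝ := by
    rw [LinearMap.add_apply, inner_add_left, LinearMap.adjoint_inner_left, real_inner_comm]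
    ring
  have h2 : ⟪(A + LinearMap.adjoint A) x, x⟫_ℝ = ∑ i, hB.eigenvalues rfl i * ⟪b i, x⟫_ℝ ^ 2 := by
    rw [← b.sum_inner_mul_inner]
    refine Finset.sum_congr rfl fun i _ => ?_
    rw [hB, hb, hB.apply_eigenvectorBasis, real_inner_smul_right, real_inner_comm x]
    simp
    ring
  have h3 : ∑ i, hB.eigenvalues rfl i / 2 * ⟪b i, x⟫_ℝ ^ 2
      = (∑ i, hB.eigenvalues rfl i * ⟪b i, x⟫_ℝ ^ 2) / 2 := by
    rw [Finset.sum_div]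
    exact Finset.sum_congr rfl fun i _ => by ring
  rw [h3, ← h2, h1]
  ring

variable [MeasurableSpace E] [BorelSpace E]

/-- Both sides are Gaussian, so their characteristic functions depend only on means and directional
variances, and these agree. -/
theorem isGaussian_eq_map_stdGaussian {μ : Measure E} [IsGaussian μ] (h0 : ∫ x, x ∂μ = 0)
    {T : E →L[ℝ] E} (hT : ∀ x y, ⟪T x, y⟫_ℝ = ⟪x, T y⟫_ℝ)
    (hTC : ∀ x, ⟪T x, T x⟫_ℝ = ∫ z, ⟪x, z⟫_ℝ ^ 2 ∂μ) :
    μ = (stdGaussian E).map T := by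
  apply Measure.ext_of_charFun
  ext t
  have hm : MemLp (id : E → E) 2 μ := IsGaussian.memLp_two_id
  rw [IsGaussian.charFun_eq', IsGaussian.charFun_eq', covarianceBilin_self hm,
    covarianceBilin_self (IsGaussian.memLp_two_id)]
  have e1 : ∫ x, x ∂((stdGaussian E).map T) = 0 := by
    rw [integral_map (by fun_prop) (by fun_prop), T.integral_comp_comm IsGaussian.integrable_fun_id]
    simp
  have e0 : μ[fun x => ⟪t, x⟫_ℝ] = 0 := by
    rw [integral_inner IsGaussian.integrable_fun_id, h0, inner_zero_right]
  have e2 : Var[fun x => ⟪t, x⟫_ℝ; μ] = ⟪T t, T t⟫_ℝ := by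
    rw [hTC, variance_eq_integral (by fun_prop), e0]
    simp
  have e3 : Var[fun x => ⟪t, x⟫_ℝ; (stdGaussian E).map T] = ⟪T t, T t⟫_ℝ := by
    rw [variance_map (by fun_prop) (by fun_prop)]
    have : (fun x => ⟪t, x⟫_ℝ) ∘ T = innerSL ℝ (T t) := by
      ext x
      simp [hT]
    rw [this, variance_dual_stdGaussian, innerSL_apply_norm, real_inner_self_eq_norm_sq]
  rw [e2, e3]
  simp only [id] at *
  rw [h0, e1]

/-- In an eigenbasis the centred form is `∑ μᵢ (xᵢ² - 1)` with independent standard normal `xᵢ`. The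
characteristic function is the product of the one-variable ones and the variance is `2 ∑ μᵢ²`, so
comparing factor by factor costs `η ∑ μᵢ²`. The only requirement is that all `|μᵢ| ≤ ρ`,
independently of the dimension. -/
theorem norm_charFun_quadratic_stdGaussian_sub_le (B : E →ₗ[ℝ] E) {ρ η : ℝ}
    (hB : ∀ u, |⟪B u, u⟫_ℝ| ≤ ρ * ‖u‖ ^ 2)
    (hη : ∀ μ : ℝ, |μ| ≤ ρ → ‖chiSqCharFun μ - Complex.exp (-(μ ^ 2 : ℝ))‖ ≤ η * μ ^ 2) :
    ‖∫ w, Complex.exp (Complex.I * (⟪B w, w⟫_ℝ - ∫ v, ⟪B v, v⟫_ℝ ∂(stdGaussian E) : ℝ))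
        ∂(stdGaussian E)
      - Complex.exp (-((∫ w, (⟪B w, w⟫_ℝ - ∫ v, ⟪B v, v⟫_ℝ ∂(stdGaussian E)) ^ 2
        ∂(stdGaussian E)) / 2 : ℝ))‖
      ≤ η * ((∫ w, (⟪B w, w⟫_ℝ - ∫ v, ⟪B v, v⟫_ℝ ∂(stdGaussian E)) ^ 2 ∂(stdGaussian E)) / 2) := by
  obtain ⟨b, μ, hb⟩ := exists_orthonormalBasis_quadratic B
  have hμ : ∀ i, |μ i| ≤ ρ := fun i => by
    have h := hB (b i)
    have e : ⟪B (b i), b i⟫_ℝ = μ i := by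
      rw [hb, Finset.sum_eq_single i]
      · rw [real_inner_self_eq_norm_sq, b.orthonormal.1]; simp
      · intro j _ hj
        rw [b.orthonormal.2 hj]; simp
      · simp
    rwa [e, b.orthonormal.1, one_pow, mul_one] at h
  set π : Measure (Fin (Module.finrank ℝ E) → ℝ) := Measure.pi fun _ => gaussianReal 0 1
  have hstd := stdGaussian_eq_map_pi_orthonormalBasis b
  have hmeas : AEMeasurable (fun x : Fin (Module.finrank ℝ E) → ℝ => ∑ i, x i • b i) π :=
    Measurable.aemeasurable (by fun_prop)
  have hq : ∀ x : Fin (Module.finrank ℝ E) → ℝ,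
      ⟪B (∑ i, x i • b i), ∑ i, x i • b i⟫_ℝ = ∑ i, μ i * x i ^ 2 := fun x => by
    rw [hb]
    refine Finset.sum_congr rfl fun i _ => ?_
    rw [b.orthonormal.inner_right_fintype]
  have hcB : Continuous fun v => ⟪B v, v⟫_ℝ :=
    (B.continuous_of_finiteDimensional).inner continuous_id
  have hmean : ∫ v, ⟪B v, v⟫_ℝ ∂(stdGaussian E) = ∑ i, μ i := by
    rw [hstd, integral_map hmeas hcB.aestronglyMeasurable]
    simp_rw [hq]
    rw [integral_finsetSum]
    · refine Finset.sum_congr rfl fun i _ => ?_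
      rw [integral_const_mul]
      have := integral_comp_eval (μ := fun _ : Fin (Module.finrank ℝ E) => gaussianReal 0 1)
        (i := i) (f := fun x : ℝ => x ^ 2) (by fun_prop)
      rw [this, integral_sq_gaussianReal]; simp
    · intro i _
      exact ((integrable_comp_eval (μ := fun _ : Fin (Module.finrank ℝ E) => gaussianReal 0 1)
        (i := i) (integrable_pow_gaussianReal 2))).const_mul _
  have hcen : ∀ x : Fin (Module.finrank ℝ E) → ℝ,
      ⟪B (∑ i, x i • b i), ∑ i, x i • b i⟫_ℝ - ∫ v, ⟪B v, v⟫_ℝ ∂(stdGaussian E)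
        = ∑ i, μ i * (x i ^ 2 - 1) := fun x => by
    rw [hq, hmean, ← Finset.sum_sub_distrib]
    exact Finset.sum_congr rfl fun i _ => by ring
  have hvar : ∫ w, (⟪B w, w⟫_ℝ - ∫ v, ⟪B v, v⟫_ℝ ∂(stdGaussian E)) ^ 2 ∂(stdGaussian E)
      = ∑ i, 2 * μ i ^ 2 := by
    have h1 : ∫ w, (⟪B w, w⟫_ℝ - ∫ v, ⟪B v, v⟫_ℝ ∂(stdGaussian E)) ^ 2 ∂(stdGaussian E)
        = ∫ x, (∑ i, μ i * (x i ^ 2 - 1)) ^ 2 ∂π := by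
      simp_rw [← hcen]
      conv_lhs => rw [hstd]
      rw [integral_map hmeas (Continuous.aestronglyMeasurable (by fun_prop)), ← hstd]
    have hml : ∀ i, MemLp (fun x : ℝ => μ i * (x ^ 2 - 1)) 2 (gaussianReal 0 1) := fun i =>
      memLp_sq_sub_one.const_mul _
    have h2 := variance_sum_pi (μ := fun _ : Fin (Module.finrank ℝ E) => gaussianReal 0 1)
      (X := fun i (x : ℝ) => μ i * (x ^ 2 - 1)) hml
    rw [variance_eq_integral (by fun_prop)] at h2
    have h3 : ∫ x, (∑ i, fun ω : Fin (Module.finrank ℝ E) → ℝ => μ i * (ω i ^ 2 - 1)) x ∂π = 0 := by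
      simp only [Finset.sum_apply]
      rw [integral_finsetSum]
      · refine Finset.sum_eq_zero fun i _ => ?_
        have := integral_comp_eval (μ := fun _ : Fin (Module.finrank ℝ E) => gaussianReal 0 1)
          (i := i) (f := fun x : ℝ => μ i * (x ^ 2 - 1)) (by fun_prop)
        rw [this, integral_const_mul, integral_sq_sub_one, mul_zero]
      · intro i _
        exact integrable_comp_eval (μ := fun _ : Fin (Module.finrank ℝ E) => gaussianReal 0 1)
          (i := i) ((hml i).integrable (by norm_num))
    rw [h3] at h2
    simp only [Finset.sum_apply, sub_zero] at h2
    rw [h1, h2]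
    refine Finset.sum_congr rfl fun i _ => ?_
    rw [variance_const_mul, variance_eq_integral (by fun_prop), integral_sq_sub_one]
    simp only [sub_zero]
    rw [integral_sq_sub_one_sq]
    ring
  have hchar : ∫ w, Complex.exp (Complex.I * (⟪B w, w⟫_ℝ - ∫ v, ⟪B v, v⟫_ℝ ∂(stdGaussian E) : ℝ))
        ∂(stdGaussian E) = ∏ i, chiSqCharFun (μ i) := by
    have h1 : ∫ w, Complex.exp (Complex.I * (⟪B w, w⟫_ℝ - ∫ v, ⟪B v, v⟫_ℝ ∂(stdGaussian E) : ℝ))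
        ∂(stdGaussian E)
        = ∫ x, ∏ i, Complex.exp (Complex.I * (μ i * (x i ^ 2 - 1) : ℝ)) ∂π := by
      simp_rw [← Complex.exp_sum, ← Finset.mul_sum, ← Complex.ofReal_sum, ← hcen]
      conv_lhs => rw [hstd]
      rw [integral_map hmeas (Continuous.aestronglyMeasurable (by fun_prop)), ← hstd]
    rw [h1]
    exact integral_fintype_prod_eq_prod
      (f := fun i (x : ℝ) => Complex.exp (Complex.I * (μ i * (x ^ 2 - 1) : ℝ)))
  rw [hvar, hchar]
  have e : Complex.exp (-((∑ i, 2 * μ i ^ 2) / 2 : ℝ)) = ∏ i, Complex.exp (-(μ i ^ 2 : ℝ)) := by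
    rw [← Complex.exp_sum, ← Finset.mul_sum, Finset.sum_neg_distrib]
    push_cast
    congr 2
    ring
  rw [e, ← Finset.mul_sum, mul_div_cancel_left₀ _ two_ne_zero, Finset.mul_sum]
  refine (norm_prod_sub_prod_le _ _ _ (fun i => norm_chiSqCharFun_le _) fun i => ?_).trans
    (Finset.sum_le_sum fun i _ => hη _ (hμ i))
  rw [Complex.norm_exp, Complex.neg_re, Complex.ofReal_re, Real.exp_le_one_iff]
  exact neg_nonpos.mpr (sq_nonneg _)

/-- A centred quadratic form in a centred Gaussian vector is close to Gaussian if its spectral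
radius is small. -/
theorem norm_charFun_quadratic_sub_le {Ω : Type*} [MeasurableSpace Ω] {P : Measure Ω} {G : Ω → E}
    (hG : HasGaussianLaw G P) (h0 : ∫ ω, G ω ∂P = 0) (A : E →ₗ[ℝ] E) {α s η : ℝ} (hα : 0 ≤ α)
    (hA : ∀ u, |⟪A u, u⟫_ℝ| ≤ α * ‖u‖ ^ 2)
    (hs : ∀ v, ∫ ω, ⟪v, G ω⟫_ℝ ^ 2 ∂P ≤ s * ‖v‖ ^ 2)
    (hη : ∀ μ : ℝ, |μ| ≤ α * s → ‖chiSqCharFun μ - Complex.exp (-(μ ^ 2 : ℝ))‖ ≤ η * μ ^ 2) :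
    ‖∫ ω, Complex.exp (Complex.I * (⟪A (G ω), G ω⟫_ℝ - ∫ ω', ⟪A (G ω'), G ω'⟫_ℝ ∂P : ℝ)) ∂P
      - Complex.exp (-((∫ ω, (⟪A (G ω), G ω⟫_ℝ - ∫ ω', ⟪A (G ω'), G ω'⟫_ℝ ∂P) ^ 2 ∂P) / 2 : ℝ))‖
      ≤ η * ((∫ ω, (⟪A (G ω), G ω⟫_ℝ - ∫ ω', ⟪A (G ω'), G ω'⟫_ℝ ∂P) ^ 2 ∂P) / 2) := by
  have := hG.isGaussian_map
  set ν := P.map G with hν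
  have hm : MemLp (id : E → E) 2 ν := IsGaussian.memLp_two_id
  have hν0 : ∫ x, x ∂ν = 0 := by
    rw [hν, integral_map hG.aemeasurable (by fun_prop), h0]
  obtain ⟨T, hT1, hT2⟩ := exists_symmetric_sqrt (covarianceOperator ν).toLinearMap
    isPositive_covarianceOperator
  have hTC : ∀ x, ⟪T x, T x⟫_ℝ = ∫ z, ⟪x, z⟫_ℝ ^ 2 ∂ν := fun x => by
    rw [hT2, ContinuousLinearMap.coe_coe, covarianceOperator_inner hm]
    simp_rw [sq]
  have hstd := isGaussian_eq_map_stdGaussian hν0 hT1 hTC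
  have hcA : Continuous A := A.continuous_of_finiteDimensional
  have hTn : ∀ x, ‖T x‖ ^ 2 ≤ s * ‖x‖ ^ 2 := fun x => by
    rw [← real_inner_self_eq_norm_sq, hTC, hν, integral_map hG.aemeasurable
      (Continuous.aestronglyMeasurable (by fun_prop))]
    exact hs x
  -- The vector `G` has the law of `T w` with `w` standard, so the form becomes that of `T A T`. Its
  -- numerical radius is at most `α s` because `‖T x‖² ≤ s ‖x‖²`.
  set B : E →ₗ[ℝ] E := T.toLinearMap ∘ₗ A ∘ₗ T.toLinearMap with hBdef
  have hBA : ∀ w, ⟪A (T w), T w⟫_ℝ = ⟪B w, w⟫_ℝ := fun w => by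
    simp [hBdef, hT1]
  have hB : ∀ u, |⟪B u, u⟫_ℝ| ≤ α * s * ‖u‖ ^ 2 := fun u => by
    rw [← hBA]
    refine (hA _).trans ?_
    rw [mul_assoc]
    exact mul_le_mul_of_nonneg_left (hTn u) hα
  have key := norm_charFun_quadratic_stdGaussian_sub_le B hB hη
  have tr : ∀ {F : Type} [NormedAddCommGroup F] [NormedSpace ℝ F] (f : E → F), Continuous f →
      ∫ ω, f (G ω) ∂P = ∫ w, f (T w) ∂(stdGaussian E) := by
    intro F _ _ f hf
    rw [← integral_map hG.aemeasurable hf.aestronglyMeasurable, ← hν, hstd,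
      integral_map (by fun_prop) hf.aestronglyMeasurable]
  have t1 := tr (fun x => ⟪A x, x⟫_ℝ) (by fun_prop)
  rw [t1, tr (fun x => Complex.exp (Complex.I * (⟪A x, x⟫_ℝ
      - ∫ w, ⟪A (T w), T w⟫_ℝ ∂(stdGaussian E) : ℝ))) (by fun_prop),
    tr (fun x => (⟪A x, x⟫_ℝ - ∫ w, ⟪A (T w), T w⟫_ℝ ∂(stdGaussian E)) ^ 2) (by fun_prop)]
  simp_rw [hBA]
  exact key

end FiniteDimensional

end QuadraticForm

end FunctionalCLT

namespace FunctionalCLT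

/-! ### Sampled kernels and sums over lags -/

section DiscreteKernel

theorem sum_Icc_int_eq_sum_range {M : Type*} [AddCommMonoid M] (p q : ℤ) (f : ℤ → M) :
    ∑ d ∈ Finset.Icc p q, f d = ∑ t ∈ Finset.range (q + 1 - p).toNat, f (p + t) := by
  refine (Finset.sum_nbij' (fun t : ℕ => p + t) (fun d : ℤ => (d - p).toNat) ?_ ?_ ?_ ?_ ?_).symm
  · intro t ht; simp only [Finset.mem_range, Finset.mem_Icc] at *; omega
  · intro t ht; simp only [Finset.mem_range, Finset.mem_Icc] at *; omega
  · intro t ht; simp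
  · intro t ht; simp only [Finset.mem_Icc] at *; omega
  · intro t ht; rfl

/-- Abel summation, kept in multiplied form so that no division by `1 - y` occurs. -/
theorem one_sub_mul_sum_range_pow (y : ℂ) (g : ℕ → ℂ) (m : ℕ) :
    (1 - y) * ∑ t ∈ Finset.range (m + 1), y ^ t * g t
      = g 0 - y ^ (m + 1) * g m + ∑ t ∈ Finset.range m, y ^ (t + 1) * (g (t + 1) - g t) := by
  induction m with
  | zero => simp; ring
  | succ m ih =>
    rw [Finset.sum_range_succ, mul_add, ih, Finset.sum_range_succ _ m]
    ring

/-- Summation by parts for an oscillating sum with coefficients of bounded variation. -/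
theorem norm_one_sub_mul_norm_sum_le {y : ℂ} (hy : ‖y‖ = 1) {g : ℤ → ℝ} {M V : ℝ}
    (hM : ∀ d, |g d| ≤ M) (hV : ∀ S : Finset ℤ, ∑ d ∈ S, |g (d + 1) - g d| ≤ V) (p q : ℤ) :
    ‖1 - y‖ * ‖∑ d ∈ Finset.Icc p q, y ^ d * (g d : ℂ)‖ ≤ 2 * M + V := by
  have hM0 : 0 ≤ M := (abs_nonneg _).trans (hM 0)
  have hV0 : 0 ≤ V := by simpa using hV ∅
  have hy0 : y ≠ 0 := by rintro rfl; simp at hy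
  rw [sum_Icc_int_eq_sum_range]
  rcases (q + 1 - p).toNat with _ | m
  · simp; positivity
  have e : ∑ t ∈ Finset.range (m + 1), y ^ (p + (t : ℤ)) * (g (p + t) : ℂ)
      = y ^ p * ∑ t ∈ Finset.range (m + 1), y ^ t * (g (p + t) : ℂ) := by
    rw [Finset.mul_sum]
    refine Finset.sum_congr rfl fun t _ => ?_
    rw [zpow_add₀ hy0, zpow_natCast]
    ring
  rw [e, norm_mul, norm_zpow, hy, one_zpow, one_mul, ← norm_mul,
    one_sub_mul_sum_range_pow y (fun t => (g (p + t) : ℂ))]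
  have h1 : ‖((g (p + (0 : ℕ)) : ℝ) : ℂ)‖ ≤ M := by
    rw [Complex.norm_real]; exact hM _
  have h2 : ‖y ^ (m + 1) * ((g (p + m) : ℝ) : ℂ)‖ ≤ M := by
    rw [norm_mul, norm_pow, hy, one_pow, one_mul, Complex.norm_real]; exact hM _
  have h3 : ‖∑ t ∈ Finset.range m, y ^ (t + 1) *
      (((g (p + (t + 1 : ℕ)) : ℝ) : ℂ) - ((g (p + t) : ℝ) : ℂ))‖ ≤ V := by
    refine (norm_sum_le _ _).trans ?_
    have h4 := hV ((Finset.range m).image fun t : ℕ => p + (t : ℤ))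
    rw [Finset.sum_image (by intro a _ b _ h; simpa using h)] at h4
    refine le_trans (le_of_eq (Finset.sum_congr rfl fun t _ => ?_)) h4
    rw [norm_mul, norm_pow, hy, one_pow, one_mul, ← Complex.ofReal_sub, Complex.norm_real,
      Real.norm_eq_abs]
    push_cast
    rw [add_assoc]
  calc _ ≤ M + M + V := (norm_add_le _ _).trans (add_le_add ((norm_sub_le _ _).trans
        (add_le_add h1 h2)) h3)
    _ = _ := by ring

/-- A sampled kernel: nonnegative, bounded by `M`, of variation at most `V`, supported in
`[-N, N]`. -/
structure IsSampledKernel (k : ℤ → ℝ) (M V : ℝ) (N : ℕ) : Prop where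
  nonneg : ∀ d, 0 ≤ k d
  le : ∀ d, k d ≤ M
  variation : ∀ S : Finset ℤ, ∑ d ∈ S, |k (d + 1) - k d| ≤ V
  support : ∀ d : ℤ, (N : ℤ) < |d| → k d = 0

namespace IsSampledKernel

variable {k : ℤ → ℝ} {M V : ℝ} {N : ℕ} (hk : IsSampledKernel k M V N)
include hk

theorem bound_nonneg : 0 ≤ M := (hk.nonneg 0).trans (hk.le 0)

theorem variation_nonneg : 0 ≤ V := by simpa using hk.variation ∅

theorem sum_le (S : Finset ℤ) : ∑ d ∈ S, k d ≤ M * (2 * N + 1) := by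
  classical
  calc ∑ d ∈ S, k d = ∑ d ∈ S.filter (fun d => |d| ≤ (N : ℤ)), k d := by
        rw [Finset.sum_filter]
        refine Finset.sum_congr rfl fun d _ => ?_
        split_ifs with h
        · rfl
        · exact hk.support d (not_le.mp h)
    _ ≤ ∑ d ∈ Finset.Icc (-(N : ℤ)) N, k d := by
        refine Finset.sum_le_sum_of_subset_of_nonneg (fun d hd => ?_) fun d _ _ => hk.nonneg d
        rw [Finset.mem_filter] at hd
        exact Finset.mem_Icc.mpr (abs_le.mp hd.2)
    _ ≤ ∑ d ∈ Finset.Icc (-(N : ℤ)) N, M := Finset.sum_le_sum fun d _ => hk.le d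
    _ = M * (2 * N + 1) := by
        rw [Finset.sum_const, Int.card_Icc, nsmul_eq_mul, mul_comm]
        congr 1
        have : ((N : ℤ) + 1 - -(N : ℤ)).toNat = 2 * N + 1 := by omega
        rw [this]; push_cast; ring

theorem sum_mul_le (S : Finset ℤ) (c : ℤ) : ∑ d ∈ S, k (d + c) * k d ≤ M ^ 2 * (2 * N + 1) := by
  calc ∑ d ∈ S, k (d + c) * k d ≤ ∑ d ∈ S, M * k d :=
        Finset.sum_le_sum fun d _ => mul_le_mul_of_nonneg_right (hk.le _) (hk.nonneg _)
    _ = M * ∑ d ∈ S, k d := by rw [Finset.mul_sum]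
    _ ≤ M * (M * (2 * N + 1)) := mul_le_mul_of_nonneg_left (hk.sum_le S) hk.bound_nonneg
    _ = _ := by ring

theorem shift_variation (c : ℤ) (S : Finset ℤ) :
    ∑ d ∈ S, |k (d + 1 + c) - k (d + c)| ≤ V := by
  classical
  have h := hk.variation (S.image fun d => d + c)
  rw [Finset.sum_image (by intro a _ b _ h; simpa using h)] at h
  refine le_trans (le_of_eq (Finset.sum_congr rfl fun d _ => ?_)) h
  rw [add_right_comm]

theorem sum_shift_sub_nat (c : ℕ) (S : Finset ℤ) : ∑ d ∈ S, |k (d + c) - k d| ≤ c * V := by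
  induction c with
  | zero => simp
  | succ c ih =>
    calc ∑ d ∈ S, |k (d + (c + 1 : ℕ)) - k d|
        ≤ ∑ d ∈ S, (|k (d + 1 + c) - k (d + c)| + |k (d + c) - k d|) := by
          refine Finset.sum_le_sum fun d _ => ?_
          have e : d + ((c + 1 : ℕ) : ℤ) = d + 1 + c := by push_cast; ring
          rw [e]
          exact abs_sub_le _ _ _
      _ ≤ V + c * V := by
          rw [Finset.sum_add_distrib]
          exact add_le_add (hk.shift_variation c S) ih
      _ = _ := by push_cast; ring

theorem sum_shift_sub (c : ℤ) (S : Finset ℤ) : ∑ d ∈ S, |k (d + c) - k d| ≤ |(c : ℝ)| * V := by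
  classical
  rcases le_total 0 c with hc | hc
  · obtain ⟨m, rfl⟩ := Int.eq_ofNat_of_zero_le hc
    simpa using hk.sum_shift_sub_nat m S
  · obtain ⟨m, hm⟩ := Int.eq_ofNat_of_zero_le (neg_nonneg.mpr hc)
    have hc' : c = -(m : ℤ) := by omega
    subst hc'
    have h := hk.sum_shift_sub_nat m (S.image fun d => d + -(m : ℤ))
    rw [Finset.sum_image (by intro a _ b _ h; simpa using h)] at h
    have e : |(((-(m : ℤ)) : ℤ) : ℝ)| = m := by push_cast; rw [abs_neg, Nat.abs_cast]
    rw [e]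
    refine le_trans (le_of_eq (Finset.sum_congr rfl fun d _ => ?_)) h
    rw [abs_sub_comm]
    congr 3
    ring

theorem abs_mul_le (c d : ℤ) : |k (d + c) * k d| ≤ M ^ 2 := by
  rw [abs_of_nonneg (mul_nonneg (hk.nonneg _) (hk.nonneg _)), sq]
  exact mul_le_mul (hk.le _) (hk.le _) (hk.nonneg _) hk.bound_nonneg

theorem mul_variation (c : ℤ) (S : Finset ℤ) :
    ∑ d ∈ S, |k (d + 1 + c) * k (d + 1) - k (d + c) * k d| ≤ 2 * M * V := by
  calc ∑ d ∈ S, |k (d + 1 + c) * k (d + 1) - k (d + c) * k d|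
      ≤ ∑ d ∈ S, (M * |k (d + 1 + c) - k (d + c)| + M * |k (d + 1) - k d|) := by
        refine Finset.sum_le_sum fun d _ => ?_
        have e : k (d + 1 + c) * k (d + 1) - k (d + c) * k d
            = k (d + 1) * (k (d + 1 + c) - k (d + c)) + k (d + c) * (k (d + 1) - k d) := by ring
        rw [e]
        refine (abs_add_le _ _).trans ?_
        rw [abs_mul, abs_mul, abs_of_nonneg (hk.nonneg _), abs_of_nonneg (hk.nonneg _)]
        gcongr
        · exact hk.le _
        · exact hk.le _
    _ ≤ M * V + M * V := by
        rw [Finset.sum_add_distrib, ← Finset.mul_sum, ← Finset.mul_sum]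
        have := hk.bound_nonneg
        gcongr
        · exact hk.shift_variation c S
        · exact hk.variation S
    _ = _ := by ring

end IsSampledKernel

/-- The weights in the second moment of the estimator: the sum of `y^(i-j) k(i-j+a-b) k(i-j)` over
`i, j, i + a, j + b ∈ {1, …, n}`. -/
noncomputable def pairWeight (k : ℤ → ℝ) (n : ℕ) (y : ℂ) (a b : ℤ) : ℂ :=
  ∑ j ∈ Finset.Icc (1 : ℤ) n, ∑ i ∈ Finset.Icc (1 : ℤ) n,
    if i + a ∈ Finset.Icc (1 : ℤ) n ∧ j + b ∈ Finset.Icc (1 : ℤ) n then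
      y ^ (i - j) * ((k (i - j + (a - b)) * k (i - j) : ℝ) : ℂ) else 0

section PairWeight

variable {k : ℤ → ℝ} {M V : ℝ} {N : ℕ} (hk : IsSampledKernel k M V N) (n : ℕ)
include hk

/-- For fixed `j` at most `2N + 1` values of `i` contribute. No cancellation is used, so the bound
holds for every phase. -/
theorem norm_pairWeight_le {y : ℂ} (hy : ‖y‖ = 1) (a b : ℤ) :
    ‖pairWeight k n y a b‖ ≤ n * (M ^ 2 * (2 * N + 1)) := by
  classical
  unfold pairWeight
  refine (norm_sum_le _ _).trans ?_
  have h : ∀ j ∈ Finset.Icc (1 : ℤ) n, ‖∑ i ∈ Finset.Icc (1 : ℤ) n,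
    (if i + a ∈ Finset.Icc (1 : ℤ) n ∧ j + b ∈ Finset.Icc (1 : ℤ) n then
      y ^ (i - j) * ((k (i - j + (a - b)) * k (i - j) : ℝ) : ℂ) else 0)‖
      ≤ M ^ 2 * (2 * N + 1) := by
    intro j _
    refine (norm_sum_le _ _).trans ?_
    have h1 := hk.sum_mul_le ((Finset.Icc (1 : ℤ) n).image fun i => i - j) (a - b)
    rw [Finset.sum_image (by intro a _ b _ h; simpa using h)] at h1
    refine (Finset.sum_le_sum fun i _ => ?_).trans h1
    have h0 : 0 ≤ k (i - j + (a - b)) * k (i - j) := mul_nonneg (hk.nonneg _) (hk.nonneg _)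
    split_ifs
    · rw [norm_mul, norm_zpow, hy, one_zpow, one_mul, Complex.norm_real, Real.norm_of_nonneg h0]
    · simpa using h0
  refine (Finset.sum_le_sum h).trans ?_
  simp

/-- For fixed `j` the admissible `i` form an interval, so summation by parts bounds the inner sum
independently of `N`; there are `n` values of `j`. The gain over the trivial bound is the missing
factor `2N + 1`. -/
theorem norm_one_sub_mul_norm_pairWeight_le {y : ℂ} (hy : ‖y‖ = 1) (a b : ℤ) :
    ‖1 - y‖ * ‖pairWeight k n y a b‖ ≤ n * (2 * M ^ 2 + 2 * M * V) := by
  classical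
  have hy0 : y ≠ 0 := by rintro rfl; simp at hy
  have hM := hk.bound_nonneg
  have hV := hk.variation_nonneg
  unfold pairWeight
  have h : ∀ j ∈ Finset.Icc (1 : ℤ) n, ‖1 - y‖ * ‖∑ i ∈ Finset.Icc (1 : ℤ) n,
    (if i + a ∈ Finset.Icc (1 : ℤ) n ∧ j + b ∈ Finset.Icc (1 : ℤ) n then
      y ^ (i - j) * ((k (i - j + (a - b)) * k (i - j) : ℝ) : ℂ) else 0)‖
      ≤ 2 * M ^ 2 + 2 * M * V := by
    intro j _
    by_cases hjb : j + b ∈ Finset.Icc (1 : ℤ) n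
    · simp only [hjb, and_true]
      rw [← Finset.sum_filter]
      have e : (Finset.Icc (1 : ℤ) n).filter (fun i => i + a ∈ Finset.Icc (1 : ℤ) n)
          = Finset.Icc (max 1 (1 - a)) (min n (n - a)) := by
        ext i
        simp only [Finset.mem_filter, Finset.mem_Icc]
        omega
      have e2 : ∑ i ∈ Finset.Icc (max 1 (1 - a)) (min (n : ℤ) (n - a)),
          y ^ (i - j) * ((k (i - j + (a - b)) * k (i - j) : ℝ) : ℂ)
          = y ^ (-j) * ∑ i ∈ Finset.Icc (max 1 (1 - a)) (min (n : ℤ) (n - a)),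
            y ^ i * ((k (i - j + (a - b)) * k (i - j) : ℝ) : ℂ) := by
        rw [Finset.mul_sum]
        refine Finset.sum_congr rfl fun i _ => ?_
        rw [sub_eq_add_neg, zpow_add₀ hy0]
        ring
      rw [e, e2, norm_mul, norm_zpow, hy, one_zpow, one_mul]
      refine norm_one_sub_mul_norm_sum_le hy (g := fun i => k (i - j + (a - b)) * k (i - j))
        (fun d => hk.abs_mul_le _ _) (fun S => ?_) _ _
      have h1 := hk.mul_variation (a - b) (S.image fun i => i - j)
      rw [Finset.sum_image (by intro a _ b _ h; simpa using h)] at h1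
      refine le_trans (le_of_eq (Finset.sum_congr rfl fun d _ => ?_)) h1
      have e3 : d + 1 - j = d - j + 1 := by ring
      rw [e3]
    · simp only [hjb, and_false]
      simp
      positivity
  refine (mul_le_mul_of_nonneg_left (norm_sum_le _ _) (norm_nonneg _)).trans ?_
  rw [Finset.mul_sum]
  refine (Finset.sum_le_sum h).trans ?_
  simp [mul_add]

/-- If `j` is at distance at least `N + l` from both ends, no boundary constraint acts and the inner
sum is the full shifted correlation of `k`. Replacing it by `∑ k²` costs at most `|a - b| V M`. Each
of the at most `2(N + l)` remaining `j` costs no more than the trivial bound. -/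
theorem norm_pairWeight_one_sub_le {l : ℕ} {a b : ℤ} (ha : |a| ≤ l) (hb : |b| ≤ l) :
    ‖pairWeight k n 1 a b - ((n * ∑ d ∈ Finset.Icc (-(N : ℤ)) N, k d ^ 2 : ℝ) : ℂ)‖
      ≤ n * (2 * l * V * M) + 2 * (N + l) * (M ^ 2 * (2 * N + 1)) := by
  classical
  have hM := hk.bound_nonneg
  have hV := hk.variation_nonneg
  set κ : ℝ := ∑ d ∈ Finset.Icc (-(N : ℤ)) N, k d ^ 2 with hκ
  set s : ℤ → ℝ := fun j => ∑ i ∈ Finset.Icc (1 : ℤ) n,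
    if i + a ∈ Finset.Icc (1 : ℤ) n ∧ j + b ∈ Finset.Icc (1 : ℤ) n then
      k (i - j + (a - b)) * k (i - j) else 0 with hs
  have e1 : pairWeight k n 1 a b = ((∑ j ∈ Finset.Icc (1 : ℤ) n, s j : ℝ) : ℂ) := by
    unfold pairWeight
    simp only [hs, one_zpow, one_mul]
    push_cast
    refine Finset.sum_congr rfl fun j _ => Finset.sum_congr rfl fun i _ => ?_
    split_ifs <;> simp
  have e2 : (n * κ : ℝ) = ∑ j ∈ Finset.Icc (1 : ℤ) n, κ := by simp
  rw [e1, e2, ← Complex.ofReal_sub, ← Finset.sum_sub_distrib, Complex.norm_real, Real.norm_eq_abs]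
  have hκ0 : 0 ≤ κ := Finset.sum_nonneg fun d _ => sq_nonneg _
  have hκB : κ ≤ M ^ 2 * (2 * N + 1) := by
    have := hk.sum_mul_le (Finset.Icc (-(N : ℤ)) N) 0
    simpa [sq, hκ] using this
  have hs0 : ∀ j, 0 ≤ s j := fun j => Finset.sum_nonneg fun i _ => by
    split_ifs
    · exact mul_nonneg (hk.nonneg _) (hk.nonneg _)
    · exact le_rfl
  have hsB : ∀ j, s j ≤ M ^ 2 * (2 * N + 1) := fun j => by
    have h1 := hk.sum_mul_le ((Finset.Icc (1 : ℤ) n).image fun i => i - j) (a - b)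
    rw [Finset.sum_image (by intro a _ b _ h; simpa using h)] at h1
    refine (Finset.sum_le_sum fun i _ => ?_).trans h1
    split_ifs
    · exact le_rfl
    · exact mul_nonneg (hk.nonneg _) (hk.nonneg _)
  set m : ℤ := N + l with hm
  have hcore : ∀ j ∈ Finset.Icc (1 + m) (n - m), |s j - κ| ≤ 2 * l * V * M := by
    intro j hj
    rw [Finset.mem_Icc] at hj
    have e3 : s j = ∑ d ∈ Finset.Icc (-(N : ℤ)) N, k (d + (a - b)) * k d := by
      have e4 : s j = ∑ i ∈ Finset.Icc (j - N) (j + N), k (i - j + (a - b)) * k (i - j) := by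
        symm
        rw [hs]
        refine Finset.sum_subset_zero_on_sdiff (fun i hi => ?_) (fun i hi => ?_) fun i hi => ?_
        · rw [Finset.mem_Icc] at *; omega
        · rw [Finset.mem_sdiff, Finset.mem_Icc, Finset.mem_Icc] at hi
          split_ifs
          · rw [hk.support (i - j), mul_zero]
            rw [lt_abs]; omega
          · rfl
        · rw [if_pos]
          rw [Finset.mem_Icc] at hi
          rw [abs_le] at ha hb
          constructor <;> rw [Finset.mem_Icc] <;> omega
      rw [e4]
      refine Finset.sum_nbij' (fun i => i - j) (fun d => d + j) ?_ ?_ ?_ ?_ ?_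
      · intro i hi; rw [Finset.mem_Icc] at *; omega
      · intro i hi; rw [Finset.mem_Icc] at *; omega
      · intro i _; ring
      · intro i _; ring
      · intro i _; rfl
    rw [e3, hκ, ← Finset.sum_sub_distrib]
    calc |∑ d ∈ Finset.Icc (-(N : ℤ)) N, (k (d + (a - b)) * k d - k d ^ 2)|
        ≤ ∑ d ∈ Finset.Icc (-(N : ℤ)) N, |k (d + (a - b)) * k d - k d ^ 2| :=
          Finset.abs_sum_le_sum_abs _ _
      _ ≤ ∑ d ∈ Finset.Icc (-(N : ℤ)) N, |k (d + (a - b)) - k d| * M := by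
          refine Finset.sum_le_sum fun d _ => ?_
          rw [sq, ← sub_mul, abs_mul, abs_of_nonneg (hk.nonneg d)]
          exact mul_le_mul_of_nonneg_left (hk.le d) (abs_nonneg _)
      _ ≤ |((a - b : ℤ) : ℝ)| * V * M := by
          rw [← Finset.sum_mul]
          exact mul_le_mul_of_nonneg_right (hk.sum_shift_sub _ _) hM
      _ ≤ 2 * l * V * M := by
          have h5 : |((a - b : ℤ) : ℝ)| ≤ 2 * l := by
            have h6 : |a - b| ≤ 2 * (l : ℤ) := by
              rw [abs_le] at *; omega
            exact_mod_cast h6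
          gcongr
  calc |∑ j ∈ Finset.Icc (1 : ℤ) n, (s j - κ)| ≤ ∑ j ∈ Finset.Icc (1 : ℤ) n, |s j - κ| :=
        Finset.abs_sum_le_sum_abs _ _
    _ ≤ ∑ j ∈ Finset.Icc (1 : ℤ) n, (2 * l * V * M +
          if j ∈ Finset.Icc (1 + m) (n - m) then 0 else M ^ 2 * (2 * N + 1)) := by
        refine Finset.sum_le_sum fun j _ => ?_
        split_ifs with hj
        · rw [add_zero]; exact hcore j hj
        · have : |s j - κ| ≤ M ^ 2 * (2 * N + 1) := by
            rw [abs_le]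
            constructor <;> linarith [hs0 j, hsB j]
          have h7 : 0 ≤ 2 * l * V * M := by positivity
          linarith
    _ = n * (2 * l * V * M) + ((Finset.Icc (1 : ℤ) n).filter
          (fun j => j ∉ Finset.Icc (1 + m) (n - m))).card * (M ^ 2 * (2 * N + 1)) := by
        rw [Finset.sum_add_distrib, Finset.sum_const, Int.card_Icc, nsmul_eq_mul]
        congr 1
        · simp
        · have : ∀ j : ℤ, (if j ∈ Finset.Icc (1 + m) (n - m) then (0 : ℝ)
              else M ^ 2 * (2 * N + 1)) = if j ∉ Finset.Icc (1 + m) (n - m) then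
                M ^ 2 * (2 * N + 1) else 0 := fun j => by
            by_cases hj : j ∈ Finset.Icc (1 + m) (n - m) <;> simp only [hj] <;> simp
          simp_rw [this]
          rw [← Finset.sum_filter, Finset.sum_const, nsmul_eq_mul]
    _ ≤ _ := by
        gcongr
        have hsub : (Finset.Icc (1 : ℤ) n).filter (fun j => j ∉ Finset.Icc (1 + m) (n - m))
            ⊆ Finset.Icc 1 m ∪ Finset.Icc (n - m + 1) n := by
          intro j hj
          simp only [Finset.mem_filter, Finset.mem_Icc, Finset.mem_union] at *
          omega
        have hc := (Finset.card_le_card hsub).trans (Finset.card_union_le _ _)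
        rw [Int.card_Icc, Int.card_Icc] at hc
        have hc2 : ((Finset.Icc (1 : ℤ) n).filter
            (fun j => j ∉ Finset.Icc (1 + m) (n - m))).card ≤ 2 * (N + l) := by omega
        exact_mod_cast hc2

end PairWeight

theorem sum_Icc_eq_sum_shift {n : ℕ} {i' : ℤ} (hi' : i' ∈ Finset.Icc (1 : ℤ) n) (F : ℤ → ℂ) :
    ∑ i ∈ Finset.Icc (1 : ℤ) n, F i
      = ∑ a ∈ Finset.Icc (-(n : ℤ)) n, if i' + a ∈ Finset.Icc (1 : ℤ) n then F (i' + a) else 0 := by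
  classical
  rw [← Finset.sum_filter]
  rw [Finset.mem_Icc] at hi'
  refine Finset.sum_nbij' (fun i => i - i') (fun a => i' + a) ?_ ?_ ?_ ?_ ?_
  · intro i hi; simp only [Finset.mem_filter, Finset.mem_Icc] at *; omega
  · intro i hi; simp only [Finset.mem_filter, Finset.mem_Icc] at *; omega
  · intro i _; ring
  · intro i _; ring
  · intro i _; congr 1; ring

/-- Reorganization of the fourfold sum in the second moment of the estimator by lags. -/
theorem sum_four_eq_sum_lags (n : ℕ) (Φ Ψ g g' : ℤ → ℂ) :
    ∑ i' ∈ Finset.Icc (1 : ℤ) n, ∑ j' ∈ Finset.Icc (1 : ℤ) n,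
      ∑ i ∈ Finset.Icc (1 : ℤ) n, ∑ j ∈ Finset.Icc (1 : ℤ) n,
        Φ (i - i') * Ψ (j - j') * (g (i - j) * g' (i' - j'))
      = ∑ a ∈ Finset.Icc (-(n : ℤ)) n, ∑ b ∈ Finset.Icc (-(n : ℤ)) n, Φ a * Ψ b *
        ∑ j' ∈ Finset.Icc (1 : ℤ) n, ∑ i' ∈ Finset.Icc (1 : ℤ) n,
          if i' + a ∈ Finset.Icc (1 : ℤ) n ∧ j' + b ∈ Finset.Icc (1 : ℤ) n then
            g (i' - j' + (a - b)) * g' (i' - j') else 0 := by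
  classical
  have h1 : ∀ i' ∈ Finset.Icc (1 : ℤ) n, ∀ j' ∈ Finset.Icc (1 : ℤ) n,
      ∑ i ∈ Finset.Icc (1 : ℤ) n, ∑ j ∈ Finset.Icc (1 : ℤ) n,
        Φ (i - i') * Ψ (j - j') * (g (i - j) * g' (i' - j'))
      = ∑ a ∈ Finset.Icc (-(n : ℤ)) n, ∑ b ∈ Finset.Icc (-(n : ℤ)) n, Φ a * Ψ b *
          if i' + a ∈ Finset.Icc (1 : ℤ) n ∧ j' + b ∈ Finset.Icc (1 : ℤ) n then
            g (i' - j' + (a - b)) * g' (i' - j') else 0 := by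
    intro i' hi' j' hj'
    rw [sum_Icc_eq_sum_shift hi']
    refine Finset.sum_congr rfl fun a _ => ?_
    by_cases ha : i' + a ∈ Finset.Icc (1 : ℤ) n
    · rw [if_pos ha, sum_Icc_eq_sum_shift hj']
      refine Finset.sum_congr rfl fun b _ => ?_
      by_cases hb : j' + b ∈ Finset.Icc (1 : ℤ) n
      · rw [if_pos hb, if_pos ⟨ha, hb⟩, add_sub_cancel_left, add_sub_cancel_left]
        congr 3
        ring
      · rw [if_neg hb, if_neg (fun h => hb h.2), mul_zero]
    · rw [if_neg ha]
      symm
      refine Finset.sum_eq_zero fun b _ => ?_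
      rw [if_neg (fun h => ha h.1), mul_zero]
  rw [Finset.sum_congr rfl fun i' hi' => Finset.sum_congr rfl fun j' hj' => h1 i' hi' j' hj']
  simp_rw [Finset.mul_sum]
  rw [Finset.sum_comm]
  simp_rw [Finset.sum_comm (s := Finset.Icc (1 : ℤ) (n : ℤ)) (t := Finset.Icc (-(n : ℤ)) (n : ℤ))]

end DiscreteKernel

end FunctionalCLT

namespace FunctionalCLT

/-! ### Sampling a kernel of bounded variation -/

section KernelSampling

/-- Since `t ≤ h`, the intervals `[x + ih, x + ih + t]` do not overlap, so their increments add up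
to at most the variation. Half-lines in the bound let the induction use superadditivity. -/
theorem sum_range_edist_le_eVariationOn (K : ℝ → ℝ) {h t : ℝ} (ht : 0 ≤ t) (hth : t ≤ h) (x : ℝ)
    (m : ℕ) : ∑ i ∈ Finset.range m, edist (K (x + i * h + t)) (K (x + i * h))
      ≤ eVariationOn K (Set.Iic (x + m * h)) := by
  induction m with
  | zero => simp
  | succ m ih =>
    rw [Finset.sum_range_succ]
    have h1 : edist (K (x + m * h + t)) (K (x + m * h))
        ≤ eVariationOn K (Set.Icc (x + m * h) (x + m * h + t)) :=
      eVariationOn.edist_le K (by simp [ht]) (by simp [ht])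
    refine (add_le_add ih h1).trans ((eVariationOn.add_le_union K ?_).trans
      (eVariationOn.mono K ?_))
    · intro a ha b hb
      exact le_trans ha hb.1
    · rintro y (hy | hy)
      · simp only [Set.mem_Iic] at *
        push_cast
        nlinarith
      · simp only [Set.mem_Iic]
        have := hy.2
        push_cast
        nlinarith

theorem sum_abs_sub_le_eVariationOn {K : ℝ → ℝ} (hK : BoundedVariationOn K Set.univ) {h t : ℝ}
    (ht : 0 ≤ t) (hth : t ≤ h) (S : Finset ℤ) :
    ∑ d ∈ S, |K (d * h + t) - K (d * h)| ≤ (eVariationOn K Set.univ).toReal := by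
  classical
  obtain ⟨m, hm⟩ : ∃ m : ℕ, ∀ d ∈ S, |d| ≤ (m : ℤ) := by
    refine ⟨(S.sup fun d => d.natAbs), fun d hd => ?_⟩
    have := Finset.le_sup (f := fun d : ℤ => d.natAbs) hd
    rw [Int.abs_eq_natAbs]
    exact_mod_cast this
  have h1 := (sum_range_edist_le_eVariationOn K ht hth (-(m : ℝ) * h) (2 * m + 1)).trans
    (eVariationOn.mono K (Set.subset_univ _))
  have h2 := ENNReal.toReal_mono hK h1
  refine le_trans ?_ h2
  rw [ENNReal.toReal_sum (fun _ _ => edist_ne_top _ _)]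
  have h3 : ∑ d ∈ S, |K (d * h + t) - K (d * h)|
      ≤ ∑ d ∈ Finset.Icc (-(m : ℤ)) m, |K (d * h + t) - K (d * h)| :=
    Finset.sum_le_sum_of_subset_of_nonneg
      (fun d hd => Finset.mem_Icc.mpr (abs_le.mp (hm d hd))) fun _ _ _ => abs_nonneg _
  refine h3.trans (le_of_eq ?_)
  rw [sum_Icc_int_eq_sum_range]
  have e : ((m : ℤ) + 1 - -(m : ℤ)).toNat = 2 * m + 1 := by omega
  rw [e]
  refine Finset.sum_congr rfl fun i _ => ?_
  rw [← dist_edist, Real.dist_eq]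
  congr 3 <;> push_cast <;> ring_nf

/-- The constants do not depend on the mesh: `V` is the total variation, `M = K 0 + V`, and `R` is a
radius of the support; only the window `⌈R / h⌉` changes with `h`. -/
theorem IsCLTKernel.exists_isSampledKernel {K : ℝ → ℝ} (hK : IsCLTKernel K) :
    ∃ M V R : ℝ, 0 ≤ R ∧ (∀ x, K x ≤ M) ∧ (∀ x, R < |x| → K x = 0) ∧
      (∀ h t : ℝ, 0 ≤ t → t ≤ h → ∀ S : Finset ℤ, ∑ d ∈ S, |K (d * h + t) - K (d * h)| ≤ V) ∧
      ∀ h : ℝ, 0 < h → IsSampledKernel (fun d : ℤ => K (d * h)) M V ⌈R / h⌉₊ := by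
  obtain ⟨R, hR⟩ := hK.compact_support.isBounded.subset_closedBall (0 : ℝ)
  have hR' : ∀ x, R < |x| → K x = 0 := fun x hx => by
    by_contra h
    have := hR (subset_tsupport K h)
    simp [Real.norm_eq_abs] at this
    linarith
  have hvar := fun h t ht hth S => sum_abs_sub_le_eVariationOn hK.boundedVariation (h := h)
    (t := t) ht hth S
  have hV : 0 ≤ (eVariationOn K Set.univ).toReal := ENNReal.toReal_nonneg
  have hM : ∀ x, K x ≤ K 0 + (eVariationOn K Set.univ).toReal := fun x => by
    have h1 := ENNReal.toReal_mono hK.boundedVariation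
      (eVariationOn.edist_le K (Set.mem_univ x) (Set.mem_univ 0))
    rw [← dist_edist, Real.dist_eq] at h1
    linarith [le_abs_self (K x - K 0)]
  refine ⟨_, _, max R 0, le_max_right _ _, hM, fun x hx => hR' x ((le_max_left _ _).trans_lt hx),
    hvar, fun h hh => ⟨fun d => hK.nonneg _, fun d => hM _, fun S => ?_, fun d hd => ?_⟩⟩
  · refine le_trans (le_of_eq (Finset.sum_congr rfl fun d _ => ?_)) (hvar h h hh.le le_rfl S)
    push_cast
    ring_nf
  · refine hR' _ ?_
    have h1 : max R 0 / h ≤ (⌈max R 0 / h⌉₊ : ℝ) := Nat.le_ceil _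
    have h2 : ((⌈max R 0 / h⌉₊ : ℤ) : ℝ) < |(d : ℝ)| := by exact_mod_cast hd
    rw [abs_mul, abs_of_pos hh]
    refine (le_max_left R 0).trans_lt ?_
    rw [div_le_iff₀ hh] at h1
    have h3 : (⌈max R 0 / h⌉₊ : ℝ) < |(d : ℝ)| := by exact_mod_cast h2
    nlinarith

/-- A function of bounded variation is a difference of two monotone functions. -/
theorem IsCLTKernel.measurable {K : ℝ → ℝ} (hK : IsCLTKernel K) : Measurable K := by
  obtain ⟨p, q, hp, hq, h⟩ :=
    hK.boundedVariation.locallyBoundedVariationOn.exists_monotoneOn_sub_monotoneOn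
  rw [h]
  exact (monotoneOn_univ.mp hp).measurable.sub (monotoneOn_univ.mp hq).measurable

/-- Riemann sums of the square of a kernel of bounded variation. -/
theorem abs_riemannSum_sq_sub_integral_le {K : ℝ → ℝ} (hm : Measurable K) (h0 : ∀ x, 0 ≤ K x)
    {M V R : ℝ} (hR : 0 ≤ R) (hM : ∀ x, K x ≤ M) (hsupp : ∀ x, R < |x| → K x = 0)
    (hV : ∀ h t : ℝ, 0 ≤ t → t ≤ h → ∀ S : Finset ℤ, ∑ d ∈ S, |K (d * h + t) - K (d * h)| ≤ V)
    {h : ℝ} (hh : 0 < h) :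
    |h * ∑ d ∈ Finset.Icc (-(⌈R / h⌉₊ : ℤ)) ⌈R / h⌉₊, K (d * h) ^ 2 - ∫ x, K x ^ 2|
      ≤ h * (2 * M * V) := by
  have hM0 : 0 ≤ M := (h0 0).trans (hM 0)
  set N := ⌈R / h⌉₊ with hN
  have hRN : R ≤ N * h := (div_le_iff₀ hh).mp (Nat.le_ceil _)
  have hint : ∀ a b : ℝ, IntervalIntegrable (fun x => K x ^ 2) volume a b := fun a b => by
    rw [intervalIntegrable_iff]
    refine Measure.integrableOn_of_bounded (M := M ^ 2) (by simp) (by fun_prop) ?_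
    refine ae_of_all _ fun x => ?_
    rw [norm_pow, Real.norm_of_nonneg (h0 x)]
    exact pow_le_pow_left₀ (h0 x) (hM x) 2
  -- The cells `[dh, (d + 1)h]` with `|d| ≤ N` tile this interval, which contains the support up to
  -- its endpoints; hence the asymmetric right end.
  have e1 : ∫ x, K x ^ 2 = ∫ x in (-(N * h))..((N + 1) * h), K x ^ 2 := by
    rw [intervalIntegral.integral_of_le (by nlinarith), ← integral_Icc_eq_integral_Ioc,
      setIntegral_eq_integral_of_forall_compl_eq_zero]
    intro x hx
    rw [hsupp x, sq, mul_zero]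
    rw [lt_abs]
    by_contra hc
    push Not at hc
    exact hx ⟨by linarith, by nlinarith⟩
  have e2 : ∫ x in (-(N * h))..((N + 1) * h), K x ^ 2
      = ∑ d ∈ Finset.Icc (-(N : ℤ)) N, ∫ t in (0 : ℝ)..h, K (d * h + t) ^ 2 := by
    have h1 := intervalIntegral.sum_integral_adjacent_intervals (μ := volume)
      (f := fun x => K x ^ 2) (a := fun i : ℕ => (i - N : ℝ) * h) (n := 2 * N + 1)
      fun i _ => hint _ _
    rw [sum_Icc_int_eq_sum_range]
    have e : ((N : ℤ) + 1 - -(N : ℤ)).toNat = 2 * N + 1 := by omega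
    rw [e]
    have e3 : ((2 * N + 1 : ℕ) - N : ℝ) * h = (N + 1) * h := by push_cast; ring
    have e4 : (((0 : ℕ) : ℝ) - N) * h = -(N * h) := by push_cast; ring
    rw [e3, e4] at h1
    rw [← h1]
    refine Finset.sum_congr rfl fun i _ => ?_
    rw [intervalIntegral.integral_comp_add_left (fun x => K x ^ 2)]
    congr 1 <;> push_cast <;> ring
  have e3 : h * ∑ d ∈ Finset.Icc (-(N : ℤ)) N, K (d * h) ^ 2
      = ∑ d ∈ Finset.Icc (-(N : ℤ)) N, ∫ t in (0 : ℝ)..h, K (d * h) ^ 2 := by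
    simp [Finset.mul_sum]
  have hint2 : ∀ d : ℤ, IntervalIntegrable (fun t => K (d * h + t) ^ 2) volume 0 h := fun d => by
    have := (hint (d * h + 0) (d * h + h)).comp_add_left (d * h)
    simpa using this
  -- With the sum inside the integral, at each fixed offset `t` the differences over all cells add
  -- up to at most `2MV`, since squaring costs a factor `2M`.
  have e4 : (∑ d ∈ Finset.Icc (-(N : ℤ)) N, ∫ t in (0 : ℝ)..h, K (d * h) ^ 2)
      - ∑ d ∈ Finset.Icc (-(N : ℤ)) N, ∫ t in (0 : ℝ)..h, K (d * h + t) ^ 2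
      = ∫ t in (0 : ℝ)..h, ∑ d ∈ Finset.Icc (-(N : ℤ)) N, (K (d * h) ^ 2 - K (d * h + t) ^ 2) := by
    rw [intervalIntegral.integral_finsetSum fun d _ => intervalIntegrable_const.sub (hint2 d),
      ← Finset.sum_sub_distrib]
    exact Finset.sum_congr rfl fun d _ =>
      (intervalIntegral.integral_sub intervalIntegrable_const (hint2 d)).symm
  rw [e1, e2, e3, e4, ← Real.norm_eq_abs]
  refine (intervalIntegral.norm_integral_le_of_norm_le_const (C := 2 * M * V) ?_).trans ?_
  · intro t ht
    rw [Set.uIoc_of_le hh.le] at ht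
    rw [Real.norm_eq_abs]
    calc |∑ d ∈ Finset.Icc (-(N : ℤ)) N, (K (d * h) ^ 2 - K (d * h + t) ^ 2)|
        ≤ ∑ d ∈ Finset.Icc (-(N : ℤ)) N, |K (d * h) ^ 2 - K (d * h + t) ^ 2| :=
          Finset.abs_sum_le_sum_abs _ _
      _ ≤ ∑ d ∈ Finset.Icc (-(N : ℤ)) N, 2 * M * |K (d * h + t) - K (d * h)| := by
          refine Finset.sum_le_sum fun d _ => ?_
          rw [sq_sub_sq, abs_mul, abs_sub_comm (K (d * h)),
            abs_of_nonneg (add_nonneg (h0 _) (h0 _))]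
          refine mul_le_mul_of_nonneg_right ?_ (abs_nonneg _)
          linarith [hM (d * h), hM (d * h + t)]
      _ ≤ 2 * M * V := by
          rw [← Finset.mul_sum]
          exact mul_le_mul_of_nonneg_left (hV h t ht.1.le ht.2 _) (by positivity)
  · rw [sub_zero, abs_of_pos hh, mul_comm]

end KernelSampling

/-! ### Consequences of the scaling conditions -/

section Scaling

variable {δ Δ L : ℕ → ℝ} {δinf : ℝ}

/-- The conditions on grid sizes, bandwidths and lags. -/
structure IsScaling (δ Δ L : ℕ → ℝ) (δinf : ℝ) : Prop where
  grid_pos : ∀ n, 0 < δ n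
  bandwidth_pos : ∀ n, 0 < Δ n
  L_pos : ∀ n, 0 < L n
  limit_nonneg : 0 ≤ δinf
  grid_tendsto : Tendsto δ atTop (𝓝 δinf)
  domain_tendsto : Tendsto (fun n => n * δ n / Δ n) atTop atTop
  L_grid_tendsto : Tendsto (fun n => L n * δ n) atTop atTop
  L_bandwidth_tendsto : Tendsto (fun n => L n / Δ n) atTop (𝓝 0)

namespace IsScaling

variable (hs : IsScaling δ Δ L δinf)
include hs

theorem tendsto_inv_bandwidth : Tendsto (fun n => 1 / Δ n) atTop (𝓝 0) := by
  have h1 : Tendsto (fun n => (L n / Δ n) * (L n * δ n)⁻¹ * δ n) atTop (𝓝 (0 * 0 * δinf)) :=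
    (hs.L_bandwidth_tendsto.mul hs.L_grid_tendsto.inv_tendsto_atTop).mul hs.grid_tendsto
  rw [zero_mul, zero_mul] at h1
  refine h1.congr fun n => ?_
  have := (hs.L_pos n).ne'
  have := (hs.grid_pos n).ne'
  have := (hs.bandwidth_pos n).ne'
  field_simp

theorem tendsto_step : Tendsto (fun n => δ n / Δ n) atTop (𝓝 0) := by
  have h1 := hs.grid_tendsto.mul hs.tendsto_inv_bandwidth
  rw [mul_zero] at h1
  refine h1.congr fun n => ?_
  rw [mul_one_div]

theorem step_pos (n : ℕ) : 0 < δ n / Δ n := div_pos (hs.grid_pos n) (hs.bandwidth_pos n)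

theorem tendsto_step_mul_L : Tendsto (fun n => δ n / Δ n * L n) atTop (𝓝 0) := by
  have h1 := hs.grid_tendsto.mul hs.L_bandwidth_tendsto
  rw [mul_zero] at h1
  refine h1.congr fun n => ?_
  ring

theorem tendsto_inv_step_div : Tendsto (fun n : ℕ => (δ n / Δ n)⁻¹ / n) atTop (𝓝 0) := by
  refine hs.domain_tendsto.inv_tendsto_atTop.congr fun n => ?_
  simp only [Pi.inv_apply]
  rw [inv_div, inv_div, div_div, mul_comm (δ n)]

theorem tendsto_L_div : Tendsto (fun n : ℕ => L n / n) atTop (𝓝 0) := by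
  have h1 := hs.tendsto_step_mul_L.mul hs.tendsto_inv_step_div
  rw [zero_mul] at h1
  refine h1.congr fun n => ?_
  have := (hs.step_pos n).ne'
  have := (hs.grid_pos n).ne'
  have := (hs.bandwidth_pos n).ne'
  field_simp

theorem tendsto_step_div_norm {θ : ℝ}
    (hθ : 0 < δinf → θ ∈ Set.Icc (-(Real.pi / δinf)) (Real.pi / δinf))
    (hc : cIndicator δinf θ = 0) :
    (∀ᶠ n in atTop, Complex.exp (Complex.I * (θ * δ n : ℝ)) ^ 2 ≠ 1) ∧
    Tendsto (fun n => δ n / Δ n / ‖1 - Complex.exp (Complex.I * (θ * δ n : ℝ)) ^ 2‖)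
      atTop (𝓝 0) := by
  have hderiv : HasDerivAt (fun x : ℝ => Complex.exp (Complex.I * (θ * x : ℝ)) ^ 2)
      (2 * (Complex.I * θ)) 0 := by
    have h1 : HasDerivAt (fun x : ℝ => Complex.I * ((θ * x : ℝ) : ℂ)) (Complex.I * θ) 0 := by
      have h2 : HasDerivAt (fun x : ℝ => θ * x) θ 0 := by
        simpa using (hasDerivAt_id (0 : ℝ)).const_mul θ
      exact h2.ofReal_comp.const_mul Complex.I
    have := (h1.cexp).fun_pow 2
    simpa using this
  unfold cIndicator at hc
  rcases hs.limit_nonneg.eq_or_lt with h0 | h0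
  · have hθ0 : θ ≠ 0 := by
      intro h
      simp [← h0, h] at hc
    have h1 : Tendsto (fun n => δ n) atTop (𝓝[≠] 0) := by
      refine tendsto_nhdsWithin_iff.mpr ⟨h0 ▸ hs.grid_tendsto, ?_⟩
      filter_upwards with n
      exact (hs.grid_pos n).ne'
    have h2 := (hasDerivAt_iff_tendsto_slope.mp hderiv).comp h1
    have h3 := h2.norm.inv₀ (by simp [hθ0])
    have h4 := hs.tendsto_inv_bandwidth.mul h3
    rw [zero_mul] at h4
    constructor
    · filter_upwards [h2.eventually_ne (b₂ := 0) (by simp [hθ0])] with n hn h1n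
      apply hn
      simp only [Function.comp, slope, vsub_eq_sub, h1n]
      simp
    refine h4.congr fun n => ?_
    have := (hs.grid_pos n)
    simp only [Function.comp, slope, vsub_eq_sub, sub_zero, norm_smul, norm_inv,
      Real.norm_of_nonneg this.le]
    rw [mul_inv, inv_inv, norm_sub_rev]
    simp
    ring
  · have hne : Complex.exp (Complex.I * (θ * δinf : ℝ)) ^ 2 ≠ 1 := by
      intro h
      rw [← Complex.exp_nat_mul, Complex.exp_eq_one_iff] at h
      obtain ⟨m, hm⟩ := h
      have h5 : θ * δinf = m * Real.pi := by
        have h6 : (Complex.I * 2) * ((θ * δinf : ℝ) : ℂ) = (Complex.I * 2) * ((m * Real.pi : ℝ) : ℂ) := by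
          push_cast at hm ⊢
          linear_combination hm
        exact_mod_cast mul_left_cancel₀ (by simp) h6
      rw [if_neg h0.ne'] at hc
      have h7 := hθ h0
      have hpi := Real.pi_pos
      have h8 : θ = m * (Real.pi / δinf) := by field_simp; linarith
      have hq : 0 < Real.pi / δinf := by positivity
      rw [h8] at h7
      have h9 : -1 ≤ (m : ℝ) := by
        have := h7.1
        by_contra hcc
        nlinarith
      have h10 : (m : ℝ) ≤ 1 := by
        have := h7.2
        by_contra hcc
        nlinarith
      have h11 : -1 ≤ m := by exact_mod_cast h9
      have h12 : m ≤ 1 := by exact_mod_cast h10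
      apply one_ne_zero (α := ℝ)
      rw [← hc, if_pos]
      interval_cases m <;> simp [h8]
    have h1 : Tendsto (fun n => ‖1 - Complex.exp (Complex.I * (θ * δ n : ℝ)) ^ 2‖) atTop
        (𝓝 ‖1 - Complex.exp (Complex.I * (θ * δinf : ℝ)) ^ 2‖) := by
      have : Continuous fun x : ℝ => ‖1 - Complex.exp (Complex.I * (θ * x : ℝ)) ^ 2‖ := by fun_prop
      exact (this.tendsto δinf).comp hs.grid_tendsto
    have hne' : ‖1 - Complex.exp (Complex.I * (θ * δinf : ℝ)) ^ 2‖ ≠ 0 := by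
      rw [norm_ne_zero_iff, sub_ne_zero]; exact hne.symm
    have h2 := hs.tendsto_step.div h1 hne'
    rw [zero_div] at h2
    refine ⟨?_, h2⟩
    filter_upwards [h1.eventually_ne hne'] with n hn h1n
    apply hn
    rw [h1n, sub_self, norm_zero]

end IsScaling

end Scaling

end FunctionalCLT

namespace FunctionalCLT

/-! ### Estimates for lag sums -/

section LagSum

/-- The sum over lags that describes one part of the second moment of the estimator. -/
noncomputable def lagSum (k : ℤ → ℝ) (n : ℕ) (y : ℂ) (Φ Ψ : ℤ → ℂ) : ℂ :=
  ∑ a ∈ Finset.Icc (-(n : ℤ)) n, ∑ b ∈ Finset.Icc (-(n : ℤ)) n, Φ a * Ψ b * pairWeight k n y a b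

/-- The normalization of the second moment of the estimator. -/
noncomputable def lagScale (δ Δ : ℝ) (n : ℕ) : ℝ := (δ / (2 * Real.pi)) ^ 2 * (δ / Δ / n)

theorem lagScale_nonneg {δ Δ : ℝ} (hδ : 0 ≤ δ) (hΔ : 0 ≤ Δ) (n : ℕ) : 0 ≤ lagScale δ Δ n := by
  unfold lagScale; positivity

theorem norm_sum_sum_mul_le (S : Finset ℤ) (Φ Ψ : ℤ → ℂ) (W : ℤ → ℤ → ℂ) {w : ℝ}
    (hW : ∀ a ∈ S, ∀ b ∈ S, ‖W a b‖ ≤ w) :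
    ‖∑ a ∈ S, ∑ b ∈ S, Φ a * Ψ b * W a b‖ ≤ (∑ a ∈ S, ‖Φ a‖) * (∑ b ∈ S, ‖Ψ b‖) * w := by
  rw [Finset.sum_mul_sum, Finset.sum_mul]
  refine (norm_sum_le _ _).trans (Finset.sum_le_sum fun a ha => ?_)
  rw [Finset.sum_mul]
  refine (norm_sum_le _ _).trans (Finset.sum_le_sum fun b hb => ?_)
  rw [norm_mul, norm_mul]
  exact mul_le_mul_of_nonneg_left (hW a ha b hb) (by positivity)

variable {k : ℤ → ℝ} {M V : ℝ} {N : ℕ} (hk : IsSampledKernel k M V N)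
include hk

/-- This bound ignores the phase. Its right side is a product of two absolute lag sums, the shape in
which the summability conditions on individual coordinates can be applied. -/
theorem lagScale_mul_norm_lagSum_le {δ Δ : ℝ} (hδ : 0 < δ) (hΔ : 0 < Δ) (n : ℕ) {y : ℂ}
    (hy : ‖y‖ = 1) (Φ Ψ : ℤ → ℂ) :
    lagScale δ Δ n * ‖lagSum k n y Φ Ψ‖ ≤ M ^ 2 * (δ / Δ * (2 * N + 1)) *
      ((δ * ∑ a ∈ Finset.Icc (-(n : ℤ)) n, ‖Φ a‖) * (δ * ∑ a ∈ Finset.Icc (-(n : ℤ)) n, ‖Ψ a‖)) := by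
  have h1 := norm_sum_sum_mul_le (Finset.Icc (-(n : ℤ)) n) Φ Ψ (pairWeight k n y)
    fun a _ b _ => norm_pairWeight_le hk n hy a b
  set A := ∑ a ∈ Finset.Icc (-(n : ℤ)) n, ‖Φ a‖ with hA
  set B := ∑ a ∈ Finset.Icc (-(n : ℤ)) n, ‖Ψ a‖ with hB
  have hA0 : 0 ≤ A := Finset.sum_nonneg fun _ _ => norm_nonneg _
  have hB0 : 0 ≤ B := Finset.sum_nonneg fun _ _ => norm_nonneg _
  refine (mul_le_mul_of_nonneg_left h1 (lagScale_nonneg hδ.le hΔ.le n)).trans ?_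
  have hpi : 1 ≤ 2 * Real.pi := by linarith [Real.pi_gt_three]
  have h2 : (δ / (2 * Real.pi)) ^ 2 ≤ δ ^ 2 := by
    gcongr
    exact div_le_self hδ.le hpi
  have h3 : (δ / Δ / n) * n ≤ δ / Δ := by
    rcases Nat.eq_zero_or_pos n with h | h
    · subst h; simp; positivity
    · rw [div_mul_cancel₀]; positivity
  unfold lagScale
  calc (δ / (2 * Real.pi)) ^ 2 * (δ / Δ / n) * (A * B * (n * (M ^ 2 * (2 * N + 1))))
      = (δ / (2 * Real.pi)) ^ 2 * (A * B) * (((δ / Δ / n) * n) * (M ^ 2 * (2 * N + 1))) := by ring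
    _ ≤ δ ^ 2 * (A * B) * ((δ / Δ) * (M ^ 2 * (2 * N + 1))) := by gcongr
    _ = _ := by ring

/-- Summation by parts replaces the bounded factor `(δ/Δ)(2N + 1)` of the trivial bound by `(δ/Δ)/|1
- y|`, which can tend to zero. -/
theorem lagScale_mul_norm_lagSum_osc_le {δ Δ : ℝ} (hδ : 0 < δ) (hΔ : 0 < Δ) (n : ℕ) {y : ℂ}
    (hy : ‖y‖ = 1) (hy1 : y ≠ 1) (Φ Ψ : ℤ → ℂ) :
    lagScale δ Δ n * ‖lagSum k n y Φ Ψ‖ ≤ (2 * M ^ 2 + 2 * M * V) * (δ / Δ / ‖1 - y‖) *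
      ((δ * ∑ a ∈ Finset.Icc (-(n : ℤ)) n, ‖Φ a‖) * (δ * ∑ a ∈ Finset.Icc (-(n : ℤ)) n, ‖Ψ a‖)) := by
  have hy2 : 0 < ‖1 - y‖ := norm_pos_iff.mpr (sub_ne_zero.mpr hy1.symm)
  have hM := hk.bound_nonneg
  have hV := hk.variation_nonneg
  have h1 := norm_sum_sum_mul_le (Finset.Icc (-(n : ℤ)) n) Φ Ψ (pairWeight k n y)
    (w := n * (2 * M ^ 2 + 2 * M * V) / ‖1 - y‖)
    fun a _ b _ => by
      rw [le_div_iff₀ hy2, mul_comm]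
      exact norm_one_sub_mul_norm_pairWeight_le hk n hy a b
  set A := ∑ a ∈ Finset.Icc (-(n : ℤ)) n, ‖Φ a‖ with hA
  set B := ∑ a ∈ Finset.Icc (-(n : ℤ)) n, ‖Ψ a‖ with hB
  have hA0 : 0 ≤ A := Finset.sum_nonneg fun _ _ => norm_nonneg _
  have hB0 : 0 ≤ B := Finset.sum_nonneg fun _ _ => norm_nonneg _
  refine (mul_le_mul_of_nonneg_left h1 (lagScale_nonneg hδ.le hΔ.le n)).trans ?_
  have hpi : 1 ≤ 2 * Real.pi := by linarith [Real.pi_gt_three]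
  have h2 : (δ / (2 * Real.pi)) ^ 2 ≤ δ ^ 2 := by
    gcongr
    exact div_le_self hδ.le hpi
  have h3 : (δ / Δ / n) * n ≤ δ / Δ := by
    rcases Nat.eq_zero_or_pos n with h | h
    · subst h; simp; positivity
    · rw [div_mul_cancel₀]; positivity
  unfold lagScale
  calc (δ / (2 * Real.pi)) ^ 2 * (δ / Δ / n) * (A * B * (n * (2 * M ^ 2 + 2 * M * V) / ‖1 - y‖))
      = (δ / (2 * Real.pi)) ^ 2 * (A * B) *
          (((δ / Δ / n) * n) * ((2 * M ^ 2 + 2 * M * V) / ‖1 - y‖)) := by ring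
    _ ≤ δ ^ 2 * (A * B) * ((δ / Δ) * ((2 * M ^ 2 + 2 * M * V) / ‖1 - y‖)) := by gcongr
    _ = _ := by ring

/-- The nonoscillating lag sum is close to a multiple of a product of two simple sums. -/
theorem norm_lagScale_mul_lagSum_one_sub_le {δ Δ : ℝ} (hδ : 0 < δ) (hΔ : 0 < Δ) {n l : ℕ}
    (hn : 0 < n) (Φ Ψ : ℤ → ℂ) {q ε : ℝ} (hq : 0 ≤ q)
    (hε : |δ / Δ * ∑ d ∈ Finset.Icc (-(N : ℤ)) N, k d ^ 2 - q| ≤ ε) :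
    ‖(lagScale δ Δ n : ℂ) * lagSum k n 1 Φ Ψ - (q : ℂ) *
      (((δ / (2 * Real.pi) : ℝ) : ℂ) * ∑ a ∈ Finset.Icc (-(n : ℤ)) n, Φ a) *
      (((δ / (2 * Real.pi) : ℝ) : ℂ) * ∑ a ∈ Finset.Icc (-(n : ℤ)) n, Ψ a)‖
    ≤ (δ / Δ * (2 * l * V * M) + 2 * ((N + l) / n) * (M ^ 2 * (δ / Δ * (2 * N + 1))) + ε) *
        ((δ * ∑ a ∈ Finset.Icc (-(n : ℤ)) n, ‖Φ a‖) * (δ * ∑ a ∈ Finset.Icc (-(n : ℤ)) n, ‖Ψ a‖)) +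
      (M ^ 2 * (δ / Δ * (2 * N + 1)) + q) *
        ((δ * ∑ a ∈ (Finset.Icc (-(n : ℤ)) n).filter (fun a => (l : ℤ) < |a|), ‖Φ a‖) *
          (δ * ∑ a ∈ Finset.Icc (-(n : ℤ)) n, ‖Ψ a‖) +
        (δ * ∑ a ∈ Finset.Icc (-(n : ℤ)) n, ‖Φ a‖) *
          (δ * ∑ a ∈ (Finset.Icc (-(n : ℤ)) n).filter (fun a => (l : ℤ) < |a|), ‖Ψ a‖)) := by
  classical
  have hM := hk.bound_nonneg
  have hV := hk.variation_nonneg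
  have hn' : (0 : ℝ) < n := by exact_mod_cast hn
  have hε0 : 0 ≤ ε := (abs_nonneg _).trans hε
  set S := Finset.Icc (-(n : ℤ)) n with hS
  set h := δ / Δ with hh
  have hh0 : 0 < h := div_pos hδ hΔ
  set E1 := h * (2 * l * V * M) + 2 * ((N + l) / n) * (M ^ 2 * (h * (2 * N + 1))) + ε with hE1
  set E2 := M ^ 2 * (h * (2 * N + 1)) + q with hE2
  have hE10 : 0 ≤ E1 := by positivity
  have hE20 : 0 ≤ E2 := by positivity
  have hpi : 1 ≤ 2 * Real.pi := by linarith [Real.pi_gt_three]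
  set κ := ∑ d ∈ Finset.Icc (-(N : ℤ)) N, k d ^ 2
  have e1 : (lagScale δ Δ n : ℂ) * lagSum k n 1 Φ Ψ - (q : ℂ) *
      (((δ / (2 * Real.pi) : ℝ) : ℂ) * ∑ a ∈ S, Φ a) * (((δ / (2 * Real.pi) : ℝ) : ℂ) * ∑ a ∈ S, Ψ a)
      = (((δ / (2 * Real.pi)) ^ 2 : ℝ) : ℂ) * ∑ a ∈ S, ∑ b ∈ S, Φ a * Ψ b *
        (((h / n : ℝ) : ℂ) * pairWeight k n 1 a b - (q : ℂ)) := by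
    have e2 : ∑ a ∈ S, ∑ b ∈ S, Φ a * Ψ b * (((h / n : ℝ) : ℂ) * pairWeight k n 1 a b - (q : ℂ))
        = ((h / n : ℝ) : ℂ) * lagSum k n 1 Φ Ψ - (q : ℂ) * ((∑ a ∈ S, Φ a) * ∑ b ∈ S, Ψ b) := by
      unfold lagSum
      rw [Finset.sum_mul_sum, Finset.mul_sum, Finset.mul_sum, ← Finset.sum_sub_distrib]
      refine Finset.sum_congr rfl fun a _ => ?_
      rw [Finset.mul_sum, Finset.mul_sum, ← Finset.sum_sub_distrib]
      refine Finset.sum_congr rfl fun b _ => ?_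
      ring
    rw [e2, lagScale, ← hh]
    push_cast
    ring
  -- When both lags are at most `l`, the weight is close to `q`. Otherwise only the trivial bound is
  -- available, and the indicators turn it into tails of `Φ` or `Ψ`.
  have hW : ∀ a ∈ S, ∀ b ∈ S, ‖((h / n : ℝ) : ℂ) * pairWeight k n 1 a b - (q : ℂ)‖
      ≤ E1 + E2 * ((if (l : ℤ) < |a| then 1 else 0) + (if (l : ℤ) < |b| then 1 else 0)) := by
    intro a _ b _
    by_cases hab : |a| ≤ l ∧ |b| ≤ l
    · rw [if_neg (not_lt.mpr hab.1), if_neg (not_lt.mpr hab.2), add_zero, mul_zero, add_zero]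
      have h1 := norm_pairWeight_one_sub_le hk n hab.1 hab.2
      have e3 : ((h / n : ℝ) : ℂ) * pairWeight k n 1 a b - (q : ℂ)
          = ((h / n : ℝ) : ℂ) * (pairWeight k n 1 a b - ((n * κ : ℝ) : ℂ))
            + ((h * κ - q : ℝ) : ℂ) := by
        have : (n : ℂ) ≠ 0 := by exact_mod_cast hn.ne'
        push_cast
        field_simp
        ring
      rw [e3]
      refine (norm_add_le _ _).trans ?_
      rw [norm_mul, Complex.norm_real, Complex.norm_real, Real.norm_eq_abs (h * κ - q),
        Real.norm_of_nonneg (by positivity)]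
      refine (add_le_add (mul_le_mul_of_nonneg_left h1 (by positivity)) hε).trans (le_of_eq ?_)
      rw [hE1]
      field_simp
    · have h1 : ‖((h / n : ℝ) : ℂ) * pairWeight k n 1 a b - (q : ℂ)‖ ≤ E2 := by
        refine (norm_sub_le _ _).trans ?_
        rw [norm_mul, Complex.norm_real, Complex.norm_real, Real.norm_of_nonneg hq,
          Real.norm_of_nonneg (by positivity)]
        refine add_le_add ((mul_le_mul_of_nonneg_left
          (norm_pairWeight_le hk n norm_one a b) (by positivity)).trans (le_of_eq ?_)) le_rfl
        field_simp
      have h2 : (1 : ℝ) ≤ (if (l : ℤ) < |a| then 1 else 0) + (if (l : ℤ) < |b| then 1 else 0) := by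
        by_cases ha : (l : ℤ) < |a|
        · rw [if_pos ha]; split_ifs <;> norm_num
        · have hb : (l : ℤ) < |b| := by
            by_contra hb
            exact hab ⟨not_lt.mp ha, not_lt.mp hb⟩
          rw [if_pos hb]; split_ifs; norm_num
      nlinarith
  rw [e1, norm_mul, Complex.norm_real, Real.norm_of_nonneg (by positivity)]
  have h5 : ‖∑ a ∈ S, ∑ b ∈ S, Φ a * Ψ b * (((h / n : ℝ) : ℂ) * pairWeight k n 1 a b - (q : ℂ))‖
      ≤ ∑ a ∈ S, ∑ b ∈ S, ‖Φ a‖ * ‖Ψ b‖ *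
        (E1 + E2 * ((if (l : ℤ) < |a| then 1 else 0) + (if (l : ℤ) < |b| then 1 else 0))) := by
    refine (norm_sum_le _ _).trans (Finset.sum_le_sum fun a ha => ?_)
    refine (norm_sum_le _ _).trans (Finset.sum_le_sum fun b hb => ?_)
    rw [norm_mul, norm_mul]
    exact mul_le_mul_of_nonneg_left (hW a ha b hb) (by positivity)
  have h6 : (δ / (2 * Real.pi)) ^ 2 ≤ δ ^ 2 := by
    gcongr
    exact div_le_self hδ.le hpi
  refine (mul_le_mul h6 h5 (norm_nonneg _) (by positivity)).trans (le_of_eq ?_)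
  have e7 : ∑ a ∈ S, ∑ b ∈ S, ‖Φ a‖ * ‖Ψ b‖ *
        (E1 + E2 * ((if (l : ℤ) < |a| then 1 else 0) + (if (l : ℤ) < |b| then 1 else 0)))
      = E1 * ((∑ a ∈ S, ‖Φ a‖) * ∑ b ∈ S, ‖Ψ b‖) +
        E2 * ((∑ a ∈ S, if (l : ℤ) < |a| then ‖Φ a‖ else 0) * (∑ b ∈ S, ‖Ψ b‖) +
          (∑ a ∈ S, ‖Φ a‖) * ∑ b ∈ S, if (l : ℤ) < |b| then ‖Ψ b‖ else 0) := by
    rw [Finset.sum_mul_sum, Finset.sum_mul_sum, Finset.sum_mul_sum, ← Finset.sum_add_distrib,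
      Finset.mul_sum, Finset.mul_sum, ← Finset.sum_add_distrib]
    refine Finset.sum_congr rfl fun a _ => ?_
    rw [← Finset.sum_add_distrib, Finset.mul_sum, Finset.mul_sum, ← Finset.sum_add_distrib]
    refine Finset.sum_congr rfl fun b _ => ?_
    split_ifs <;> ring
  rw [e7, Finset.sum_filter, Finset.sum_filter]
  ring

end LagSum

/-! ### Limits of lag sums -/

section LagLimit

/-- Uniform summability of the lag coefficients on the grids `δ n`. -/
structure IsLagBound (δ L : ℕ → ℝ) (γ : ℕ → ℤ → ℂ) (B : ℝ) (τ : ℕ → ℝ) : Prop where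
  bdd : ∀ n (S : Finset ℤ), δ n * ∑ a ∈ S, ‖γ n a‖ ≤ B
  tail : ∀ n (S : Finset ℤ), (∀ a ∈ S, L n < |(a : ℝ)|) → δ n * ∑ a ∈ S, ‖γ n a‖ ≤ τ n
  tendsto : Tendsto τ atTop (𝓝 0)

theorem IsLagBound.of_norm_eq {δ L : ℕ → ℝ} {γ γ' : ℕ → ℤ → ℂ} {B : ℝ} {τ : ℕ → ℝ}
    (h : IsLagBound δ L γ B τ) (he : ∀ n a, ‖γ' n a‖ = ‖γ n a‖) : IsLagBound δ L γ' B τ where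
  bdd n S := by simpa [he] using h.bdd n S
  tail n S hS := by simpa [he] using h.tail n S hS
  tendsto := h.tendsto

theorem IsLagBound.summable {δ L : ℕ → ℝ} {γ : ℕ → ℤ → ℂ} {B : ℝ} {τ : ℕ → ℝ}
    (h : IsLagBound δ L γ B τ) {n : ℕ} (hδ : 0 < δ n) : Summable fun a => ‖γ n a‖ :=
  summable_of_sum_le (fun _ => norm_nonneg _) (c := B / δ n) fun S => by
    rw [le_div_iff₀ hδ, mul_comm]
    exact h.bdd n S

variable {δ Δ L : ℕ → ℝ} {δinf : ℝ} (hs : IsScaling δ Δ L δinf)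
include hs

/-- Eventually `L n ≤ n`, so the discarded lags all exceed `L n` and the tail condition removes
them. -/
theorem tendsto_partial_lag {Φ : ℕ → ℤ → ℂ} {B : ℝ} {τ : ℕ → ℝ} (hΦ : IsLagBound δ L Φ B τ)
    {F : ℂ} (hF : Tendsto (fun n => ((δ n / (2 * Real.pi) : ℝ) : ℂ) * ∑' a, Φ n a) atTop (𝓝 F)) :
    Tendsto (fun n => ((δ n / (2 * Real.pi) : ℝ) : ℂ) * ∑ a ∈ Finset.Icc (-(n : ℤ)) n, Φ n a)
      atTop (𝓝 F) := by
  have hpi : 1 ≤ 2 * Real.pi := by linarith [Real.pi_gt_three]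
  have h1 : Tendsto (fun n => ((δ n / (2 * Real.pi) : ℝ) : ℂ) * ∑' a, Φ n a -
      ((δ n / (2 * Real.pi) : ℝ) : ℂ) * ∑ a ∈ Finset.Icc (-(n : ℤ)) n, Φ n a) atTop (𝓝 0) := by
    have hev : ∀ᶠ n : ℕ in atTop, L n ≤ n := by
      filter_upwards [hs.tendsto_L_div.eventually_le_const one_pos, eventually_gt_atTop 0]
        with n h2 h3
      rwa [div_le_one (by exact_mod_cast h3)] at h2
    refine squeeze_zero_norm' (a := τ) ?_ hΦ.tendsto
    filter_upwards [hev] with n hn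
    have hδ := hs.grid_pos n
    have hsum := hΦ.summable (n := n) hδ
    rw [← mul_sub, norm_mul, Complex.norm_real, Real.norm_of_nonneg (by positivity),
      ← (hsum.of_norm).sum_add_tsum_compl (s := Finset.Icc (-(n : ℤ)) n), add_sub_cancel_left]
    have h4 : ∑' a : ((Finset.Icc (-(n : ℤ)) n : Finset ℤ) : Set ℤ)ᶜ.Elem, ‖Φ n a‖ ≤ τ n / δ n := by
      refine Real.tsum_le_of_sum_le (fun _ => norm_nonneg _) fun S => ?_
      rw [le_div_iff₀ hδ, mul_comm]
      have h5 := hΦ.tail n (S.map (Function.Embedding.subtype _)) ?_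
      · simpa using h5
      · intro a ha
        simp only [Finset.mem_map, Function.Embedding.subtype_apply] at ha
        obtain ⟨a, _, rfl⟩ := ha
        have h6 := a.2
        simp only [Set.mem_compl_iff, Finset.mem_coe, Finset.mem_Icc, ← abs_le, not_le] at h6
        refine hn.trans_lt ?_
        exact_mod_cast h6
    have h7 := (norm_tsum_le_tsum_norm (f := fun a : ((Finset.Icc (-(n : ℤ)) n : Finset ℤ) :
      Set ℤ)ᶜ.Elem => Φ n a) (hsum.subtype _)).trans h4
    calc δ n / (2 * Real.pi) * _ ≤ δ n * (τ n / δ n) := by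
          gcongr
          exact div_le_self hδ.le hpi
      _ = τ n := by field_simp
  have h2 := hF.sub h1
  rw [sub_zero] at h2
  exact h2.congr fun n => by ring

variable {k : ℕ → ℤ → ℝ} {M V R : ℝ} (hR : 0 ≤ R)
  (hk : ∀ n, IsSampledKernel (k n) M V ⌈R / (δ n / Δ n)⌉₊)
include hR

omit hs hR in
theorem step_mul_le {h : ℝ} (hh : 0 < h) (hR : 0 ≤ R) :
    h * (2 * (⌈R / h⌉₊ : ℝ) + 1) ≤ 2 * R + 3 * h := by
  have h1 : (⌈R / h⌉₊ : ℝ) ≤ R / h + 1 := (Nat.ceil_lt_add_one (by positivity)).le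
  calc h * (2 * (⌈R / h⌉₊ : ℝ) + 1) ≤ h * (2 * (R / h + 1) + 1) := by gcongr
    _ = _ := by field_simp; ring

theorem eventually_step_mul_le :
    ∀ᶠ n in atTop, δ n / Δ n * (2 * (⌈R / (δ n / Δ n)⌉₊ : ℝ) + 1) ≤ 2 * R + 3 := by
  filter_upwards [hs.tendsto_step.eventually_le_const one_pos] with n hn
  have := step_mul_le (hs.step_pos n) hR
  linarith

include hk

omit hR in
theorem tendsto_lagSum_osc {Φ Ψ : ℕ → ℤ → ℂ} {B B' : ℝ} {τ τ' : ℕ → ℝ}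
    (hΦ : IsLagBound δ L Φ B τ) (hΨ : IsLagBound δ L Ψ B' τ') {y : ℕ → ℂ} (hy : ∀ n, ‖y n‖ = 1)
    (hy1 : ∀ᶠ n in atTop, y n ≠ 1)
    (hyt : Tendsto (fun n => δ n / Δ n / ‖1 - y n‖) atTop (𝓝 0)) :
    Tendsto (fun n => (lagScale (δ n) (Δ n) n : ℂ) * lagSum (k n) n (y n) (Φ n) (Ψ n))
      atTop (𝓝 0) := by
  have hM := (hk 0).bound_nonneg
  have hV := (hk 0).variation_nonneg
  have h1 : Tendsto (fun n => (2 * M ^ 2 + 2 * M * V) * (δ n / Δ n / ‖1 - y n‖) * (B * B'))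
      atTop (𝓝 0) := by
    have := (hyt.const_mul (2 * M ^ 2 + 2 * M * V)).mul_const (B * B')
    simpa using this
  refine squeeze_zero_norm' ?_ h1
  filter_upwards [hy1] with n hn
  have hδ := hs.grid_pos n
  have hΔ := hs.bandwidth_pos n
  have hB : 0 ≤ B := by simpa using hΦ.bdd 0 ∅
  rw [norm_mul, Complex.norm_real, Real.norm_of_nonneg (lagScale_nonneg hδ.le hΔ.le n)]
  refine (lagScale_mul_norm_lagSum_osc_le (hk n) hδ hΔ n (hy n) hn _ _).trans ?_
  refine mul_le_mul_of_nonneg_left (mul_le_mul (hΦ.bdd _ _) (hΨ.bdd _ _) ?_ hB) (by positivity)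
  exact mul_nonneg hδ.le (Finset.sum_nonneg fun _ _ => norm_nonneg _)

/-- Cut the lags at `⌊L n⌋`. The tails beyond are at most `τ` and `τ'`; below the cutoff the shift
and boundary errors vanish because `Lδ/Δ`, `Δ/(nδ)` and `L/n` tend to zero. What remains is `q`
times the product of two partial sums. -/
theorem tendsto_lagSum_one {Φ Ψ : ℕ → ℤ → ℂ} {B B' : ℝ} {τ τ' : ℕ → ℝ}
    (hΦ : IsLagBound δ L Φ B τ) (hΨ : IsLagBound δ L Ψ B' τ') {q : ℝ} (hq : 0 ≤ q)
    (hkq : Tendsto (fun n => δ n / Δ n * ∑ d ∈ Finset.Icc (-(⌈R / (δ n / Δ n)⌉₊ : ℤ))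
      ⌈R / (δ n / Δ n)⌉₊, k n d ^ 2) atTop (𝓝 q)) {F F' : ℂ}
    (hF : Tendsto (fun n => ((δ n / (2 * Real.pi) : ℝ) : ℂ) * ∑' a, Φ n a) atTop (𝓝 F))
    (hF' : Tendsto (fun n => ((δ n / (2 * Real.pi) : ℝ) : ℂ) * ∑' a, Ψ n a) atTop (𝓝 F')) :
    Tendsto (fun n => (lagScale (δ n) (Δ n) n : ℂ) * lagSum (k n) n 1 (Φ n) (Ψ n))
      atTop (𝓝 (q * F * F')) := by
  have hM := (hk 0).bound_nonneg
  have hV := (hk 0).variation_nonneg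
  have hB : 0 ≤ B := by simpa using hΦ.bdd 0 ∅
  have hB' : 0 ≤ B' := by simpa using hΨ.bdd 0 ∅
  have h0 := ((tendsto_partial_lag hs hΦ hF).const_mul (q : ℂ)).mul (tendsto_partial_lag hs hΨ hF')
  set ε : ℕ → ℝ := fun n => |δ n / Δ n * ∑ d ∈ Finset.Icc (-(⌈R / (δ n / Δ n)⌉₊ : ℤ))
      ⌈R / (δ n / Δ n)⌉₊, k n d ^ 2 - q| with hε
  have hε0 : Tendsto ε atTop (𝓝 0) := by
    have := (hkq.sub_const q).abs
    simpa using this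
  have hbound : Tendsto (fun n : ℕ => (2 * V * M * (δ n / Δ n * L n) +
      2 * (R * ((δ n / Δ n)⁻¹ / n) + 1 / n + L n / n) * (M ^ 2 * (2 * R + 3)) + ε n) * (B * B') +
      (M ^ 2 * (2 * R + 3) + q) * (τ n * B' + B * τ' n)) atTop (𝓝 0) := by
    have h1 := hs.tendsto_step_mul_L.const_mul (2 * V * M)
    have h2 := (((hs.tendsto_inv_step_div.const_mul R).add
      (tendsto_one_div_atTop_nhds_zero_nat (𝕜 := ℝ))).add hs.tendsto_L_div).const_mul 2
    have h3 := ((h1.add (h2.mul_const (M ^ 2 * (2 * R + 3)))).add hε0).mul_const (B * B')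
    have h4 := ((hΦ.tendsto.mul_const B').add (hΨ.tendsto.const_mul B)).const_mul
      (M ^ 2 * (2 * R + 3) + q)
    simpa using h3.add h4
  refine h0.congr_dist (squeeze_zero' (Eventually.of_forall fun _ => dist_nonneg) ?_ hbound)
  filter_upwards [eventually_step_mul_le hs hR, eventually_gt_atTop 0] with n hn1 hn
  have hδ := hs.grid_pos n
  have hΔ := hs.bandwidth_pos n
  have hh := hs.step_pos n
  have hL := hs.L_pos n
  have hn' : (0 : ℝ) < n := by exact_mod_cast hn
  rw [dist_comm, dist_eq_norm]
  refine (norm_lagScale_mul_lagSum_one_sub_le (hk n) hδ hΔ (l := ⌊L n⌋₊) hn (Φ n) (Ψ n) hq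
    (le_refl (ε n))).trans ?_
  have hfilt : ∀ a ∈ (Finset.Icc (-(n : ℤ)) n).filter (fun a => ((⌊L n⌋₊ : ℕ) : ℤ) < |a|),
      L n < |(a : ℝ)| := fun a ha => by
    have h1 := (Finset.mem_filter.mp ha).2
    rw [Int.abs_eq_natAbs, Nat.cast_lt, Nat.floor_lt hL.le] at h1
    rwa [← Int.cast_abs, Int.abs_eq_natAbs, Int.cast_natCast]
  have hl : ((⌊L n⌋₊ : ℕ) : ℝ) ≤ L n := Nat.floor_le hL.le
  have hN : (⌈R / (δ n / Δ n)⌉₊ : ℝ) ≤ R / (δ n / Δ n) + 1 :=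
    (Nat.ceil_lt_add_one (by positivity)).le
  have hsum0 : ∀ (S : Finset ℤ) (Φ : ℕ → ℤ → ℂ), 0 ≤ δ n * ∑ a ∈ S, ‖Φ n a‖ := fun S Φ =>
    mul_nonneg hδ.le (Finset.sum_nonneg fun _ _ => norm_nonneg _)
  have hτ : 0 ≤ τ n := by simpa using hΦ.tail n ∅ (by simp)
  have hτ' : 0 ≤ τ' n := by simpa using hΨ.tail n ∅ (by simp)
  have hεn : 0 ≤ ε n := abs_nonneg _
  have i1 : δ n / Δ n * (2 * ((⌊L n⌋₊ : ℕ) : ℝ) * V * M) ≤ 2 * V * M * (δ n / Δ n * L n) := by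
    calc _ ≤ δ n / Δ n * (2 * L n * V * M) := by gcongr
      _ = _ := by ring
  have i2 : ((⌈R / (δ n / Δ n)⌉₊ : ℝ) + ((⌊L n⌋₊ : ℕ) : ℝ)) / n
      ≤ R * ((δ n / Δ n)⁻¹ / n) + 1 / n + L n / n := by
    calc _ ≤ (R / (δ n / Δ n) + 1 + L n) / n := by gcongr
      _ = _ := by ring
  have i3 := hΦ.bdd n (Finset.Icc (-(n : ℤ)) n)
  have i4 := hΨ.bdd n (Finset.Icc (-(n : ℤ)) n)
  have i5 := hΦ.tail n _ hfilt
  have i6 := hΨ.tail n _ hfilt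
  refine add_le_add (mul_le_mul (add_le_add (add_le_add i1 ?_) le_rfl)
    (mul_le_mul i3 i4 (hsum0 _ _) hB) (mul_nonneg (hsum0 _ _) (hsum0 _ _)) (by positivity))
    (mul_le_mul ?_ (add_le_add (mul_le_mul i5 i4 (hsum0 _ _) hτ)
      (mul_le_mul i3 i6 (hsum0 _ _) hB)) ?_ (by positivity))
  · refine mul_le_mul (mul_le_mul_of_nonneg_left i2 zero_le_two)
      (mul_le_mul_of_nonneg_left hn1 (sq_nonneg _)) (by positivity) (by positivity)
  · exact add_le_add (mul_le_mul_of_nonneg_left hn1 (sq_nonneg _)) le_rfl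
  · exact add_nonneg (mul_nonneg (hsum0 _ _) (hsum0 _ _)) (mul_nonneg (hsum0 _ _) (hsum0 _ _))

end LagLimit

end FunctionalCLT

namespace FunctionalCLT

/-! ### Matrix entries of covariance operators -/

section CrossCov

variable {E : Type*} [NormedAddCommGroup E] [InnerProductSpace ℂ E] [CompleteSpace E]
  {Ω : Type*} [MeasurableSpace Ω] {P : Measure Ω} {Y Z : Ω → E}

omit [CompleteSpace E] in
theorem continuous_rankOne : Continuous fun p : E × E => InnerProductSpace.rankOne ℂ p.1 p.2 := by
  have h : IsBoundedBilinearMap ℝ fun p : E × E => InnerProductSpace.rankOne ℂ p.1 p.2 :=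
    { add_left := fun x y z => by ext; simp
      smul_left := fun c x y => by ext; simp
      add_right := fun x y z => by ext; simp
      smul_right := fun c x y => by
        ext v
        simp only [InnerProductSpace.rankOne_apply, smul_apply]
        rw [← Complex.coe_smul, ← Complex.coe_smul, inner_smul_left, mul_smul, Complex.conj_ofReal]
      bound := ⟨1, one_pos, fun x y => by simp⟩ }
  exact h.continuous

omit [CompleteSpace E] in
theorem integrable_rankOne (hY : MemLp Y 2 P) (hZ : MemLp Z 2 P) :
    Integrable (fun ω => InnerProductSpace.rankOne ℂ (Y ω) (Z ω)) P := by
  have hp : AEStronglyMeasurable (fun ω => (Y ω, Z ω)) P :=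
    hY.aestronglyMeasurable.prodMk hZ.aestronglyMeasurable
  have hm : AEStronglyMeasurable (fun ω => InnerProductSpace.rankOne ℂ (Y ω) (Z ω)) P :=
    Continuous.comp_aestronglyMeasurable
      (g := fun p : E × E => InnerProductSpace.rankOne ℂ p.1 p.2) (f := fun ω => (Y ω, Z ω))
      continuous_rankOne hp
  have hi : Integrable (fun ω => ‖Y ω‖ * ‖Z ω‖) P := hY.norm.integrable_mul (q := 2) hZ.norm
  refine hi.mono hm (ae_of_all _ fun ω => ?_)
  simp

theorem crossCov_apply (hY : MemLp Y 2 P) (hZ : MemLp Z 2 P) (v : E) :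
    crossCov P Y Z v = ∫ ω, ⟪Z ω, v⟫_ℂ • Y ω ∂P := by
  unfold crossCov
  rw [ContinuousLinearMap.integral_apply (integrable_rankOne hY hZ)]
  rfl

theorem inner_crossCov (hY : MemLp Y 2 P) (hZ : MemLp Z 2 P) (u v : E) :
    ⟪u, crossCov P Y Z v⟫_ℂ = ∫ ω, ⟪u, Y ω⟫_ℂ * ⟪Z ω, v⟫_ℂ ∂P := by
  have hi : Integrable (fun ω => ⟪Z ω, v⟫_ℂ • Y ω) P :=
    (integrable_rankOne hY hZ).apply_continuousLinearMap v
  rw [crossCov_apply hY hZ, ← integral_inner hi]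
  refine integral_congr_ae (ae_of_all _ fun ω => ?_)
  simp only [inner_smul_right]
  ring

end CrossCov

/-! ### Linear functionals of a Gaussian process -/

section GaussianProcess

variable {H : Type*} [NormedAddCommGroup H] [InnerProductSpace ℂ H] [CompleteSpace H]
  [TopologicalSpace.SeparableSpace H] [MeasurableSpace H] [BorelSpace H]
  {Ω : Type*} [MeasurableSpace Ω] {P : Measure Ω} {X : ℝ → Ω → H}

/-- The real valued linear functionals of a process. -/
noncomputable def linearFunctionals (X : ℝ → Ω → H) : Submodule ℝ (Ω → ℝ) :=
  LinearMap.range (Finsupp.lsum ℝ fun t : ℝ =>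
    ({ toFun := fun l ω => l (X t ω)
       map_add' := fun _ _ => rfl
       map_smul' := fun _ _ => rfl } : (H →L[ℝ] ℝ) →ₗ[ℝ] (Ω → ℝ)))

omit [CompleteSpace H] [TopologicalSpace.SeparableSpace H] [MeasurableSpace H] [BorelSpace H]
  [MeasurableSpace Ω] in
theorem apply_mem_linearFunctionals (t : ℝ) (l : H →L[ℝ] ℝ) :
    (fun ω => l (X t ω)) ∈ linearFunctionals X :=
  ⟨Finsupp.single t l, by rw [Finsupp.lsum_single]; rfl⟩

/-- Finite sums of linear functionals of jointly Gaussian values are Gaussian. Later moment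
computations only use membership in this space. -/
theorem isGaussianSpace_linearFunctionals (hX : IsGaussianProcess X P)
    (h0 : ∀ t, ∫ ω, X t ω ∂P = 0) : IsGaussianSpace (linearFunctionals X) P := by
  have e : ∀ f : ℝ →₀ (H →L[ℝ] ℝ), (Finsupp.lsum ℝ fun t : ℝ =>
    ({ toFun := fun l ω => l (X t ω)
       map_add' := fun _ _ => rfl
       map_smul' := fun _ _ => rfl } : (H →L[ℝ] ℝ) →ₗ[ℝ] (Ω → ℝ))) f
      = fun ω => ∑ t ∈ f.support, f t (X t ω) := fun f => by
    ext ω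
    simp [Finsupp.sum]
  have := hX.isProbabilityMeasure
  refine ⟨?_, ?_⟩
  · rintro _ ⟨f, rfl⟩
    rw [e]
    exact (hX.comp_left fun t => f t).hasGaussianLaw_fun_sum
  · rintro _ ⟨f, rfl⟩
    rw [e]
    have hi : ∀ t, Integrable (X t) P := fun t =>
      (hX.hasGaussianLaw_eval t).memLp_two.integrable one_le_two
    rw [integral_finsetSum _ fun t _ => (f t).integrable_comp (hi t)]
    refine Finset.sum_eq_zero fun t _ => ?_
    rw [ContinuousLinearMap.integral_comp_comm _ (hi t), h0, map_zero]

omit [CompleteSpace H] [TopologicalSpace.SeparableSpace H] [MeasurableSpace H] [BorelSpace H]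
  [MeasurableSpace Ω] in
theorem inner_mem_complexify (u : H) (t : ℝ) :
    (fun ω => ⟪u, X t ω⟫_ℂ) ∈ complexify (linearFunctionals X) :=
  ⟨apply_mem_linearFunctionals t (Complex.reCLM.comp ((innerSL ℂ u).restrictScalars ℝ)),
    apply_mem_linearFunctionals t (Complex.imCLM.comp ((innerSL ℂ u).restrictScalars ℝ))⟩

end GaussianProcess

/-! ### Second moments of centred bilinear forms -/

section CenteredForm

variable {Ω : Type*} [MeasurableSpace Ω] {P : Measure Ω} {V : Submodule ℝ (Ω → ℝ)}

/-- A centred bilinear form in two families of random variables. -/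
noncomputable def centeredForm (P : Measure Ω) (S : Finset ℤ) (w : ℤ → ℤ → ℂ) (a b : ℤ → Ω → ℂ)
    (ω : Ω) : ℂ :=
  ∑ i ∈ S, ∑ j ∈ S, w i j * (a i ω * b j ω - ∫ ω', a i ω' * b j ω' ∂P)

theorem conj_centeredForm (S : Finset ℤ) (w : ℤ → ℤ → ℂ) (a b : ℤ → Ω → ℂ) (ω : Ω) :
    conj (centeredForm P S w a b ω) = centeredForm P S (fun i j => conj (w i j))
      (fun i ω => conj (a i ω)) (fun i ω => conj (b i ω)) ω := by
  unfold centeredForm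
  simp_rw [map_sum, map_mul, map_sub, ← integral_conj, map_mul]

/-- Of the three Wick pairings, centring cancels the one that pairs each product within itself. -/
theorem integral_centered_mul [IsProbabilityMeasure P] (hV : IsGaussianSpace V P)
    {x y z w : Ω → ℂ} (hx : x ∈ complexify V)
    (hy : y ∈ complexify V) (hz : z ∈ complexify V) (hw : w ∈ complexify V) :
    Integrable (fun ω => (x ω * y ω - ∫ ω', x ω' * y ω' ∂P) * (z ω * w ω - ∫ ω', z ω' * w ω' ∂P)) P ∧
    ∫ ω, (x ω * y ω - ∫ ω', x ω' * y ω' ∂P) * (z ω * w ω - ∫ ω', z ω' * w ω' ∂P) ∂P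
      = (∫ ω, x ω * z ω ∂P) * (∫ ω, y ω * w ω ∂P) + (∫ ω, x ω * w ω ∂P) * (∫ ω, y ω * z ω ∂P) := by
  set A := ∫ ω', x ω' * y ω' ∂P with hA
  set B := ∫ ω', z ω' * w ω' ∂P with hB
  have e : (fun ω => (x ω * y ω - A) * (z ω * w ω - B))
      = fun ω => x ω * y ω * (z ω * w ω) - (x ω * y ω) * B - (A * (z ω * w ω) - A * B) := by
    ext ω; ring
  have i1 := hV.integrable_mul_mul hx hy hz hw
  have i2 := (hV.integrable_mul hx hy).mul_const B
  have i3 := (hV.integrable_mul hz hw).const_mul A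
  have i4 : Integrable (fun ω => x ω * y ω * (z ω * w ω) - (x ω * y ω) * B) P := i1.sub i2
  have i5 : Integrable (fun ω => A * (z ω * w ω) - A * B) P := i3.sub (integrable_const _)
  rw [e]
  refine ⟨i4.sub i5, ?_⟩
  rw [integral_sub i4 i5, integral_sub i1 i2,
    integral_sub i3 (integrable_const _), integral_mul_const, integral_const_mul, ← hA, ← hB,
    hV.wick hx hy hz hw]
  simp
  ring

theorem integral_centeredForm_mul [IsProbabilityMeasure P] (hV : IsGaussianSpace V P)
    (S : Finset ℤ) (w w' : ℤ → ℤ → ℂ)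
    {a b c d : ℤ → Ω → ℂ} (ha : ∀ i, a i ∈ complexify V) (hb : ∀ i, b i ∈ complexify V)
    (hc : ∀ i, c i ∈ complexify V) (hd : ∀ i, d i ∈ complexify V) :
    Integrable (fun ω => centeredForm P S w a b ω * centeredForm P S w' c d ω) P ∧
    ∫ ω, centeredForm P S w a b ω * centeredForm P S w' c d ω ∂P
      = ∑ i' ∈ S, ∑ j' ∈ S, ∑ i ∈ S, ∑ j ∈ S, w i j * w' i' j' *
        ((∫ ω, a i ω * c i' ω ∂P) * (∫ ω, b j ω * d j' ω ∂P)
          + (∫ ω, a i ω * d j' ω ∂P) * (∫ ω, b j ω * c i' ω ∂P)) := by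
  have e : (fun ω => centeredForm P S w a b ω * centeredForm P S w' c d ω)
      = fun ω => ∑ i' ∈ S, ∑ j' ∈ S, ∑ i ∈ S, ∑ j ∈ S, w i j * w' i' j' *
        ((a i ω * b j ω - ∫ ω', a i ω' * b j ω' ∂P) * (c i' ω * d j' ω - ∫ ω', c i' ω' * d j' ω' ∂P)) := by
    ext ω
    unfold centeredForm
    rw [Finset.mul_sum]
    refine Finset.sum_congr rfl fun i' _ => ?_
    rw [Finset.mul_sum]
    refine Finset.sum_congr rfl fun j' _ => ?_
    rw [Finset.sum_mul]
    refine Finset.sum_congr rfl fun i _ => ?_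
    rw [Finset.sum_mul]
    refine Finset.sum_congr rfl fun j _ => ?_
    ring
  have hi := fun i j i' j' => ((integral_centered_mul hV (ha i) (hb j) (hc i') (hd j')).1).const_mul
    (w i j * w' i' j')
  rw [e]
  refine ⟨integrable_finsetSum _ fun i' _ => integrable_finsetSum _ fun j' _ =>
    integrable_finsetSum _ fun i _ => integrable_finsetSum _ fun j _ => hi i j i' j', ?_⟩
  rw [integral_finsetSum _ fun i' _ => integrable_finsetSum _ fun j' _ =>
    integrable_finsetSum _ fun i _ => integrable_finsetSum _ fun j _ => hi i j i' j']
  refine Finset.sum_congr rfl fun i' _ => ?_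
  rw [integral_finsetSum _ fun j' _ =>
    integrable_finsetSum _ fun i _ => integrable_finsetSum _ fun j _ => hi i j i' j']
  refine Finset.sum_congr rfl fun j' _ => ?_
  rw [integral_finsetSum _ fun i _ => integrable_finsetSum _ fun j _ => hi i j i' j']
  refine Finset.sum_congr rfl fun i _ => ?_
  rw [integral_finsetSum _ fun j _ => hi i j i' j']
  refine Finset.sum_congr rfl fun j _ => ?_
  rw [integral_const_mul, (integral_centered_mul hV (ha i) (hb j) (hc i') (hd j')).2]

/-- The second moment of the coordinates of a lag window estimator. -/
theorem integral_centeredForm_mul_conj [IsProbabilityMeasure P] (hV : IsGaussianSpace V P) (n : ℕ)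
    {z : ℂ} (hz : ‖z‖ = 1) (k : ℤ → ℝ) (hk : ∀ d, k (-d) = k d)
    {a b a' b' : ℤ → Ω → ℂ} (ha : ∀ i, a i ∈ complexify V) (hb : ∀ i, b i ∈ complexify V)
    (ha' : ∀ i, a' i ∈ complexify V) (hb' : ∀ i, b' i ∈ complexify V)
    {γ γ' π π' : ℤ → ℂ} (hγ : ∀ i j, ∫ ω, a i ω * conj (a' j ω) ∂P = γ (i - j))
    (hγ' : ∀ i j, ∫ ω, b i ω * conj (b' j ω) ∂P = γ' (i - j))
    (hπ : ∀ i j, ∫ ω, a i ω * b' j ω ∂P = π (i - j))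
    (hπ' : ∀ i j, ∫ ω, b i ω * a' j ω ∂P = π' (i - j)) :
    let S := Finset.Icc (1 : ℤ) n
    let w := fun i j : ℤ => z ^ (i - j) * (k (i - j) : ℂ)
    Integrable (fun ω => centeredForm P S w a (fun i ω => conj (b i ω)) ω *
      conj (centeredForm P S w a' (fun i ω => conj (b' i ω)) ω)) P ∧
    ∫ ω, centeredForm P S w a (fun i ω => conj (b i ω)) ω *
      conj (centeredForm P S w a' (fun i ω => conj (b' i ω)) ω) ∂P
      = lagSum k n 1 (fun d => z ^ d * γ d) (fun d => conj (z ^ d * γ' d))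
        + lagSum k n (z ^ 2) (fun d => z ^ d * π d) (fun d => conj (z ^ d * π' d)) := by
  intro S w
  have hz0 : z ≠ 0 := by rintro rfl; simp at hz
  have hcz : conj z = z⁻¹ := by
    rw [Complex.inv_def, Complex.normSq_eq_norm_sq, hz]; simp
  simp_rw [conj_centeredForm, Complex.conj_conj]
  obtain ⟨h1, h2⟩ := integral_centeredForm_mul hV S w (fun i j => conj (w i j)) ha
    (fun i => conj_mem_complexify (hb i)) (fun i => conj_mem_complexify (ha' i)) hb'
  refine ⟨h1, h2.trans ?_⟩
  have e1 : ∀ i j, ∫ ω, conj (b i ω) * b' j ω ∂P = conj (γ' (i - j)) := fun i j => by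
    rw [← hγ', ← integral_conj]
    simp
  have e2 : ∀ i j, ∫ ω, conj (b i ω) * conj (a' j ω) ∂P = conj (π' (i - j)) := fun i j => by
    rw [← hπ', ← integral_conj]
    simp
  have e3 : ∀ g : ℤ → ℂ, ∀ y : ℂ, ∀ Φ Ψ : ℤ → ℂ, (∀ d, g d = y ^ d * (k d : ℂ)) →
      lagSum k n y Φ Ψ = ∑ i' ∈ S, ∑ j' ∈ S, ∑ i ∈ S, ∑ j ∈ S,
        Φ (i - i') * Ψ (j - j') * ((k (i - j) : ℂ) * g (i' - j')) := fun g y Φ Ψ hg => by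
    rw [sum_four_eq_sum_lags n Φ Ψ (fun d => (k d : ℂ)) g]
    unfold lagSum pairWeight
    refine Finset.sum_congr rfl fun a _ => Finset.sum_congr rfl fun b _ => ?_
    congr 1
    refine Finset.sum_congr rfl fun j _ => Finset.sum_congr rfl fun i _ => ?_
    split_ifs
    · rw [hg]; push_cast; ring
    · rfl
  rw [e3 (fun d => (k d : ℂ)) 1 _ _ (by simp), e3 (fun d => (z ^ 2) ^ d * (k d : ℂ)) (z ^ 2) _ _ (by simp)]
  simp_rw [mul_add, Finset.sum_add_distrib, hγ, hπ, e1, e2]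
  congr 1
  -- Pairing `i` with `i'` and `j` with `j'`: the phases split into `z^(i-i')` and the conjugate of
  -- `z^(j-j')`, and nothing is left for the weights.
  · refine Finset.sum_congr rfl fun i' _ => Finset.sum_congr rfl fun j' _ =>
      Finset.sum_congr rfl fun i _ => Finset.sum_congr rfl fun j _ => ?_
    simp only [w, map_mul, map_div₀, map_zpow₀, hcz, Complex.conj_ofReal, inv_zpow, zpow_sub₀ hz0]
    field_simp
  -- Crossed pairing. After the roles of `i'` and `j'` are exchanged, the evenness of `k` restores
  -- the weights, and the conjugated phase becomes `z^(i'-j')`. Splitting off the lag phases as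
  -- before leaves `z^(2(i'-j'))`, the source of the oscillation.
  · rw [Finset.sum_comm]
    refine Finset.sum_congr rfl fun i' _ => Finset.sum_congr rfl fun j' _ =>
      Finset.sum_congr rfl fun i _ => Finset.sum_congr rfl fun j _ => ?_
    have hk2 : k (j' - i') = k (i' - j') := by rw [← hk]; congr 1; ring
    simp only [w, map_mul, map_div₀, map_zpow₀, hcz, Complex.conj_ofReal, inv_zpow, zpow_sub₀ hz0,
      hk2, ← zpow_natCast, ← zpow_mul]
    have : z ^ (((2 : ℕ) : ℤ) * (i' - j')) = z ^ i' * z ^ i' / (z ^ j' * z ^ j') := by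
      rw [show ((2 : ℕ) : ℤ) * (i' - j') = (i' - j') + (i' - j') by push_cast; ring,
        zpow_add₀ hz0, zpow_sub₀ hz0]
      field_simp
    rw [this]
    field_simp

end CenteredForm

end FunctionalCLT

namespace FunctionalCLT

/-! ### Coordinates of the statistic -/

section Coordinates

variable {H : Type*} [NormedAddCommGroup H] [InnerProductSpace ℂ H] [CompleteSpace H]
  {Ω : Type*} [MeasurableSpace Ω] {P : Measure Ω} {X : ℝ → Ω → H} {κ : Type*}
  {r : HilbertBasis κ ℂ H}

/-- The coordinate in direction `u` of the process at the grid point `i δ`. -/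
noncomputable def gridCoord (X : ℝ → Ω → H) (δ : ℝ) (u : H) (i : ℤ) (ω : Ω) : ℂ :=
  ⟪u, X (δ * i) ω⟫_ℂ

/-- The unit complex number `exp(𝕚 θ δ)`. -/
noncomputable def phase (θ δ : ℝ) : ℂ := Complex.exp (Complex.I * (θ * δ : ℝ))

theorem norm_phase (θ δ : ℝ) : ‖phase θ δ‖ = 1 := by
  rw [phase, mul_comm, Complex.norm_exp_ofReal_mul_I]

theorem phase_ne_zero (θ δ : ℝ) : phase θ δ ≠ 0 := Complex.exp_ne_zero _

theorem exp_eq_phase_zpow (θ δ : ℝ) (d : ℤ) :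
    Complex.exp (Complex.I * (d * θ * δ : ℝ)) = phase θ δ ^ d := by
  rw [phase, ← Complex.exp_int_mul]
  congr 1
  push_cast
  ring

/-- The kernel sampled on the grid. -/
noncomputable def gridKernel (K : ℝ → ℝ) (δ Δ : ℝ) (d : ℤ) : ℝ := K (d * (δ / Δ))

/-- The terms of the series for a coordinate of the spectral density. -/
noncomputable def covLag (P : Measure Ω) (X : ℝ → Ω → H) (θ δ : ℝ) (u v : H) (d : ℤ) : ℂ :=
  phase θ δ ^ d * ⟪u, covOp P X (δ * d) v⟫_ℂ

/-- The terms of the series for a coordinate of the pseudo-spectral density. -/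
noncomputable def pseudoLag (P : Measure Ω) (r : HilbertBasis κ ℂ H) (X : ℝ → Ω → H) (θ δ : ℝ)
    (u v : H) (d : ℤ) : ℂ :=
  phase θ δ ^ d * ⟪u, pseudoCovOp P r X (δ * d) (conjVec r v)⟫_ℂ

theorem norm_covLag (θ δ : ℝ) (u v : H) (d : ℤ) :
    ‖covLag P X θ δ u v d‖ = ‖⟪u, covOp P X (δ * d) v⟫_ℂ‖ := by
  rw [covLag, norm_mul, norm_zpow, norm_phase, one_zpow, one_mul]

theorem norm_pseudoLag (θ δ : ℝ) (u v : H) (d : ℤ) :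
    ‖pseudoLag P r X θ δ u v d‖ = ‖⟪u, pseudoCovOp P r X (δ * d) (conjVec r v)⟫_ℂ‖ := by
  rw [pseudoLag, norm_mul, norm_zpow, norm_phase, one_zpow, one_mul]

theorem sum_Icc_nat_cast {M : Type*} [AddCommMonoid M] (n : ℕ) (f : ℤ → M) :
    ∑ i ∈ Finset.Icc 1 n, f (i : ℕ) = ∑ i ∈ Finset.Icc (1 : ℤ) n, f i := by
  refine Finset.sum_nbij' (fun i => (i : ℤ)) (fun i => i.toNat) ?_ ?_ ?_ ?_ ?_
  · intro i hi; simp only [Finset.mem_Icc] at *; omega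
  · intro i hi; simp only [Finset.mem_Icc] at *; omega
  · intro i _; simp
  · intro i hi; simp only [Finset.mem_Icc] at *; omega
  · intro i _; rfl

section Stationary

variable [TopologicalSpace.SeparableSpace H] [MeasurableSpace H] [BorelSpace H]
  (hX : IsStationaryGaussian P r X)
include hX

theorem IsStationaryGaussian.memLp (t : ℝ) : MemLp (X t) 2 P :=
  (hX.gaussian.hasGaussianLaw_eval t).memLp_two

theorem IsStationaryGaussian.isGaussianSpace : IsGaussianSpace (linearFunctionals X) P :=
  isGaussianSpace_linearFunctionals hX.gaussian hX.zero_mean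

omit [CompleteSpace H] [TopologicalSpace.SeparableSpace H] [MeasurableSpace H] [BorelSpace H]
  [MeasurableSpace Ω] hX in
theorem gridCoord_mem (δ : ℝ) (u : H) (i : ℤ) :
    gridCoord X δ u i ∈ complexify (linearFunctionals X) := inner_mem_complexify u _

theorem integral_gridCoord_mul_conj (δ : ℝ) (u v : H) (i j : ℤ) :
    ∫ ω, gridCoord X δ u i ω * conj (gridCoord X δ v j ω) ∂P
      = ⟪u, covOp P X (δ * (i - j : ℤ)) v⟫_ℂ := by
  have h := hX.cov_stationary (δ * (i - j : ℤ)) 0 (δ * j)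
  have e : δ * ((i - j : ℤ) : ℝ) + δ * j = δ * i := by push_cast; ring
  rw [e, zero_add] at h
  rw [covOp, ← h, inner_crossCov (hX.memLp _) (hX.memLp _)]
  simp only [gridCoord, inner_conj_symm]

/-- Stationarity of the pseudo-covariance moves the second time to 0; antiunitarity of the
conjugation turns `⟪conj X, conj v⟫` into `⟪v, X⟫`. -/
theorem integral_gridCoord_mul (δ : ℝ) (u v : H) (i j : ℤ) :
    ∫ ω, gridCoord X δ u i ω * gridCoord X δ v j ω ∂P
      = ⟪u, pseudoCovOp P r X (δ * (i - j : ℤ)) (conjVec r v)⟫_ℂ := by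
  have h := hX.pseudoCov_stationary (δ * (i - j : ℤ)) 0 (δ * j)
  have e : δ * ((i - j : ℤ) : ℝ) + δ * j = δ * i := by push_cast; ring
  have hm : MemLp (fun ω => conjVec r (X (δ * j) ω)) 2 P := by
    have hm := hX.memLp (δ * j)
    refine (memLp_congr_norm ((isometry_conjVec r).continuous.comp_aestronglyMeasurable
      hm.aestronglyMeasurable) hm.aestronglyMeasurable (ae_of_all _ fun ω => ?_)).mpr hm
    exact norm_conjVec r _
  rw [e, zero_add] at h
  rw [pseudoCovOp, ← h, inner_crossCov (hX.memLp _) hm]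
  simp only [gridCoord, inner_conjVec_conjVec]

theorem integrable_outer (t s : ℝ) : Integrable (fun ω => HS.outer (X t ω) (X s ω)) P := by
  have hp : AEStronglyMeasurable (fun ω => (X t ω, X s ω)) P :=
    (hX.memLp t).aestronglyMeasurable.prodMk (hX.memLp s).aestronglyMeasurable
  have hm : AEStronglyMeasurable (fun ω => HS.outer (X t ω) (X s ω)) P :=
    Continuous.comp_aestronglyMeasurable
      (g := fun p : H × H => HS.outer p.1 p.2) (f := fun ω => (X t ω, X s ω))
      HS.continuous_outer hp
  have hi : Integrable (fun ω => ‖X t ω‖ * ‖X s ω‖) P :=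
    (hX.memLp t).norm.integrable_mul (q := 2) (hX.memLp s).norm
  refine hi.mono hm (ae_of_all _ fun ω => ?_)
  simp [HS.norm_outer]

theorem integrable_specEstimator (K : ℝ → ℝ) (δ Δ : ℕ → ℝ) (θ : ℝ) (n : ℕ) :
    Integrable (specEstimator X K δ Δ θ n) P := by
  unfold specEstimator
  exact (integrable_finsetSum _ fun i _ => integrable_finsetSum _ fun j _ =>
    (integrable_outer hX _ _).smul (_ : ℂ)).smul (_ : ℂ)

omit [TopologicalSpace.SeparableSpace H] [MeasurableSpace H] [BorelSpace H] [MeasurableSpace Ω] hX in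
theorem inner_outer_specEstimator (K : ℝ → ℝ) (δ Δ : ℕ → ℝ) (θ : ℝ) (n : ℕ) (u v : H) (ω : Ω) :
    ⟪HS.outer u v, specEstimator X K δ Δ θ n ω⟫_ℂ = ((δ n / (2 * Real.pi * n) : ℝ) : ℂ) *
      ∑ i ∈ Finset.Icc (1 : ℤ) n, ∑ j ∈ Finset.Icc (1 : ℤ) n,
        phase θ (δ n) ^ (i - j) * (gridKernel K (δ n) (Δ n) (i - j) : ℂ) *
          (gridCoord X (δ n) u i ω * conj (gridCoord X (δ n) v j ω)) := by
  unfold specEstimator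
  rw [inner_smul_right, inner_sum, ← sum_Icc_nat_cast]
  congr 1
  refine Finset.sum_congr rfl fun i _ => ?_
  rw [inner_sum, ← sum_Icc_nat_cast]
  refine Finset.sum_congr rfl fun j _ => ?_
  have e1 : ((i : ℝ) - j) / Δ n * δ n = (((i : ℤ) - (j : ℤ) : ℤ) : ℝ) * (δ n / Δ n) := by
    push_cast; ring
  have e2 : ((i : ℝ) - j) * δ n * θ = (((i : ℤ) - (j : ℤ) : ℤ) : ℝ) * θ * δ n := by
    push_cast; ring
  rw [inner_smul_right, HS.inner_outer_outer, e1, e2, exp_eq_phase_zpow, gridCoord, gridCoord,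
    inner_conj_symm, gridKernel]
  push_cast
  rfl

/-- The bridge to scalars: in each coordinate the statistic is a centred bilinear form in jointly
Gaussian variables, with weights depending only on the lag. -/
theorem inner_outer_cltStat (K : ℝ → ℝ) (δ Δ : ℕ → ℝ) (θ : ℝ) (n : ℕ) (u v : H) (ω : Ω) :
    ⟪HS.outer u v, cltStat P X K δ Δ θ n ω⟫_ℂ
      = ((Real.sqrt (n * δ n / Δ n) * (δ n / (2 * Real.pi * n)) : ℝ) : ℂ) *
        centeredForm P (Finset.Icc (1 : ℤ) n)
          (fun i j => phase θ (δ n) ^ (i - j) * (gridKernel K (δ n) (Δ n) (i - j) : ℂ))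
          (gridCoord X (δ n) u) (fun j ω => conj (gridCoord X (δ n) v j ω)) ω := by
  have hV := hX.isGaussianSpace
  have hi : ∀ i j, Integrable (fun ω => gridCoord X (δ n) u i ω * conj (gridCoord X (δ n) v j ω)) P :=
    fun i j => hV.integrable_mul (gridCoord_mem _ u i) (conj_mem_complexify (gridCoord_mem _ v j))
  unfold cltStat
  rw [inner_smul_right, inner_sub_right, ← integral_inner (integrable_specEstimator hX K δ Δ θ n)]
  simp_rw [inner_outer_specEstimator]
  rw [integral_const_mul, integral_finsetSum _ fun i _ => integrable_finsetSum _ fun j _ =>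
    (hi i j).const_mul _]
  have e : ∀ i : ℤ, ∫ ω, ∑ j ∈ Finset.Icc (1 : ℤ) n,
        phase θ (δ n) ^ (i - j) * (gridKernel K (δ n) (Δ n) (i - j) : ℂ) *
          (gridCoord X (δ n) u i ω * conj (gridCoord X (δ n) v j ω)) ∂P
      = ∑ j ∈ Finset.Icc (1 : ℤ) n, phase θ (δ n) ^ (i - j) *
          (gridKernel K (δ n) (Δ n) (i - j) : ℂ) *
          ∫ ω, gridCoord X (δ n) u i ω * conj (gridCoord X (δ n) v j ω) ∂P := fun i => by
    rw [integral_finsetSum _ fun j _ => (hi i j).const_mul _]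
    simp_rw [integral_const_mul]
  simp_rw [e]
  unfold centeredForm
  rw [← mul_sub, ← Finset.sum_sub_distrib]
  simp_rw [← Finset.sum_sub_distrib, ← mul_sub]
  push_cast
  ring

/-- The second moments of the coordinates of the statistic. -/
theorem integral_inner_cltStat_mul_conj [IsProbabilityMeasure P] {K : ℝ → ℝ}
    (hK : ∀ x, K (-x) = K x) {δ Δ : ℕ → ℝ} (θ : ℝ) (n : ℕ) (hδ : 0 < δ n) (hΔ : 0 < Δ n)
    (u v u' v' : H) :
    Integrable (fun ω => ⟪HS.outer u v, cltStat P X K δ Δ θ n ω⟫_ℂ *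
      conj ⟪HS.outer u' v', cltStat P X K δ Δ θ n ω⟫_ℂ) P ∧
    ∫ ω, ⟪HS.outer u v, cltStat P X K δ Δ θ n ω⟫_ℂ *
      conj ⟪HS.outer u' v', cltStat P X K δ Δ θ n ω⟫_ℂ ∂P
      = (lagScale (δ n) (Δ n) n : ℂ) *
        (lagSum (gridKernel K (δ n) (Δ n)) n 1 (covLag P X θ (δ n) u u')
          (fun d => conj (covLag P X θ (δ n) v v' d))
        + lagSum (gridKernel K (δ n) (Δ n)) n (phase θ (δ n) ^ 2) (pseudoLag P r X θ (δ n) u v')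
          (fun d => conj (pseudoLag P r X θ (δ n) v u' d))) := by
  have hV := hX.isGaussianSpace
  have hk : ∀ d, gridKernel K (δ n) (Δ n) (-d) = gridKernel K (δ n) (Δ n) d := fun d => by
    rw [gridKernel, gridKernel, ← hK]
    push_cast
    ring_nf
  obtain ⟨h1, h2⟩ := integral_centeredForm_mul_conj hV n (norm_phase θ (δ n))
    (gridKernel K (δ n) (Δ n)) hk (gridCoord_mem (δ n) u) (gridCoord_mem (δ n) v)
    (gridCoord_mem (δ n) u') (gridCoord_mem (δ n) v')
    (γ := fun d => ⟪u, covOp P X (δ n * d) u'⟫_ℂ) (γ' := fun d => ⟪v, covOp P X (δ n * d) v'⟫_ℂ)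
    (π := fun d => ⟪u, pseudoCovOp P r X (δ n * d) (conjVec r v')⟫_ℂ)
    (π' := fun d => ⟪v, pseudoCovOp P r X (δ n * d) (conjVec r u')⟫_ℂ)
    (integral_gridCoord_mul_conj hX _ u u') (integral_gridCoord_mul_conj hX _ v v')
    (integral_gridCoord_mul hX _ u v') (integral_gridCoord_mul hX _ v u')
  set c : ℝ := Real.sqrt (n * δ n / Δ n) * (δ n / (2 * Real.pi * n)) with hc
  -- `(nδ/Δ)(δ/(2πn))² = (δ/(2π))² (δ/Δ)/n`; for `n = 0` both sides are zero.
  have hc2 : c * c = lagScale (δ n) (Δ n) n := by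
    have h0 : 0 ≤ n * δ n / Δ n := by positivity
    have : c * c = (Real.sqrt (n * δ n / Δ n) * Real.sqrt (n * δ n / Δ n)) *
      (δ n / (2 * Real.pi * n)) ^ 2 := by rw [hc]; ring
    rw [this, Real.mul_self_sqrt h0, lagScale]
    rcases Nat.eq_zero_or_pos n with hn | hn
    · subst hn; simp
    · have hpi := Real.pi_pos
      field_simp
  have e : ∀ ω, ⟪HS.outer u v, cltStat P X K δ Δ θ n ω⟫_ℂ *
      conj ⟪HS.outer u' v', cltStat P X K δ Δ θ n ω⟫_ℂ = (lagScale (δ n) (Δ n) n : ℂ) *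
      (centeredForm P (Finset.Icc (1 : ℤ) n)
          (fun i j => phase θ (δ n) ^ (i - j) * (gridKernel K (δ n) (Δ n) (i - j) : ℂ))
          (gridCoord X (δ n) u) (fun j ω => conj (gridCoord X (δ n) v j ω)) ω *
        conj (centeredForm P (Finset.Icc (1 : ℤ) n)
          (fun i j => phase θ (δ n) ^ (i - j) * (gridKernel K (δ n) (Δ n) (i - j) : ℂ))
          (gridCoord X (δ n) u') (fun j ω => conj (gridCoord X (δ n) v' j ω)) ω)) := fun ω => by
    rw [inner_outer_cltStat hX, inner_outer_cltStat hX, map_mul, Complex.conj_ofReal, ← hc, ← hc2]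
    push_cast
    ring
  simp_rw [e]
  refine ⟨h1.const_mul _, ?_⟩
  rw [integral_const_mul, h2]
  rfl

end Stationary

end Coordinates

end FunctionalCLT

namespace FunctionalCLT

/-! ### From trace norms to lag bounds -/

section TraceBounds

theorem ofReal_mul_sum_mul_sum_le {δ : ℝ} (hδ : 0 < δ) (S : Finset ℤ) (f g : ℤ → ℂ) {a : ℝ≥0∞}
    (h : ENNReal.ofReal (δ ^ 2) * ∑' (x₁ : ℤ) (x₂ : ℤ), ‖f x₁‖ₑ * ‖g x₂‖ₑ ≤ a) :
    ENNReal.ofReal ((δ * ∑ x ∈ S, ‖f x‖) * (δ * ∑ x ∈ S, ‖g x‖)) ≤ a := by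
  refine le_trans ?_ h
  have e : (δ * ∑ x ∈ S, ‖f x‖) * (δ * ∑ x ∈ S, ‖g x‖)
      = δ ^ 2 * ((∑ x ∈ S, ‖f x‖) * ∑ x ∈ S, ‖g x‖) := by ring
  rw [e, ENNReal.ofReal_mul (by positivity),
    ENNReal.ofReal_mul (Finset.sum_nonneg fun _ _ => norm_nonneg _),
    ENNReal.ofReal_sum_of_nonneg fun _ _ => norm_nonneg _,
    ENNReal.ofReal_sum_of_nonneg fun _ _ => norm_nonneg _]
  simp_rw [ofReal_norm, ENNReal.tsum_mul_left, ENNReal.tsum_mul_right]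
  gcongr
  · exact ENNReal.sum_le_tsum S
  · exact ENNReal.sum_le_tsum S

variable {H : Type*} [NormedAddCommGroup H] [InnerProductSpace ℂ H] [CompleteSpace H]

theorem enorm_inner_le_traceNorm (A : H →L[ℂ] H) {u v : H} (hu : ‖u‖ = 1) (hv : ‖v‖ = 1) :
    ‖⟪u, A v⟫_ℂ‖ₑ ≤ traceNorm A := by
  refine le_trans ?_ (enorm_le_traceNorm A)
  rw [← ofReal_norm, ← ofReal_norm]
  refine ENNReal.ofReal_le_ofReal ?_
  calc ‖⟪u, A v⟫_ℂ‖ ≤ ‖u‖ * ‖A v‖ := norm_inner_le_norm _ _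
    _ ≤ ‖u‖ * (‖A‖ * ‖v‖) := by gcongr; exact A.le_opNorm v
    _ = ‖A‖ := by rw [hu, hv]; ring

/-- Entries along unit vectors are bounded by the operator norm, hence by the trace norm. The
constants therefore do not depend on the directions. -/
theorem isLagBound_of_traceNorm {G : ℝ → H →L[ℂ] H} {δ L : ℕ → ℝ} (hδ : ∀ n, 0 < δ n)
    (hb : ⨆ n, ENNReal.ofReal (δ n) * ∑' x : ℤ, traceNorm (G (δ n * x)) < ⊤)
    (ht : Tendsto (fun n => ENNReal.ofReal (δ n) *
      ∑' x : {x : ℤ // L n < |(x : ℝ)|}, traceNorm (G (δ n * (x : ℤ)))) atTop (𝓝 0))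
    {u v : H} (hu : ‖u‖ = 1) (hv : ‖v‖ = 1) {γ : ℕ → ℤ → ℂ}
    (hγ : ∀ n a, ‖γ n a‖ = ‖⟪u, G (δ n * a) v⟫_ℂ‖) :
    IsLagBound δ L γ (⨆ n, ENNReal.ofReal (δ n) * ∑' x : ℤ, traceNorm (G (δ n * x))).toReal
      (fun n => (ENNReal.ofReal (δ n) *
        ∑' x : {x : ℤ // L n < |(x : ℝ)|}, traceNorm (G (δ n * (x : ℤ)))).toReal) := by
  have h1 : ∀ n (S : Finset ℤ), ENNReal.ofReal (δ n * ∑ a ∈ S, ‖γ n a‖)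
      ≤ ENNReal.ofReal (δ n) * ∑ a ∈ S, traceNorm (G (δ n * a)) := fun n S => by
    rw [ENNReal.ofReal_mul (hδ n).le, ENNReal.ofReal_sum_of_nonneg fun _ _ => norm_nonneg _]
    gcongr with a _
    rw [hγ, ofReal_norm]
    exact enorm_inner_le_traceNorm _ hu hv
  have hle : ∀ n, ENNReal.ofReal (δ n) * ∑' x : ℤ, traceNorm (G (δ n * x))
      ≤ ⨆ n, ENNReal.ofReal (δ n) * ∑' x : ℤ, traceNorm (G (δ n * x)) := fun n =>
    le_iSup (fun n => ENNReal.ofReal (δ n) * ∑' x : ℤ, traceNorm (G (δ n * x))) n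
  refine ⟨fun n S => ?_, fun n S hS => ?_, ?_⟩
  · rw [← ENNReal.ofReal_le_iff_le_toReal hb.ne]
    refine (h1 n S).trans (le_trans ?_ (hle n))
    gcongr
    exact ENNReal.sum_le_tsum S
  · rw [← ENNReal.ofReal_le_iff_le_toReal]
    · refine (h1 n S).trans ?_
      gcongr
      have h2 : ∑ a ∈ S, traceNorm (G (δ n * a))
          = ∑ x ∈ S.subtype (fun x : ℤ => L n < |(x : ℝ)|), traceNorm (G (δ n * (x : ℤ))) := by
        rw [Finset.sum_subtype_of_mem (fun x : ℤ => traceNorm (G (δ n * x))) hS]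
      rw [h2]
      exact ENNReal.sum_le_tsum _
    · refine ne_top_of_le_ne_top hb.ne (le_trans ?_ (hle n))
      gcongr
      exact ENNReal.tsum_comp_le_tsum_of_injective Subtype.val_injective
        (fun x : ℤ => traceNorm (G (δ n * x)))
  · exact (ENNReal.tendsto_toReal ENNReal.zero_ne_top).comp ht

theorem summable_of_traceNorm {G : ℤ → H →L[ℂ] H} (h : ∑' x : ℤ, traceNorm (G x) ≠ ⊤) :
    Summable fun x => ‖G x‖ := by
  have h1 : ∑' x, ‖G x‖ₑ ≠ ⊤ :=
    ne_top_of_le_ne_top h (ENNReal.tsum_le_tsum fun x => enorm_le_traceNorm _)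
  have := ENNReal.summable_toReal h1
  exact this.congr fun x => toReal_enorm _

theorem inner_foldedFourier {G : ℝ → H →L[ℂ] H} {δ : ℝ} (hδ : 0 < δ) (θ : ℝ)
    (h : ∑' x : ℤ, traceNorm (G (δ * x)) ≠ ⊤) (u v : H) :
    ⟪u, foldedFourier G θ δ v⟫_ℂ
      = ((δ / (2 * Real.pi) : ℝ) : ℂ) * ∑' d : ℤ, phase θ δ ^ d * ⟪u, G (δ * d) v⟫_ℂ := by
  have hs : Summable fun d : ℤ => phase θ δ ^ d • G (δ * d) := by
    refine Summable.of_norm ((summable_of_traceNorm h).congr fun d => ?_)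
    rw [norm_smul, norm_zpow, norm_phase, one_zpow, one_mul]
  have e : ∑' k : ℤ, Complex.exp (Complex.I * (k * θ * δ : ℝ)) • G (k * δ)
      = ∑' d : ℤ, phase θ δ ^ d • G (δ * d) :=
    tsum_congr fun d => by rw [exp_eq_phase_zpow, mul_comm δ]
  rw [foldedFourier, if_neg hδ.ne', e, smul_apply, inner_smul_right]
  congr 1
  have h1 := (hs.hasSum.mapL (ContinuousLinearMap.apply ℂ H v)).mapL (innerSL ℂ u)
  simp only [ContinuousLinearMap.apply_apply, innerSL_apply_apply, smul_apply,
    inner_smul_right] at h1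
  exact h1.tsum_eq.symm

theorem CLTCondition.isScaling {Ω : Type*} [MeasurableSpace Ω] {P : Measure Ω} {κ κ' : Type*}
    {r : HilbertBasis κ ℂ H} {e₀ : HilbertBasis κ' ℂ H} {X : ℝ → Ω → H} {δ Δ L : ℕ → ℝ}
    {δinf θ : ℝ} (h : CLTCondition P r e₀ X δ Δ L δinf θ) : IsScaling δ Δ L δinf :=
  ⟨h.grid_pos, h.bandwidth_pos, h.L_pos, h.limit_nonneg, h.grid_tendsto, h.domain_tendsto,
    h.L_grid_tendsto, h.L_bandwidth_tendsto⟩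

end TraceBounds

/-! ### Limits and uniform bounds of second moments -/

section Moments

variable {H : Type*} [NormedAddCommGroup H] [InnerProductSpace ℂ H] [CompleteSpace H]
  {Ω : Type*} [MeasurableSpace Ω] {P : Measure Ω} {X : ℝ → Ω → H} {κ κ' : Type*}
  {r : HilbertBasis κ ℂ H} {e₀ : HilbertBasis κ' ℂ H} {δ Δ L : ℕ → ℝ} {δinf θ : ℝ}
  (hCLT : CLTCondition P r e₀ X δ Δ L δinf θ)
include hCLT

theorem CLTCondition.isLagBound_covLag {u v : H} (hu : ‖u‖ = 1) (hv : ‖v‖ = 1) :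
    ∃ B τ, IsLagBound δ L (fun n => covLag P X θ (δ n) u v) B τ :=
  ⟨_, _, isLagBound_of_traceNorm hCLT.grid_pos hCLT.cov_bdd hCLT.cov_tail hu hv
    fun _ _ => norm_covLag _ _ _ _ _⟩

theorem CLTCondition.isLagBound_pseudoLag {u v : H} (hu : ‖u‖ = 1) (hv : ‖v‖ = 1) :
    ∃ B τ, IsLagBound δ L (fun n => pseudoLag P r X θ (δ n) u v) B τ :=
  ⟨_, _, isLagBound_of_traceNorm hCLT.grid_pos hCLT.pseudoCov_bdd hCLT.pseudoCov_tail hu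
    ((norm_conjVec r v).trans hv) fun _ _ => norm_pseudoLag _ _ _ _ _⟩

theorem CLTCondition.tsum_traceNorm_ne_top (n : ℕ) :
    ∑' x : ℤ, traceNorm (covOp P X (δ n * x)) ≠ ⊤ := by
  intro h
  have h1 := (le_iSup (fun n => ENNReal.ofReal (δ n) *
    ∑' x : ℤ, traceNorm (covOp P X (δ n * x))) n).trans_lt hCLT.cov_bdd
  rw [h, ENNReal.mul_top (by simpa using hCLT.grid_pos n)] at h1
  exact lt_irrefl _ h1

theorem CLTCondition.tsum_covLag (n : ℕ) (u v : H) :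
    ((δ n / (2 * Real.pi) : ℝ) : ℂ) * ∑' d, covLag P X θ (δ n) u v d
      = ⟪u, specDensity P X θ (δ n) v⟫_ℂ :=
  (inner_foldedFourier (hCLT.grid_pos n) θ (hCLT.tsum_traceNorm_ne_top n) u v).symm

theorem CLTCondition.tendsto_specDensity :
    Tendsto (fun n => specDensity P X θ (δ n)) atTop (𝓝 (specDensity P X θ δinf)) := by
  rw [tendsto_iff_edist_tendsto_0]
  refine tendsto_of_tendsto_of_tendsto_of_le_of_le tendsto_const_nhds hCLT.specDensity_tendsto
    (fun _ => zero_le) fun n => ?_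
  rw [edist_eq_enorm_sub]
  exact enorm_le_traceNorm _

theorem CLTCondition.tendsto_inner_specDensity (u v : H) :
    Tendsto (fun n => ⟪u, specDensity P X θ (δ n) v⟫_ℂ) atTop
      (𝓝 ⟪u, specDensity P X θ δinf v⟫_ℂ) := by
  have h : Continuous fun A : H →L[ℂ] H => ⟪u, A v⟫_ℂ := by fun_prop
  exact (h.tendsto _).comp hCLT.tendsto_specDensity

variable [TopologicalSpace.SeparableSpace H] [MeasurableSpace H] [BorelSpace H]
  [IsProbabilityMeasure P] (hX : IsStationaryGaussian P r X) {K : ℝ → ℝ} (hK : IsCLTKernel K)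
include hX hK

/-- The covariance pairing contributes the limit, with `‖K‖₂²` coming from Riemann sums of the
sampled kernel. The pseudo-covariance pairing carries the phase `exp(2𝕚θδ)` and disappears because
`c(θ) = 0`. -/
theorem tendsto_integral_inner_cltStat_mul_conj
    (hθ : 0 < δinf → θ ∈ Set.Icc (-(Real.pi / δinf)) (Real.pi / δinf))
    (hc : cIndicator δinf θ = 0) {u v u' v' : H}
    (hu : ‖u‖ = 1) (hv : ‖v‖ = 1) (hu' : ‖u'‖ = 1) (hv' : ‖v'‖ = 1) :
    Tendsto (fun n => ∫ ω, ⟪HS.outer u v, cltStat P X K δ Δ θ n ω⟫_ℂ *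
      conj ⟪HS.outer u' v', cltStat P X K δ Δ θ n ω⟫_ℂ ∂P) atTop
      (𝓝 (((kernelNorm K ^ 2 : ℝ) : ℂ) * ⟪u, specDensity P X θ δinf u'⟫_ℂ *
        conj ⟪v, specDensity P X θ δinf v'⟫_ℂ)) := by
  have hs := hCLT.isScaling
  obtain ⟨M, V, R, hR, hM, hsupp, hV, hk⟩ := hK.exists_isSampledKernel
  have hk' : ∀ n, IsSampledKernel (gridKernel K (δ n) (Δ n)) M V ⌈R / (δ n / Δ n)⌉₊ :=
    fun n => hk _ (hs.step_pos n)
  have hq : (0 : ℝ) ≤ kernelNorm K ^ 2 := sq_nonneg _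
  have hkq : Tendsto (fun n => δ n / Δ n * ∑ d ∈ Finset.Icc (-(⌈R / (δ n / Δ n)⌉₊ : ℤ))
      ⌈R / (δ n / Δ n)⌉₊, gridKernel K (δ n) (Δ n) d ^ 2) atTop (𝓝 (kernelNorm K ^ 2)) := by
    have e : kernelNorm K ^ 2 = ∫ x, K x ^ 2 :=
      Real.sq_sqrt (integral_nonneg fun x => sq_nonneg _)
    rw [e, tendsto_iff_norm_sub_tendsto_zero]
    have h1 := hs.tendsto_step.mul_const (2 * M * V)
    rw [zero_mul] at h1
    refine squeeze_zero (fun _ => norm_nonneg _) (fun n => ?_) h1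
    exact abs_riemannSum_sq_sub_integral_le hK.measurable hK.nonneg hR hM hsupp hV (hs.step_pos n)
  have hy : ∀ n, ‖phase θ (δ n) ^ 2‖ = 1 := fun n => by rw [norm_pow, norm_phase, one_pow]
  have hyt : Tendsto (fun n => δ n / Δ n / ‖1 - phase θ (δ n) ^ 2‖) atTop (𝓝 0) :=
    (hs.tendsto_step_div_norm hθ hc).2
  have hy1 : ∀ᶠ n in atTop, phase θ (δ n) ^ 2 ≠ 1 := (hs.tendsto_step_div_norm hθ hc).1
  obtain ⟨B₁, τ₁, h₁⟩ := hCLT.isLagBound_covLag hu hu'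
  obtain ⟨B₂, τ₂, h₂⟩ := hCLT.isLagBound_covLag hv hv'
  obtain ⟨B₃, τ₃, h₃⟩ := hCLT.isLagBound_pseudoLag hu hv'
  obtain ⟨B₄, τ₄, h₄⟩ := hCLT.isLagBound_pseudoLag hv hu'
  have h₂' := h₂.of_norm_eq (γ' := fun n d => conj (covLag P X θ (δ n) v v' d))
    fun n a => RCLike.norm_conj _
  have h₄' := h₄.of_norm_eq (γ' := fun n d => conj (pseudoLag P r X θ (δ n) v u' d))
    fun n a => RCLike.norm_conj _
  have hF : Tendsto (fun n => ((δ n / (2 * Real.pi) : ℝ) : ℂ) * ∑' a, covLag P X θ (δ n) u u' a)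
      atTop (𝓝 ⟪u, specDensity P X θ δinf u'⟫_ℂ) := by
    simp_rw [hCLT.tsum_covLag]
    exact hCLT.tendsto_inner_specDensity u u'
  have hF' : Tendsto (fun n => ((δ n / (2 * Real.pi) : ℝ) : ℂ) *
      ∑' a, conj (covLag P X θ (δ n) v v' a)) atTop (𝓝 (conj ⟪v, specDensity P X θ δinf v'⟫_ℂ)) := by
    have h := (Complex.continuous_conj.tendsto _).comp (hCLT.tendsto_inner_specDensity v v')
    refine h.congr fun n => ?_
    simp only [Function.comp]
    rw [← hCLT.tsum_covLag, map_mul, Complex.conj_ofReal, Complex.conj_tsum]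
  have hT := (tendsto_lagSum_one hs hR hk' h₁ h₂' hq hkq hF hF').add
    (tendsto_lagSum_osc hs hk' h₃ h₄' hy hy1 hyt)
  rw [add_zero] at hT
  refine hT.congr fun n => ?_
  rw [(integral_inner_cltStat_mul_conj hX hK.even θ n (hs.grid_pos n) (hs.bandwidth_pos n)
    u v u' v').2, mul_add]

/-- Uniform summability of the second moments of the coordinates. -/
theorem exists_summable_bound_cltStat :
    ∃ g : κ' × κ' → ℝ, Summable g ∧ ∀ᶠ n in atTop, ∀ p,
      ∫ ω, ‖⟪HS.outer (e₀ p.1) (e₀ p.2), cltStat P X K δ Δ θ n ω⟫_ℂ‖ ^ 2 ∂P ≤ g p := by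
  have hs := hCLT.isScaling
  obtain ⟨M, V, R, hR, hM, hsupp, hV, hk⟩ := hK.exists_isSampledKernel
  obtain ⟨a, ha, ha'⟩ := hCLT.cov_coord
  obtain ⟨b, hb, hb'⟩ := hCLT.pseudoCov_coord
  rw [← ENNReal.tsum_prod] at ha' hb'
  set C := M ^ 2 * (2 * R + 3) with hC
  have hC0 : 0 ≤ C := by positivity
  -- The pseudo-covariance part produces `B1 B2`, with the pair `(k, l)` in both orders, while `b`
  -- controls only products with equal order. Since `B1 B2 ≤ B1² + B2²`, adding the transpose of `b`
  -- suffices.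
  set g : κ' × κ' → ℝ≥0∞ := fun p => ENNReal.ofReal C * (a p.1 p.2 + (b p.1 p.2 + b p.2 p.1)) with hg
  have hgs : ∑' p, g p ≠ ⊤ := by
    have h1 : ∑' p : κ' × κ', b p.2 p.1 = ∑' p : κ' × κ', b p.1 p.2 :=
      (Equiv.prodComm κ' κ').tsum_eq fun p => b p.1 p.2
    rw [hg, ENNReal.tsum_mul_left, ENNReal.tsum_add, ENNReal.tsum_add, h1]
    exact ENNReal.mul_ne_top ENNReal.ofReal_ne_top
      (ENNReal.add_ne_top.mpr ⟨ha'.ne, ENNReal.add_ne_top.mpr ⟨hb'.ne, hb'.ne⟩⟩)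
  refine ⟨fun p => (g p).toReal, ENNReal.summable_toReal hgs, ?_⟩
  filter_upwards [eventually_step_mul_le hs hR] with n hn p
  rw [← ENNReal.ofReal_le_iff_le_toReal (ENNReal.ne_top_of_tsum_ne_top hgs p)]
  obtain ⟨k, l⟩ := p
  have hδ := hs.grid_pos n
  have hΔ := hs.bandwidth_pos n
  have h2 := (integral_inner_cltStat_mul_conj hX hK.even θ n hδ hΔ (e₀ k) (e₀ l) (e₀ k) (e₀ l)).2
  have e1 : ∫ ω, ‖⟪HS.outer (e₀ k) (e₀ l), cltStat P X K δ Δ θ n ω⟫_ℂ‖ ^ 2 ∂P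
      = ‖∫ ω, ⟪HS.outer (e₀ k) (e₀ l), cltStat P X K δ Δ θ n ω⟫_ℂ *
      conj ⟪HS.outer (e₀ k) (e₀ l), cltStat P X K δ Δ θ n ω⟫_ℂ ∂P‖ := by
    simp_rw [RCLike.mul_conj]
    have : ∀ x : ℂ, ((‖x‖ : ℂ)) ^ 2 = ((‖x‖ ^ 2 : ℝ) : ℂ) := fun x => by push_cast; rfl
    simp only [Complex.coe_algebraMap, this]
    rw [integral_complex_ofReal, Complex.norm_real, Real.norm_of_nonneg]
    exact integral_nonneg fun ω => sq_nonneg _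
  set S := Finset.Icc (-(n : ℤ)) n
  have hk' := hk _ (hs.step_pos n)
  have hw : M ^ 2 * (δ n / Δ n * (2 * (⌈R / (δ n / Δ n)⌉₊ : ℝ) + 1)) ≤ C :=
    mul_le_mul_of_nonneg_left hn (sq_nonneg _)
  have hy : ‖phase θ (δ n) ^ 2‖ = 1 := by rw [norm_pow, norm_phase, one_pow]
  have b1 := lagScale_mul_norm_lagSum_le hk' hδ hΔ n norm_one (covLag P X θ (δ n) (e₀ k) (e₀ k))
    (fun d => conj (covLag P X θ (δ n) (e₀ l) (e₀ l) d))
  have b2 := lagScale_mul_norm_lagSum_le hk' hδ hΔ n hy (pseudoLag P r X θ (δ n) (e₀ k) (e₀ l))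
    (fun d => conj (pseudoLag P r X θ (δ n) (e₀ l) (e₀ k) d))
  simp only [RCLike.norm_conj] at b1 b2
  set A1 := δ n * ∑ x ∈ S, ‖covLag P X θ (δ n) (e₀ k) (e₀ k) x‖
  set A2 := δ n * ∑ x ∈ S, ‖covLag P X θ (δ n) (e₀ l) (e₀ l) x‖
  set B1 := δ n * ∑ x ∈ S, ‖pseudoLag P r X θ (δ n) (e₀ k) (e₀ l) x‖
  set B2 := δ n * ∑ x ∈ S, ‖pseudoLag P r X θ (δ n) (e₀ l) (e₀ k) x‖
  have hpos : ∀ f : ℤ → ℂ, 0 ≤ δ n * ∑ x ∈ S, ‖f x‖ := fun f =>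
    mul_nonneg hδ.le (Finset.sum_nonneg fun _ _ => norm_nonneg _)
  have hA1 : 0 ≤ A1 := hpos _
  have hA2 : 0 ≤ A2 := hpos _
  have hB1 : 0 ≤ B1 := hpos _
  have hB2 : 0 ≤ B2 := hpos _
  have e2 : ∫ ω, ‖⟪HS.outer (e₀ k) (e₀ l), cltStat P X K δ Δ θ n ω⟫_ℂ‖ ^ 2 ∂P
      ≤ C * (A1 * A2 + (B2 * B2 + B1 * B1)) := by
    rw [e1, h2, norm_mul, Complex.norm_real, Real.norm_of_nonneg (lagScale_nonneg hδ.le hΔ.le n)]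
    calc _ ≤ lagScale (δ n) (Δ n) n * (‖lagSum _ n 1 _ _‖ + ‖lagSum _ n (phase θ (δ n) ^ 2) _ _‖) :=
          mul_le_mul_of_nonneg_left (norm_add_le _ _) (lagScale_nonneg hδ.le hΔ.le n)
      _ ≤ C * (A1 * A2) + C * (B1 * B2) := by
          rw [mul_add]
          exact add_le_add (b1.trans (mul_le_mul_of_nonneg_right hw (mul_nonneg hA1 hA2)))
            (b2.trans (mul_le_mul_of_nonneg_right hw (mul_nonneg hB1 hB2)))
      _ ≤ _ := by
          have : B1 * B2 ≤ B2 * B2 + B1 * B1 := by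
            nlinarith [sq_nonneg (B1 - B2), mul_nonneg hB1 hB2]
          rw [← mul_add]
          gcongr
  refine (ENNReal.ofReal_le_ofReal e2).trans ?_
  rw [ENNReal.ofReal_mul hC0, ENNReal.ofReal_add (by positivity) (by positivity),
    ENNReal.ofReal_add (by positivity) (by positivity)]
  have en : ∀ f f' : ℤ → ℂ, (∀ x, ‖f x‖ = ‖f' x‖) → ∀ x, ‖f x‖ₑ = ‖f' x‖ₑ := fun f f' h x => by
    rw [← ofReal_norm, h, ofReal_norm]
  refine mul_le_mul_right (add_le_add ?_ (add_le_add ?_ ?_)) _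
  · refine ofReal_mul_sum_mul_sum_le hδ S _ _ ?_
    simp_rw [en _ _ (norm_covLag (P := P) (X := X) θ (δ n) (e₀ k) (e₀ k)),
      en _ _ (norm_covLag (P := P) (X := X) θ (δ n) (e₀ l) (e₀ l))]
    exact ha n k l
  · refine ofReal_mul_sum_mul_sum_le hδ S _ _ ?_
    simp_rw [en _ _ (norm_pseudoLag (P := P) (X := X) (r := r) θ (δ n) (e₀ l) (e₀ k))]
    exact hb n k l
  · refine ofReal_mul_sum_mul_sum_le hδ S _ _ ?_
    simp_rw [en _ _ (norm_pseudoLag (P := P) (X := X) (r := r) θ (δ n) (e₀ k) (e₀ l))]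
    exact hb n l k

end Moments

end FunctionalCLT

namespace FunctionalCLT

/-! ### Fejér sums -/

section Fejer

/-- The difference `a` occurs for `m - |a|` pairs, and for none if `|a| ≥ m`; truncation in `toNat`
encodes the latter. -/
theorem sum_sum_sub_eq (m : ℕ) (F : ℤ → ℂ) :
    ∑ j ∈ Finset.Icc (1 : ℤ) m, ∑ i ∈ Finset.Icc (1 : ℤ) m, F (i - j)
      = ∑' a : ℤ, ((((m : ℤ) - |a|).toNat : ℝ) : ℂ) * F a := by
  classical
  have h1 : ∀ j ∈ Finset.Icc (1 : ℤ) m, ∑ i ∈ Finset.Icc (1 : ℤ) m, F (i - j)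
      = ∑ a ∈ Finset.Icc (-(m : ℤ)) m, if j + a ∈ Finset.Icc (1 : ℤ) m then F a else 0 := by
    intro j hj
    rw [sum_Icc_eq_sum_shift hj fun i => F (i - j)]
    simp
  rw [Finset.sum_congr rfl h1, Finset.sum_comm, tsum_eq_sum (s := Finset.Icc (-(m : ℤ)) m)]
  · refine Finset.sum_congr rfl fun a _ => ?_
    rw [← Finset.sum_filter, Finset.sum_const, nsmul_eq_mul]
    congr 1
    have e : (Finset.Icc (1 : ℤ) m).filter (fun j => j + a ∈ Finset.Icc (1 : ℤ) m)
        = Finset.Icc (max 1 (1 - a)) (min m (m - a)) := by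
      ext i
      simp only [Finset.mem_filter, Finset.mem_Icc]
      omega
    rw [e, Int.card_Icc, Complex.ofReal_natCast]
    congr 2
    rcases abs_cases a with h | h <;> omega
  · intro a ha
    rw [Finset.mem_Icc, ← abs_le] at ha
    have : ((m : ℤ) - |a|).toNat = 0 := by omega
    simp [this]

/-- A summable sequence with nonnegative Fejér sums has a nonnegative sum. -/
theorem re_tsum_nonneg_of_fejer {F : ℤ → ℂ} (hF : Summable fun a => ‖F a‖)
    (h : ∀ m : ℕ, 0 ≤ (∑ j ∈ Finset.Icc (1 : ℤ) m, ∑ i ∈ Finset.Icc (1 : ℤ) m, F (i - j)).re) :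
    0 ≤ (∑' a, F a).re := by
  have hw : ∀ (m : ℕ) (a : ℤ), (((m : ℤ) - |a|).toNat : ℝ) ≤ m := fun m a => by
    have : ((m : ℤ) - |a|).toNat ≤ m := by
      have := abs_nonneg a
      omega
    exact_mod_cast this
  -- The Fejér weights `(1 - |a|/m)⁺` tend to 1 and are at most 1, so `‖F‖` dominates.
  have hlim : Tendsto (fun m : ℕ => ∑' a : ℤ,
      (((((m : ℤ) - |a|).toNat : ℝ) / m : ℝ) : ℂ) * F a) atTop (𝓝 (∑' a, F a)) := by
    refine tendsto_tsum_of_dominated_convergence hF (fun a => ?_) ?_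
    · have h1 : Tendsto (fun m : ℕ => ((((m : ℤ) - |a|).toNat : ℝ) / m : ℝ)) atTop (𝓝 1) := by
        have h2 : Tendsto (fun m : ℕ => 1 - (a.natAbs : ℝ) / m) atTop (𝓝 (1 - 0)) :=
          tendsto_const_nhds.sub (tendsto_const_div_atTop_nhds_zero_nat _)
        rw [sub_zero] at h2
        refine h2.congr' ?_
        filter_upwards [eventually_ge_atTop (a.natAbs + 1)] with m hm
        have e : ((m : ℤ) - |a|).toNat = m - a.natAbs := by
          rw [Int.abs_eq_natAbs]; omega
        have hm0 : (m : ℝ) ≠ 0 := by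
          have : m ≠ 0 := by omega
          exact_mod_cast this
        rw [e, Nat.cast_sub (by omega)]
        field_simp
      have h3 := ((Complex.continuous_ofReal.tendsto 1).comp h1).mul_const (F a)
      simpa using h3
    · refine Eventually.of_forall fun m a => ?_
      rw [norm_mul, Complex.norm_real, Real.norm_of_nonneg (by positivity)]
      refine mul_le_of_le_one_left (norm_nonneg _) ?_
      exact div_le_one_of_le₀ (hw m a) (Nat.cast_nonneg m)
  have hre := (Complex.continuous_re.tendsto _).comp hlim
  refine ge_of_tendsto' hre fun m => ?_
  simp only [Function.comp]
  have e : ∑' a : ℤ, (((((m : ℤ) - |a|).toNat : ℝ) / m : ℝ) : ℂ) * F a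
      = ((1 / m : ℝ) : ℂ) * ∑ j ∈ Finset.Icc (1 : ℤ) m, ∑ i ∈ Finset.Icc (1 : ℤ) m, F (i - j) := by
    rw [sum_sum_sub_eq, ← tsum_mul_left]
    refine tsum_congr fun a => ?_
    push_cast
    ring
  rw [e, Complex.re_ofReal_mul]
  exact mul_nonneg (by positivity) (h m)

end Fejer

/-! ### Positivity and finite trace of the spectral density -/

section Spectral

variable {H : Type*} [NormedAddCommGroup H] [InnerProductSpace ℂ H] [CompleteSpace H]
  {Ω : Type*} [MeasurableSpace Ω] {P : Measure Ω} {X : ℝ → Ω → H} {κ κ' : Type*}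
  {r : HilbertBasis κ ℂ H} {e₀ : HilbertBasis κ' ℂ H} {δ Δ L : ℕ → ℝ} {δinf θ : ℝ}

section

variable [TopologicalSpace.SeparableSpace H] [MeasurableSpace H] [BorelSpace H]

/-- The double sum is the second moment of `∑ zⁱ ⟪u, X(δi)⟫`, with `z` the unit phase. -/
theorem fejer_covLag_nonneg (hX : IsStationaryGaussian P r X) (θ δ : ℝ) (u : H) (m : ℕ) :
    0 ≤ (∑ j ∈ Finset.Icc (1 : ℤ) m, ∑ i ∈ Finset.Icc (1 : ℤ) m, covLag P X θ δ u u (i - j)).re := by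
  have hV := hX.isGaussianSpace
  set S := Finset.Icc (1 : ℤ) m
  set Y : Ω → ℂ := fun ω => ∑ i ∈ S, phase θ δ ^ i * gridCoord X δ u i ω with hY
  have hi := fun i j => hV.integrable_mul (gridCoord_mem (X := X) δ u i)
    (conj_mem_complexify (gridCoord_mem (X := X) δ u j))
  have hcz : conj (phase θ δ) = (phase θ δ)⁻¹ := by
    rw [Complex.inv_def, Complex.normSq_eq_norm_sq, norm_phase]; simp
  have e1 : ∀ i j, covLag P X θ δ u u (i - j) = ∫ ω, phase θ δ ^ i * conj (phase θ δ ^ j) *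
      (gridCoord X δ u i ω * conj (gridCoord X δ u j ω)) ∂P := fun i j => by
    rw [integral_const_mul, integral_gridCoord_mul_conj hX, covLag, zpow_sub₀ (phase_ne_zero θ δ),
      map_zpow₀, hcz, inv_zpow]
    rfl
  have e2 : ∑ j ∈ S, ∑ i ∈ S, covLag P X θ δ u u (i - j) = ∫ ω, ((‖Y ω‖ ^ 2 : ℝ) : ℂ) ∂P := by
    simp_rw [e1]
    have e3 : ∀ ω, ((‖Y ω‖ ^ 2 : ℝ) : ℂ) = ∑ j ∈ S, ∑ i ∈ S, phase θ δ ^ i * conj (phase θ δ ^ j) *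
      (gridCoord X δ u i ω * conj (gridCoord X δ u j ω)) := fun ω => by
      push_cast
      rw [← Complex.mul_conj', hY]
      simp only [map_sum, map_mul]
      rw [Finset.sum_mul_sum, Finset.sum_comm]
      refine Finset.sum_congr rfl fun j _ => Finset.sum_congr rfl fun i _ => ?_
      ring
    simp_rw [e3]
    rw [integral_finsetSum _ fun j _ => integrable_finsetSum _ fun i _ => (hi i j).const_mul _]
    refine Finset.sum_congr rfl fun j _ => ?_
    rw [integral_finsetSum _ fun i _ => (hi i j).const_mul _]
  rw [e2, integral_complex_ofReal, Complex.ofReal_re]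
  exact integral_nonneg fun ω => sq_nonneg _

/-- Positivity holds for every grid size `δ n` by the Fejér criterion and passes to the limit. The
cases `δinf = 0` and `δinf > 0` need no separate treatment. -/
theorem CLTCondition.re_inner_specDensity_nonneg (hCLT : CLTCondition P r e₀ X δ Δ L δinf θ)
    (hX : IsStationaryGaussian P r X) {u : H} (hu : ‖u‖ = 1) :
    0 ≤ (⟪u, specDensity P X θ δinf u⟫_ℂ).re := by
  have h := (Complex.continuous_re.tendsto _).comp (hCLT.tendsto_inner_specDensity u u)
  refine ge_of_tendsto' h fun n => ?_
  simp only [Function.comp]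
  obtain ⟨B, τ, hB⟩ := hCLT.isLagBound_covLag hu hu
  rw [← hCLT.tsum_covLag, Complex.re_ofReal_mul]
  have := hCLT.grid_pos n
  have := Real.pi_pos
  exact mul_nonneg (by positivity) (re_tsum_nonneg_of_fejer (hB.summable (hCLT.grid_pos n))
    (fejer_covLag_nonneg hX θ (δ n) u))

end

/-- In the limit, `a k l` dominates the product of the `k`-th and `l`-th diagonal entries. Summing
over both indices makes the square of the wanted sum finite, hence the sum itself. -/
theorem CLTCondition.tsum_enorm_inner_specDensity_ne_top
    (hCLT : CLTCondition P r e₀ X δ Δ L δinf θ) :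
    ∑' k, ‖⟪e₀ k, specDensity P X θ δinf (e₀ k)⟫_ℂ‖ₑ ≠ ⊤ := by
  obtain ⟨a, ha, ha'⟩ := hCLT.cov_coord
  have h1 : ∀ n k, ‖⟪e₀ k, specDensity P X θ (δ n) (e₀ k)⟫_ℂ‖ₑ
      ≤ ENNReal.ofReal (δ n) * ∑' x : ℤ, ‖⟪e₀ k, covOp P X (δ n * x) (e₀ k)⟫_ℂ‖ₑ := fun n k => by
    have hδ := hCLT.grid_pos n
    have hpi : 1 ≤ 2 * Real.pi := by linarith [Real.pi_gt_three]
    rw [← hCLT.tsum_covLag, enorm_mul]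
    refine mul_le_mul' ?_ (enorm_tsum_le_tsum_enorm.trans (le_of_eq (tsum_congr fun d => ?_)))
    · rw [← ofReal_norm, Complex.norm_real, Real.norm_of_nonneg (by positivity)]
      exact ENNReal.ofReal_le_ofReal (div_le_self hδ.le hpi)
    · rw [← ofReal_norm, norm_covLag, ofReal_norm]
  have h2 : ∀ k l, ‖⟪e₀ k, specDensity P X θ δinf (e₀ k)⟫_ℂ‖ₑ *
      ‖⟪e₀ l, specDensity P X θ δinf (e₀ l)⟫_ℂ‖ₑ ≤ a k l := fun k l => by
    have h3 := ((hCLT.tendsto_inner_specDensity (e₀ k) (e₀ k)).mul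
      (hCLT.tendsto_inner_specDensity (e₀ l) (e₀ l))).enorm
    rw [enorm_mul] at h3
    refine le_of_tendsto' h3 fun n => ?_
    rw [enorm_mul]
    refine (mul_le_mul' (h1 n k) (h1 n l)).trans (le_trans (le_of_eq ?_) (ha n k l))
    simp_rw [ENNReal.tsum_mul_left, ENNReal.tsum_mul_right]
    rw [sq, ENNReal.ofReal_mul (hCLT.grid_pos n).le]
    ring
  have h4 : (∑' k, ‖⟪e₀ k, specDensity P X θ δinf (e₀ k)⟫_ℂ‖ₑ) *
      (∑' k, ‖⟪e₀ k, specDensity P X θ δinf (e₀ k)⟫_ℂ‖ₑ) < ⊤ := by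
    refine lt_of_le_of_lt ?_ ha'
    rw [← ENNReal.tsum_mul_right]
    refine ENNReal.tsum_le_tsum fun k => ?_
    rw [← ENNReal.tsum_mul_left]
    exact ENNReal.tsum_le_tsum fun l => h2 k l
  intro h
  rw [h] at h4
  simp at h4

omit [CompleteSpace H] in
theorem hasSum_inner_of_diag {ι : Type*} {e : HilbertBasis ι ℂ H} {lam : ι → ℝ} {A : H →L[ℂ] H}
    (hdiag : HasSum (fun i => (lam i : ℂ) • InnerProductSpace.rankOne ℂ (e i) (e i)) A) (u v : H) :
    HasSum (fun i => (lam i : ℂ) * (⟪u, e i⟫_ℂ * ⟪e i, v⟫_ℂ)) ⟪u, A v⟫_ℂ := by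
  have h1 := (hdiag.mapL (ContinuousLinearMap.apply ℂ H v)).mapL (innerSL ℂ u)
  simp only [ContinuousLinearMap.apply_apply, innerSL_apply_apply, smul_apply,
    InnerProductSpace.rankOne_apply, inner_smul_right] at h1
  refine h1.congr_fun fun i => ?_
  ring

omit [CompleteSpace H] in
theorem apply_eq_of_diag {ι : Type*} {e : HilbertBasis ι ℂ H} {lam : ι → ℝ} {A : H →L[ℂ] H}
    (hdiag : HasSum (fun i => (lam i : ℂ) • InnerProductSpace.rankOne ℂ (e i) (e i)) A) (i : ι) :
    A (e i) = (lam i : ℂ) • e i := by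
  classical
  have h1 := hdiag.mapL (ContinuousLinearMap.apply ℂ H (e i))
  simp only [ContinuousLinearMap.apply_apply, smul_apply, InnerProductSpace.rankOne_apply] at h1
  refine h1.unique ?_
  have h2 := hasSum_single (f := fun j => (lam j : ℂ) • ⟪e j, e i⟫_ℂ • e j) i fun j hj => by
    rw [e.orthonormal.2 hj, zero_smul, smul_zero]
  simpa [e.orthonormal.1 i] using h2

/-- All terms being nonnegative, Tonelli exchanges the two bases: the diagonal sum in the system `b`
equals `∑ λᵢ`. -/
theorem summable_of_trace {ι : Type*} {e : HilbertBasis ι ℂ H} {lam : ι → ℝ} {A : H →L[ℂ] H}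
    (hdiag : HasSum (fun i => (lam i : ℂ) • InnerProductSpace.rankOne ℂ (e i) (e i)) A)
    (h0 : ∀ i, 0 ≤ lam i) (b : HilbertBasis κ' ℂ H) (ht : ∑' k, ‖⟪b k, A (b k)⟫_ℂ‖ₑ ≠ ⊤) :
    Summable lam := by
  have h1 : ∀ k, ∑' i, ENNReal.ofReal (lam i) * ‖⟪b k, e i⟫_ℂ‖ₑ ^ 2 ≤ ‖⟪b k, A (b k)⟫_ℂ‖ₑ := by
    intro k
    have h2 := hasSum_inner_of_diag hdiag (b k) (b k)
    have e2 : ∀ i, (lam i : ℂ) * (⟪b k, e i⟫_ℂ * ⟪e i, b k⟫_ℂ)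
        = ((lam i * ‖⟪b k, e i⟫_ℂ‖ ^ 2 : ℝ) : ℂ) := fun i => by
      rw [← inner_conj_symm (e i), Complex.mul_conj']
      push_cast
      rfl
    simp_rw [e2] at h2
    have h3 : HasSum (fun i => lam i * ‖⟪b k, e i⟫_ℂ‖ ^ 2) (⟪b k, A (b k)⟫_ℂ).re := by
      have := Complex.hasSum_re h2
      simpa only [Complex.ofReal_re] using this
    have e3 : ∀ i, ENNReal.ofReal (lam i) * ‖⟪b k, e i⟫_ℂ‖ₑ ^ 2
        = ENNReal.ofReal (lam i * ‖⟪b k, e i⟫_ℂ‖ ^ 2) := fun i => by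
      rw [ENNReal.ofReal_mul (h0 i), ENNReal.ofReal_pow (norm_nonneg _), ofReal_norm]
    simp_rw [e3]
    rw [← ENNReal.ofReal_tsum_of_nonneg (fun i => mul_nonneg (h0 i) (sq_nonneg _)) h3.summable,
      h3.tsum_eq, ← ofReal_norm]
    exact ENNReal.ofReal_le_ofReal (Complex.re_le_norm _)
  have h4 : ∑' i, ENNReal.ofReal (lam i) ≠ ⊤ := by
    refine ne_top_of_le_ne_top ht (le_trans (le_of_eq ?_) (ENNReal.tsum_le_tsum h1))
    rw [ENNReal.tsum_comm]
    refine tsum_congr fun i => ?_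
    rw [ENNReal.tsum_mul_left, ← enorm_sq_eq_tsum b (e i), ← ofReal_norm, e.orthonormal.1 i]
    simp
  exact (ENNReal.summable_toReal h4).congr fun i => ENNReal.toReal_ofReal (h0 i)

end Spectral

end FunctionalCLT

namespace FunctionalCLT

/-! ### Almost sure limits of Gaussian variables -/

section GaussianLimit

variable {Ω : Type*} [MeasurableSpace Ω] {P : Measure Ω} [IsProbabilityMeasure P]

omit [IsProbabilityMeasure P] in
theorem integral_exp_of_hasGaussianLaw {Y : Ω → ℝ} (hY : HasGaussianLaw Y P)
    (h0 : ∫ ω, Y ω ∂P = 0) (t : ℝ) :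
    ∫ ω, Complex.exp (t * Y ω * Complex.I) ∂P
      = Complex.exp ((-((∫ ω, Y ω ^ 2 ∂P) * t ^ 2 / 2) : ℝ) : ℂ) := by
  have hv : Var[Y; P] = ∫ ω, Y ω ^ 2 ∂P := variance_of_integral_eq_zero hY.aemeasurable h0
  have h1 : charFun (P.map Y) t = ∫ ω, Complex.exp (t * Y ω * Complex.I) ∂P := by
    rw [charFun_apply_real, integral_map hY.aemeasurable (by fun_prop)]
  rw [← h1, hY.map_eq_gaussianReal, charFun_gaussianReal, h0, hv,
    Real.coe_toNNReal _ (integral_nonneg fun ω => sq_nonneg _)]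
  congr 1
  push_cast
  ring

/-- An almost sure limit of centred Gaussian variables is centred Gaussian. -/
theorem map_eq_gaussianReal_of_tendsto {β : Type*} {l : Filter β} [l.NeBot]
    [l.IsCountablyGenerated] {Y : β → Ω → ℝ} {W : Ω → ℝ} (hY : ∀ b, HasGaussianLaw (Y b) P)
    (h0 : ∀ b, ∫ ω, Y b ω ∂P = 0)
    (hlim : ∀ᵐ ω ∂P, Tendsto (fun b => Y b ω) l (𝓝 (W ω))) :
    ∃ v : ℝ≥0, P.map W = gaussianReal 0 v := by
  have hW : AEMeasurable W P :=
    aemeasurable_of_tendsto_metrizable_ae l (fun b => (hY b).aemeasurable) hlim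
  have hWp : IsProbabilityMeasure (P.map W) := Measure.isProbabilityMeasure_map hW
  have hφ : ∀ t : ℝ, Tendsto (fun b => Complex.exp ((-((∫ ω, Y b ω ^ 2 ∂P) * t ^ 2 / 2) : ℝ) : ℂ))
      l (𝓝 (charFun (P.map W) t)) := fun t => by
    have e : charFun (P.map W) t = ∫ ω, Complex.exp (t * W ω * Complex.I) ∂P := by
      rw [charFun_apply_real, integral_map hW (by fun_prop)]
    rw [e]
    simp_rw [← fun b => integral_exp_of_hasGaussianLaw (hY b) (h0 b) t]
    refine tendsto_integral_filter_of_dominated_convergence (fun _ => 1) ?_ ?_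
      (integrable_const _) ?_
    · refine Eventually.of_forall fun b => ?_
      have : Continuous fun x : ℝ => Complex.exp (t * x * Complex.I) := by fun_prop
      exact this.comp_aestronglyMeasurable (hY b).aemeasurable.aestronglyMeasurable
    · refine Eventually.of_forall fun b => ae_of_all _ fun ω => ?_
      rw [← Complex.ofReal_mul, Complex.norm_exp_ofReal_mul_I]
    · filter_upwards [hlim] with ω hω
      have : Continuous fun x : ℝ => Complex.exp (t * x * Complex.I) := by fun_prop
      exact (this.tendsto _).comp hω
  -- Convergence of the variances is not assumed. At a point `t₀ ≠ 0` where the limiting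
  -- characteristic function does not vanish, logarithms of the moduli force it.
  obtain ⟨t₀, ht₀, hne⟩ : ∃ t₀ : ℝ, t₀ ≠ 0 ∧ charFun (P.map W) t₀ ≠ 0 := by
    have h1 : ∀ᶠ t : ℝ in 𝓝 0, charFun (P.map W) t ≠ 0 :=
      continuous_charFun.continuousAt.eventually_ne (by simp)
    have h2 := (h1.filter_mono nhdsWithin_le_nhds : ∀ᶠ t in 𝓝[≠] (0 : ℝ), _).and
      self_mem_nhdsWithin
    obtain ⟨t, ht⟩ := h2.exists
    exact ⟨t, ht.2, ht.1⟩
  have hv : ∃ s : ℝ, Tendsto (fun b => ∫ ω, Y b ω ^ 2 ∂P) l (𝓝 s) := by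
    have h1 := (hφ t₀).norm.log (norm_ne_zero_iff.mpr hne)
    refine ⟨_, (h1.const_mul (-2 / t₀ ^ 2)).congr fun b => ?_⟩
    rw [Complex.norm_exp_ofReal, Real.log_exp]
    field_simp
  obtain ⟨s, hs⟩ := hv
  have hs0 : 0 ≤ s := ge_of_tendsto' hs fun b => integral_nonneg fun ω => sq_nonneg _
  refine ⟨s.toNNReal, Measure.ext_of_charFun ?_⟩
  ext t
  refine tendsto_nhds_unique (hφ t) ?_
  rw [charFun_gaussianReal, Real.coe_toNNReal s hs0]
  have hc : Continuous fun x : ℝ => Complex.exp ((-(x * t ^ 2 / 2) : ℝ) : ℂ) := by fun_prop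
  have h2 := (hc.tendsto s).comp hs
  have e : Complex.exp (t * (0 : ℝ) * Complex.I - s * t ^ 2 / 2)
      = Complex.exp ((-(s * t ^ 2 / 2) : ℝ) : ℂ) := by
    congr 1
    push_cast
    ring
  rw [e]
  exact h2

end GaussianLimit

/-! ### The Hermitian Gaussian array -/

section HermitianArray

variable {ι : Type*} [LinearOrder ι] {Ω : Type*} [MeasurableSpace Ω] {P : Measure Ω}
  {Z : ι → ι → Ω → ℂ}

/-- The independent real variables of a Hermitian Gaussian array. -/
noncomputable def realParts (Z : ι → ι → Ω → ℂ) (p : ι × ι) (ω : Ω) : ℝ :=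
  if p.1 ≤ p.2 then (Z p.1 p.2 ω).re else (Z p.2 p.1 ω).im

/-- The real span of the entries of a Hermitian Gaussian array. -/
noncomputable def realPartsSpan (Z : ι → ι → Ω → ℂ) : Submodule ℝ (Ω → ℝ) :=
  Submodule.span ℝ (Set.range (realParts Z))

namespace IsHermitianGaussianArray

variable (hZ : IsHermitianGaussianArray P Z)
include hZ

theorem hasLaw_realParts (p : ι × ι) :
    HasLaw (realParts Z p) (gaussianReal 0 (if p.1 = p.2 then 1 else 1 / 2)) P := by
  unfold realParts
  rcases lt_trichotomy p.1 p.2 with h | h | h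
  · simp only [h.le, if_true, h.ne, if_false]
    exact hZ.law_re _ _ h
  · simp only [h, le_refl, if_true]
    exact hZ.law_diag _
  · simp only [not_le.mpr h, if_false, h.ne']
    exact hZ.law_im _ _ h

theorem isGaussianSpace [IsProbabilityMeasure P] : IsGaussianSpace (realPartsSpan Z) P := by
  have hg : ∀ p, HasGaussianLaw (realParts Z p) P := fun p => (hZ.hasLaw_realParts p).hasGaussianLaw
  have hmean : ∀ p, ∫ ω, realParts Z p ω ∂P = 0 := fun p => by
    rw [(hZ.hasLaw_realParts p).integral_eq]
    simp
  have hrep : ∀ Y ∈ realPartsSpan Z, ∃ (s : Finset (ι × ι)) (c : ι × ι → ℝ),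
      Y = fun ω => ∑ p : s, c p * realParts Z p ω := fun Y hY => by
    obtain ⟨c, rfl⟩ := Finsupp.mem_span_range_iff_exists_finsupp.mp hY
    refine ⟨c.support, c, ?_⟩
    ext ω
    rw [Finset.sum_coe_sort c.support (fun p => c p * realParts Z p ω)]
    simp [Finsupp.sum]
  refine ⟨fun Y hY => ?_, fun Y hY => ?_⟩
  · obtain ⟨s, c, rfl⟩ := hrep Y hY
    have hi : iIndepFun (fun (p : s) ω => c p * realParts Z p ω) P :=
      (hZ.indep.precomp Subtype.val_injective).comp (fun (p : s) x => c p * x)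
        (fun p => measurable_const_mul _)
    exact hi.hasGaussianLaw_fun_sum fun p => by
      simpa using (hg p).fun_smul (c p)
  · obtain ⟨s, c, rfl⟩ := hrep Y hY
    change ∫ ω, ∑ p : s, c p * realParts Z p ω ∂P = 0
    rw [integral_finsetSum _ fun (p : s) _ => (hg (p : ι × ι)).integrable.const_mul (c p)]
    simp [integral_const_mul, hmean]

theorem integral_realParts_mul [IsProbabilityMeasure P] (p q : ι × ι) :
    ∫ ω, realParts Z p ω * realParts Z q ω ∂P
      = if p = q then (if p.1 = p.2 then 1 else 1 / 2) else 0 := by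
  have hg : ∀ p, HasGaussianLaw (realParts Z p) P := fun p => (hZ.hasLaw_realParts p).hasGaussianLaw
  have hmean : ∀ p, ∫ ω, realParts Z p ω ∂P = 0 := fun p => by
    rw [(hZ.hasLaw_realParts p).integral_eq]
    simp
  have hsq : ∫ ω, realParts Z p ω ^ 2 ∂P = ∫ x, x ^ 2 ∂(gaussianReal 0
      (if p.1 = p.2 then 1 else 1 / 2)) :=
    (hZ.hasLaw_realParts p).integral_comp (f := fun x => x ^ 2) (by fun_prop)
  split_ifs with h h1
  · subst h
    simp_rw [← sq]
    rw [hsq, integral_sq_gaussianReal]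
    simp [h1]
  · subst h
    simp_rw [← sq]
    rw [hsq, integral_sq_gaussianReal]
    simp [h1]
  · have hi : IndepFun (realParts Z p) (realParts Z q) P := hZ.indep.indepFun h
    rw [hi.integral_fun_mul_eq_mul_integral (hg p).aemeasurable.aestronglyMeasurable
      (hg q).aemeasurable.aestronglyMeasurable, hmean, zero_mul]

theorem im_diag (i : ι) (ω : Ω) : (Z i i ω).im = 0 := by
  have := congrArg Complex.im (hZ.hermitian i i ω)
  simp at this
  linarith

/-- Every entry is a combination of the real variables. -/
theorem eq_realParts (i j : ι) (ω : Ω) : Z i j ω =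
    (if j < i then -Complex.I else 1) * (realParts Z (i, j) ω : ℂ) +
    (if i < j then Complex.I else if j < i then 1 else 0) * (realParts Z (j, i) ω : ℂ) := by
  unfold realParts
  rcases lt_trichotomy i j with h | h | h
  · simp only [h.le, not_lt.mpr h.le, not_le.mpr h, h, if_true, if_false]
    rw [one_mul, mul_comm, Complex.re_add_im]
  · subst h
    apply Complex.ext
    · simp
    · simp [hZ.im_diag]
  · simp only [h, not_lt.mpr h.le, not_le.mpr h, h.le, if_true, if_false]
    rw [hZ.hermitian j i]
    apply Complex.ext <;> simp

theorem mem_complexify (i j : ι) : Z i j ∈ complexify (realPartsSpan Z) := by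
  have hm : ∀ p, (fun ω => (realParts Z p ω : ℂ)) ∈ complexify (realPartsSpan Z) := fun p =>
    ofReal_mem_complexify (Submodule.subset_span ⟨p, rfl⟩)
  have h := (complexify (realPartsSpan Z)).add_mem
    ((complexify (realPartsSpan Z)).smul_mem (if j < i then -Complex.I else 1) (hm (i, j)))
    ((complexify (realPartsSpan Z)).smul_mem
      (if i < j then Complex.I else if j < i then 1 else 0) (hm (j, i)))
  convert! h using 1
  ext ω
  rw [hZ.eq_realParts]
  rfl

theorem integral_mul_conj [IsProbabilityMeasure P] (i j k l : ι) :
    ∫ ω, Z i j ω * conj (Z k l ω) ∂P = if (i, j) = (k, l) then 1 else 0 := by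
  have hV := hZ.isGaussianSpace
  have hm : ∀ p, (fun ω => (realParts Z p ω : ℂ)) ∈ complexify (realPartsSpan Z) := fun p =>
    ofReal_mem_complexify (Submodule.subset_span ⟨p, rfl⟩)
  have hint : ∀ (c : ℂ) p q, Integrable (fun ω => c * ((realParts Z p ω : ℂ) * (realParts Z q ω : ℂ))) P :=
    fun c p q => (hV.integrable_mul (hm p) (hm q)).const_mul c
  have hval : ∀ (c : ℂ) p q, ∫ ω, c * ((realParts Z p ω : ℂ) * (realParts Z q ω : ℂ)) ∂P
      = c * ((if p = q then (if p.1 = p.2 then 1 else 1 / 2) else 0 : ℝ) : ℂ) := fun c p q => by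
    rw [integral_const_mul, ← hZ.integral_realParts_mul p q, ← integral_complex_ofReal]
    simp
  have e : ∀ a b a' b' : ℂ, ∫ ω, (a * (realParts Z (i, j) ω : ℂ) + b * (realParts Z (j, i) ω : ℂ)) *
      conj (a' * (realParts Z (k, l) ω : ℂ) + b' * (realParts Z (l, k) ω : ℂ)) ∂P
      = (a * conj a') * ((if (i, j) = (k, l) then (if i = j then 1 else 1 / 2) else 0 : ℝ) : ℂ)
      + (a * conj b') * ((if (i, j) = (l, k) then (if i = j then 1 else 1 / 2) else 0 : ℝ) : ℂ)
      + ((b * conj a') * ((if (j, i) = (k, l) then (if j = i then 1 else 1 / 2) else 0 : ℝ) : ℂ)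
      + (b * conj b') * ((if (j, i) = (l, k) then (if j = i then 1 else 1 / 2) else 0 : ℝ) : ℂ)) := by
    intro a b a' b'
    have hadd : ∀ (c c' : ℂ) p q p' q', Integrable (fun ω =>
        c * ((realParts Z p ω : ℂ) * (realParts Z q ω : ℂ)) +
        c' * ((realParts Z p' ω : ℂ) * (realParts Z q' ω : ℂ))) P :=
      fun c c' p q p' q' => (hint c p q).add (hint c' p' q')
    rw [← hval, ← hval, ← hval, ← hval, ← integral_add (hint _ _ _) (hint _ _ _),
      ← integral_add (hint _ _ _) (hint _ _ _), ← integral_add (hadd _ _ _ _ _ _)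
        (hadd _ _ _ _ _ _)]
    refine integral_congr_ae (ae_of_all _ fun ω => ?_)
    simp only [map_add, map_mul, Complex.conj_ofReal]
    ring
  simp_rw [hZ.eq_realParts i j, hZ.eq_realParts k l]
  rw [e]
  simp only [Prod.mk.injEq]
  by_cases h1 : i = k ∧ j = l
  · obtain ⟨rfl, rfl⟩ := h1
    rcases lt_trichotomy i j with h | h | h
    · simp [h, h.ne, h.ne', not_lt.mpr h.le]; norm_num
    · subst h; simp
    · simp [h, h.ne, h.ne', not_lt.mpr h.le]; norm_num
  · rw [if_neg h1]
    by_cases h2 : i = l ∧ j = k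
    · obtain ⟨rfl, rfl⟩ := h2
      rcases lt_trichotomy i j with h | h | h
      · simp [h, h.ne, h.ne', not_lt.mpr h.le]
      · subst h; simp at h1
      · simp [h, h.ne, h.ne', not_lt.mpr h.le]
    · have h3 : ¬(j = l ∧ i = k) := fun h => h1 h.symm
      have h4 : ¬(j = k ∧ i = l) := fun h => h2 h.symm
      simp [h1, h2, h3, h4]

theorem integral_norm_sq [IsProbabilityMeasure P] (i j : ι) : ∫ ω, ‖Z i j ω‖ ^ 2 ∂P = 1 := by
  have h := hZ.integral_mul_conj i j i j
  rw [if_pos rfl] at h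
  have e : ∀ ω, Z i j ω * conj (Z i j ω) = ((‖Z i j ω‖ ^ 2 : ℝ) : ℂ) := fun ω => by
    rw [Complex.mul_conj']; push_cast; rfl
  simp_rw [e] at h
  rw [integral_complex_ofReal] at h
  exact_mod_cast h

end IsHermitianGaussianArray

end HermitianArray

end FunctionalCLT

namespace FunctionalCLT

/-! ### Moments in a Hilbert basis -/

section HilbertBasisMoments

variable {E : Type*} [NormedAddCommGroup E] [InnerProductSpace ℂ E] [CompleteSpace E]
  {Ω : Type*} [MeasurableSpace Ω] {P : Measure Ω}

theorem lintegral_enorm_sq_eq_tsum {ι : Type*} [Countable ι] (b : HilbertBasis ι ℂ E) {Y : Ω → E}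
    (hY : AEStronglyMeasurable Y P) :
    ∫⁻ ω, ‖Y ω‖ₑ ^ 2 ∂P = ∑' i, ∫⁻ ω, ‖⟪b i, Y ω⟫_ℂ‖ₑ ^ 2 ∂P := by
  simp_rw [enorm_sq_eq_tsum b]
  refine lintegral_tsum fun i => ?_
  have : AEStronglyMeasurable (fun ω => ⟪b i, Y ω⟫_ℂ) P := aestronglyMeasurable_const.inner hY
  exact this.enorm.pow_const 2

omit [CompleteSpace E] [InnerProductSpace ℂ E] in
theorem memLp_two_iff_lintegral {Y : Ω → E} (hY : AEStronglyMeasurable Y P) :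
    MemLp Y 2 P ↔ ∫⁻ ω, ‖Y ω‖ₑ ^ 2 ∂P < ⊤ := by
  have h := eLpNorm_lt_top_iff_lintegral_rpow_enorm_lt_top (f := Y) (μ := P) (p := 2)
    (by norm_num) (by norm_num)
  simp only [ENNReal.toReal_ofNat, ENNReal.rpow_ofNat] at h
  exact ⟨fun hm => h.mp hm.eLpNorm_lt_top, fun hl => ⟨hY, h.mpr hl⟩⟩

omit [CompleteSpace E] in
theorem HilbertBasis.ext_inner {ι : Type*} (b : HilbertBasis ι ℂ E) {x y : E}
    (h : ∀ i, ⟪b i, x⟫_ℂ = ⟪b i, y⟫_ℂ) : x = y := by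
  apply b.repr.injective
  ext i
  rw [b.repr_apply_apply, b.repr_apply_apply, h]

omit [CompleteSpace E] in
theorem HilbertBasis.ext_clm {ι : Type*} {F : Type*} [NormedAddCommGroup F] [NormedSpace ℂ F]
    (b : HilbertBasis ι ℂ E) {S T : E →L[ℂ] F} (h : ∀ i, S (b i) = T (b i)) : S = T := by
  refine ContinuousLinearMap.ext_on
    (Submodule.dense_iff_topologicalClosure_eq_top.mpr b.dense_span) ?_
  rintro _ ⟨i, rfl⟩
  exact h i

end HilbertBasisMoments

/-! ### The limiting Gaussian series -/

section KarhunenLoeve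

variable {H : Type*} [NormedAddCommGroup H] [InnerProductSpace ℂ H] [CompleteSpace H]
  {ι : Type*} [LinearOrder ι] {Ω : Type*} [MeasurableSpace Ω] {P : Measure Ω}
  [IsProbabilityMeasure P] {Z : ι → ι → Ω → ℂ} (hZ : IsHermitianGaussianArray P Z)
  (e : HilbertBasis ι ℂ H) {lam : ι → ℝ} (h0 : ∀ i, 0 ≤ lam i) (hs : Summable lam) (K : ℝ → ℝ)

/-- The coefficient of an entry of the Gaussian array in the expansion. -/
noncomputable def klCoeff (lam : ι → ℝ) (p : ι × ι) : ℝ := Real.sqrt (lam p.1 * lam p.2)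

omit [LinearOrder ι] [MeasurableSpace Ω] in
theorem klTerm_eq (ω : Ω) (p : ι × ι) :
    klTerm e lam Z ω p = ((klCoeff lam p : ℂ) * Z p.1 p.2 ω) • HS.outerBasis e p := by
  rw [HS.outerBasis_apply]; rfl

section
include h0

omit [LinearOrder ι] in
theorem klCoeff_sq (p : ι × ι) : klCoeff lam p ^ 2 = lam p.1 * lam p.2 :=
  Real.sq_sqrt (mul_nonneg (h0 _) (h0 _))

include hs

omit [LinearOrder ι] in
theorem summable_klCoeff_sq : Summable fun p => klCoeff lam p ^ 2 := by
  simp_rw [klCoeff_sq h0]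
  exact hs.mul_of_nonneg hs h0 h0

end

include hZ

theorem lintegral_enorm_entry_sq (p : ι × ι) (c : ℂ) :
    ∫⁻ ω, ‖c * Z p.1 p.2 ω‖ₑ ^ 2 ∂P = ENNReal.ofReal (‖c‖ ^ 2) := by
  have hm := hZ.isGaussianSpace.memLp (hZ.mem_complexify p.1 p.2) (p := 2) (by norm_num)
  have hi : Integrable (fun ω => ‖Z p.1 p.2 ω‖ ^ 2) P := hm.integrable_norm_pow (p := 2) (by norm_num)
  have e1 : ∀ ω, ‖c * Z p.1 p.2 ω‖ₑ ^ 2 = ENNReal.ofReal (‖c‖ ^ 2 * ‖Z p.1 p.2 ω‖ ^ 2) := fun ω => by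
    rw [← ofReal_norm, ← ENNReal.ofReal_pow (norm_nonneg _), norm_mul, mul_pow]
  simp_rw [e1]
  rw [← ofReal_integral_eq_lintegral_ofReal (hi.const_mul _)
    (ae_of_all _ fun ω => by positivity), integral_const_mul, hZ.integral_norm_sq, mul_one]

include h0 hs

/-- The expected sum of squared coefficients is `∑ λᵢλⱼ`, which is finite. So almost surely the
coefficients are square summable along an orthonormal system, which gives unconditional convergence.
-/
theorem ae_summable_klTerm [TopologicalSpace.SeparableSpace H] :
    ∀ᵐ ω ∂P, Summable (klTerm e lam Z ω) := by
  have := e.countable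
  have hme : ∀ p : ι × ι, AEMeasurable (fun ω => ‖(klCoeff lam p : ℂ) * Z p.1 p.2 ω‖ₑ ^ 2) P := by
    intro p
    have hm : Measurable fun ω => (klCoeff lam p : ℂ) * Z p.1 p.2 ω :=
      (hZ.measurable p.1 p.2).const_mul _
    exact (hm.enorm.pow_const 2).aemeasurable
  have h1 : ∫⁻ ω, ∑' p : ι × ι, ‖(klCoeff lam p : ℂ) * Z p.1 p.2 ω‖ₑ ^ 2 ∂P ≠ ⊤ := by
    rw [lintegral_tsum hme]
    simp_rw [lintegral_enorm_entry_sq hZ]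
    have e2 : ∀ p, ‖((klCoeff lam p : ℝ) : ℂ)‖ ^ 2 = klCoeff lam p ^ 2 := fun p => by
      rw [Complex.norm_real, Real.norm_eq_abs, sq_abs]
    simp_rw [e2]
    exact (summable_klCoeff_sq h0 hs).tsum_ofReal_ne_top
  have h2 := ae_lt_top' (AEMeasurable.tsum hme) h1
  filter_upwards [h2] with ω hω
  have h3 : Summable fun p : ι × ι => ‖(klCoeff lam p : ℂ) * Z p.1 p.2 ω‖ ^ 2 :=
    (ENNReal.summable_toReal hω.ne).congr fun p => by
      rw [ENNReal.toReal_pow, toReal_enorm]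
  have h4 : Memℓp (fun p : ι × ι => (klCoeff lam p : ℂ) * Z p.1 p.2 ω) 2 :=
    memℓp_gen (by simpa using h3)
  have h5 := (HS.outerBasis e).hasSum_repr_symm ⟨_, h4⟩
  refine h5.summable.congr fun p => ?_
  rw [klTerm_eq]

theorem ae_inner_klSeries [TopologicalSpace.SeparableSpace H] :
    ∀ᵐ ω ∂P, ∀ p, ⟪HS.outerBasis e p, klSeries K e lam Z ω⟫_ℂ
      = ((kernelNorm K * klCoeff lam p : ℝ) : ℂ) * Z p.1 p.2 ω := by
  classical
  filter_upwards [ae_summable_klTerm hZ e h0 hs] with ω hω p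
  have h1 := hω.hasSum.mapL (innerSL ℂ (HS.outerBasis e p))
  simp only [innerSL_apply_apply, klTerm_eq, inner_smul_right] at h1
  have h2 := hasSum_single (f := fun q => ((klCoeff lam q : ℂ) * Z q.1 q.2 ω) *
    ⟪HS.outerBasis e p, HS.outerBasis e q⟫_ℂ) p fun q hq => by
      rw [(HS.outerBasis e).orthonormal.2 hq.symm, mul_zero]
  have h3 : ⟪HS.outerBasis e p, HS.outerBasis e p⟫_ℂ = 1 := by
    rw [inner_self_eq_norm_sq_to_K, (HS.outerBasis e).orthonormal.1 p]; simp
  rw [h3, mul_one] at h2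
  rw [klSeries, inner_smul_right]
  simp only [klTerm_eq]
  rw [h1.unique h2]
  push_cast
  ring

/-- The partial sums of the expansion. -/
noncomputable def klPartial (K : ℝ → ℝ) (e : HilbertBasis ι ℂ H) (lam : ι → ℝ) (Z : ι → ι → Ω → ℂ)
    (s : Finset (ι × ι)) (ω : Ω) : HS H :=
  (kernelNorm K : ℂ) • ∑ p ∈ s, klTerm e lam Z ω p

theorem ae_tendsto_klPartial [TopologicalSpace.SeparableSpace H] :
    ∀ᵐ ω ∂P, Tendsto (fun s => klPartial K e lam Z s ω) atTop (𝓝 (klSeries K e lam Z ω)) := by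
  filter_upwards [ae_summable_klTerm hZ e h0 hs] with ω hω
  have h : Tendsto (fun s => ∑ p ∈ s, klTerm e lam Z ω p) atTop (𝓝 (∑' p, klTerm e lam Z ω p)) :=
    hω.hasSum
  exact h.const_smul (kernelNorm K : ℂ)

omit h0 hs [IsProbabilityMeasure P] in
theorem apply_klPartial_mem (l : HS H →L[ℝ] ℝ) (s : Finset (ι × ι)) :
    (fun ω => l (klPartial K e lam Z s ω)) ∈ realPartsSpan Z := by
  have h1 : ∀ (A : HS H) (z : ℂ), l (z • A) = z.re * l A + z.im * l (Complex.I • A) := fun A z => by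
    conv_lhs => rw [← Complex.re_add_im z, add_smul, map_add, mul_smul]
    rw [Complex.coe_smul, Complex.coe_smul, map_smul, map_smul]
    rfl
  have h2 : (fun ω => l (klPartial K e lam Z s ω)) = ∑ p ∈ s,
      ((l (((kernelNorm K * klCoeff lam p : ℝ) : ℂ) • HS.outerBasis e p)) •
        (fun ω => (Z p.1 p.2 ω).re) +
      (l (Complex.I • (((kernelNorm K * klCoeff lam p : ℝ) : ℂ) • HS.outerBasis e p))) •
        (fun ω => (Z p.1 p.2 ω).im)) := by
    ext ω
    rw [klPartial, Finset.smul_sum, map_sum, Finset.sum_apply]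
    refine Finset.sum_congr rfl fun p _ => ?_
    have e3 : (kernelNorm K : ℂ) • klTerm e lam Z ω p
        = Z p.1 p.2 ω • (((kernelNorm K * klCoeff lam p : ℝ) : ℂ) • HS.outerBasis e p) := by
      rw [klTerm_eq, smul_smul, smul_smul]
      congr 1
      push_cast
      ring
    rw [e3, h1]
    simp only [Pi.add_apply, Pi.smul_apply, smul_eq_mul]
    ring
  rw [h2]
  refine Submodule.sum_mem _ fun p _ => Submodule.add_mem _ ?_ ?_
  · exact Submodule.smul_mem _ _ (hZ.mem_complexify p.1 p.2).1
  · exact Submodule.smul_mem _ _ (hZ.mem_complexify p.1 p.2).2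

variable [TopologicalSpace.SeparableSpace H]

theorem aemeasurable_klSeries : AEMeasurable (klSeries K e lam Z) P := by
  -- Countability of `ι` makes the filter of finite index sets countably generated, so almost sure
  -- limits along it are measurable.
  have := e.countable
  refine aemeasurable_of_tendsto_metrizable_ae atTop (fun s => ?_)
    (ae_tendsto_klPartial hZ e h0 hs K)
  unfold klPartial klTerm
  have hc : ∀ (p : ι × ι) (A : HS H), Continuous fun z : ℂ =>
      ((Real.sqrt (lam p.1 * lam p.2) : ℂ) * z) • A := fun p A => by fun_prop
  have h1 : ∀ p : ι × ι, Measurable fun ω => ((Real.sqrt (lam p.1 * lam p.2) : ℂ) * Z p.1 p.2 ω) •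
      HS.outer (e p.1) (e p.2) := fun p => (hc p _).measurable.comp (hZ.measurable p.1 p.2)
  exact ((Finset.measurable_fun_sum s fun p _ => h1 p).const_smul (kernelNorm K : ℂ)).aemeasurable

/-- A continuous real functional of the series is an almost sure limit of functionals of partial
sums, and these lie in the real Gaussian span of the array. -/
theorem hasGaussianLaw_klSeries : HasGaussianLaw (klSeries K e lam Z) P := by
  have := e.countable
  have hm := aemeasurable_klSeries hZ e h0 hs K
  have hV := hZ.isGaussianSpace
  refine ⟨isGaussian_of_map_eq_gaussianReal fun l => ?_⟩
  obtain ⟨v, hv⟩ := map_eq_gaussianReal_of_tendsto (P := P) (l := atTop)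
    (Y := fun s ω => l (klPartial K e lam Z s ω)) (W := fun ω => l (klSeries K e lam Z ω))
    (fun s => hV.hasGaussianLaw _ (apply_klPartial_mem hZ e K l s))
    (fun s => hV.integral_eq_zero _ (apply_klPartial_mem hZ e K l s)) (by
      filter_upwards [ae_tendsto_klPartial hZ e h0 hs K] with ω hω
      exact (l.continuous.tendsto _).comp hω)
  refine ⟨0, v, ?_⟩
  rw [AEMeasurable.map_map_of_aemeasurable l.continuous.measurable.aemeasurable hm]
  exact hv

theorem memLp_klSeries : MemLp (klSeries K e lam Z) 2 P :=
  (hasGaussianLaw_klSeries hZ e h0 hs K).memLp_two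

theorem integral_klSeries : ∫ ω, klSeries K e lam Z ω ∂P = 0 := by
  have hV := hZ.isGaussianSpace
  have hi := (memLp_klSeries hZ e h0 hs K).integrable one_le_two
  refine HilbertBasis.ext_inner (HS.outerBasis e) fun p => ?_
  rw [← integral_inner hi, inner_zero_right,
    integral_congr_ae ((ae_inner_klSeries hZ e h0 hs K).mono fun ω hω => hω p),
    integral_const_mul]
  have hp := hZ.mem_complexify p.1 p.2
  have hz : Integrable (Z p.1 p.2) P := (hV.memLp hp (p := 1) (by norm_num)).integrable le_rfl
  have h1 : ∫ ω, Z p.1 p.2 ω ∂P = 0 := by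
    rw [← integral_re_add_im hz]
    have e1 : ∫ ω, RCLike.re (Z p.1 p.2 ω) ∂P = 0 := hV.integral_eq_zero _ hp.1
    have e2 : ∫ ω, RCLike.im (Z p.1 p.2 ω) ∂P = 0 := hV.integral_eq_zero _ hp.2
    rw [e1, e2]
    simp
  rw [h1, mul_zero]

/-- The coordinates of the series are real multiples of the entries of `Z`, which are orthonormal in
`L²`. -/
theorem inner_crossCov_klSeries (p q : ι × ι) :
    ⟪HS.outerBasis e p, crossCov P (klSeries K e lam Z) (klSeries K e lam Z) (HS.outerBasis e q)⟫_ℂ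
      = if p = q then ((kernelNorm K ^ 2 * (lam q.1 * lam q.2) : ℝ) : ℂ) else 0 := by
  have hm := memLp_klSeries hZ e h0 hs K
  rw [inner_crossCov hm hm]
  have h1 : ∫ ω, ⟪HS.outerBasis e p, klSeries K e lam Z ω⟫_ℂ *
      ⟪klSeries K e lam Z ω, HS.outerBasis e q⟫_ℂ ∂P
      = ∫ ω, (((kernelNorm K * klCoeff lam p : ℝ) : ℂ) * ((kernelNorm K * klCoeff lam q : ℝ) : ℂ)) *
        (Z p.1 p.2 ω * conj (Z q.1 q.2 ω)) ∂P := by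
    refine integral_congr_ae ?_
    filter_upwards [ae_inner_klSeries hZ e h0 hs K] with ω hω
    rw [← inner_conj_symm (klSeries K e lam Z ω), hω, hω, map_mul, Complex.conj_ofReal]
    ring
  rw [h1, integral_const_mul, hZ.integral_mul_conj]
  by_cases h : p = q
  · subst h
    rw [if_pos rfl, if_pos rfl, ← klCoeff_sq h0]
    push_cast
    ring
  · rw [if_neg h, if_neg (fun hh => h hh), mul_zero]

theorem crossCov_klSeries_apply (q : ι × ι) :
    crossCov P (klSeries K e lam Z) (klSeries K e lam Z) (HS.outerBasis e q)
      = ((kernelNorm K ^ 2 * (lam q.1 * lam q.2) : ℝ) : ℂ) • HS.outerBasis e q := by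
  classical
  refine HilbertBasis.ext_inner (HS.outerBasis e) fun p => ?_
  rw [inner_crossCov_klSeries hZ e h0 hs K, inner_smul_right,
    orthonormal_iff_ite.mp (HS.outerBasis e).orthonormal p q]
  split_ifs <;> simp

/-- The terms are summable in operator norm because `∑ λᵢλⱼ < ∞`, and the sum agrees with the
covariance on every basis vector. -/
theorem hasSum_crossCov_klSeries :
    HasSum (fun p : ι × ι => ((kernelNorm K ^ 2 * (lam p.1 * lam p.2) : ℝ) : ℂ) •
      InnerProductSpace.rankOne ℂ (HS.outer (e p.1) (e p.2)) (HS.outer (e p.1) (e p.2)))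
      (crossCov P (klSeries K e lam Z) (klSeries K e lam Z)) := by
  classical
  have hsum : Summable fun p : ι × ι => ((kernelNorm K ^ 2 * (lam p.1 * lam p.2) : ℝ) : ℂ) •
      InnerProductSpace.rankOne ℂ (HS.outer (e p.1) (e p.2)) (HS.outer (e p.1) (e p.2)) := by
    refine Summable.of_norm (((hs.mul_of_nonneg hs h0 h0).mul_left (kernelNorm K ^ 2)).congr
      fun p => ?_)
    have h1 : ‖HS.outer (e p.1) (e p.2)‖ = 1 := by
      rw [← HS.outerBasis_apply]
      exact (HS.outerBasis e).orthonormal.1 p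
    rw [norm_smul, InnerProductSpace.norm_rankOne, h1, Complex.norm_real, Real.norm_eq_abs,
      abs_of_nonneg (mul_nonneg (sq_nonneg _) (mul_nonneg (h0 _) (h0 _)))]
    ring
  have heq : ∑' p : ι × ι, ((kernelNorm K ^ 2 * (lam p.1 * lam p.2) : ℝ) : ℂ) •
      InnerProductSpace.rankOne ℂ (HS.outer (e p.1) (e p.2)) (HS.outer (e p.1) (e p.2))
      = crossCov P (klSeries K e lam Z) (klSeries K e lam Z) := by
    refine HilbertBasis.ext_clm (HS.outerBasis e) fun q => ?_
    rw [crossCov_klSeries_apply hZ e h0 hs K]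
    have h1 := hsum.hasSum.mapL (ContinuousLinearMap.apply ℂ (HS H) (HS.outerBasis e q))
    refine h1.unique ?_
    have h2 := hasSum_single (f := fun p : ι × ι => ContinuousLinearMap.apply ℂ (HS H)
      (HS.outerBasis e q) (((kernelNorm K ^ 2 * (lam p.1 * lam p.2) : ℝ) : ℂ) •
      InnerProductSpace.rankOne ℂ (HS.outer (e p.1) (e p.2)) (HS.outer (e p.1) (e p.2)))) q
      fun p hp => by
        rw [ContinuousLinearMap.apply_apply, smul_apply, InnerProductSpace.rankOne_apply,
          ← HS.outerBasis_apply, (HS.outerBasis e).orthonormal.2 hp, zero_smul, smul_zero]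
    convert! h2 using 1
    rw [ContinuousLinearMap.apply_apply, smul_apply, InnerProductSpace.rankOne_apply,
      ← HS.outerBasis_apply, inner_self_eq_norm_sq_to_K, (HS.outerBasis e).orthonormal.1 q]
    simp
  exact heq ▸ hsum.hasSum

/-- The series is almost surely self-adjoint: conjugating a term exchanges its two indices, and
unconditional summability permits this exchange in the sum. -/
theorem ae_conj_inner_klSeries :
    ∀ᵐ ω ∂P, ∀ u v, conj ⟪HS.outer u v, klSeries K e lam Z ω⟫_ℂ
      = ⟪HS.outer v u, klSeries K e lam Z ω⟫_ℂ := by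
  filter_upwards [ae_summable_klTerm hZ e h0 hs] with ω hω u v
  have h1 : ∀ u v, HasSum (fun p => ⟪HS.outer u v, klTerm e lam Z ω p⟫_ℂ)
      ⟪HS.outer u v, ∑' p, klTerm e lam Z ω p⟫_ℂ := fun u v =>
    hω.hasSum.mapL (innerSL ℂ (HS.outer u v))
  have h2 : HasSum (fun p => conj ⟪HS.outer u v, klTerm e lam Z ω p⟫_ℂ)
      (conj ⟪HS.outer u v, ∑' p, klTerm e lam Z ω p⟫_ℂ) :=
    (h1 u v).map (starRingEnd ℂ) Complex.continuous_conj
  have h3 := (Equiv.prodComm ι ι).hasSum_iff.mpr (h1 v u)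
  have h4 : conj ⟪HS.outer u v, ∑' p, klTerm e lam Z ω p⟫_ℂ
      = ⟪HS.outer v u, ∑' p, klTerm e lam Z ω p⟫_ℂ := by
    refine h2.unique ?_
    convert! h3 using 1
    ext p
    simp only [Function.comp_apply, klTerm, Equiv.prodComm_apply, Prod.fst_swap, Prod.snd_swap,
      inner_smul_right, HS.inner_outer_outer, map_mul, Complex.conj_ofReal, inner_conj_symm]
    rw [hZ.hermitian p.1 p.2, mul_comm (lam p.2)]
    ring
  rw [klSeries, inner_smul_right, inner_smul_right, map_mul, Complex.conj_ofReal, h4]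

end KarhunenLoeve

end FunctionalCLT

namespace FunctionalCLT

/-! ### Complex quadratic forms in Gaussian variables -/

section ComplexQuadraticForm

variable {I : Type*} [Fintype I]

/-- Schur's test, from `x y ≤ (x² + y²)/2`. It controls both the coefficient matrix and the
covariance matrix by their row and column sums. -/
theorem sum_sum_mul_le_of_row_col {m : I → I → ℝ} {α : ℝ} (h0 : ∀ p q, 0 ≤ m p q)
    (hrow : ∀ p, ∑ q, m p q ≤ α) (hcol : ∀ q, ∑ p, m p q ≤ α) (x : I → ℝ) :
    ∑ p, ∑ q, m p q * (x p * x q) ≤ α * ∑ p, x p ^ 2 := by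
  have h1 : ∑ p, ∑ q, m p q * x p ^ 2 ≤ α * ∑ p, x p ^ 2 := by
    rw [Finset.mul_sum]
    refine Finset.sum_le_sum fun p _ => ?_
    rw [← Finset.sum_mul]
    exact mul_le_mul_of_nonneg_right (hrow p) (sq_nonneg _)
  have h2 : ∑ p, ∑ q, m p q * x q ^ 2 ≤ α * ∑ p, x p ^ 2 := by
    rw [Finset.sum_comm, Finset.mul_sum]
    refine Finset.sum_le_sum fun p _ => ?_
    rw [← Finset.sum_mul]
    exact mul_le_mul_of_nonneg_right (hcol p) (sq_nonneg _)
  have h3 : ∑ p, ∑ q, m p q * (x p * x q)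
      ≤ ((∑ p, ∑ q, m p q * x p ^ 2) + ∑ p, ∑ q, m p q * x q ^ 2) / 2 := by
    rw [← Finset.sum_add_distrib, Finset.sum_div]
    refine Finset.sum_le_sum fun p _ => ?_
    rw [← Finset.sum_add_distrib, Finset.sum_div]
    refine Finset.sum_le_sum fun q _ => ?_
    nlinarith [mul_nonneg (h0 p q) (sq_nonneg (x p - x q))]
  linarith

theorem inner_real_euclidean (x y : EuclideanSpace ℂ I) :
    ⟪x, y⟫_ℝ = (∑ p, conj (x p) * y p).re := by
  rw [PiLp.inner_apply, Complex.re_sum]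
  refine Finset.sum_congr rfl fun p _ => ?_
  rw [Complex.inner, mul_comm]

/-- The quadratic form `∑ M p q gₚ conj(g_q)` comes from this linear map. -/
noncomputable def kernelMap (M : I → I → ℂ) : EuclideanSpace ℂ I →ₗ[ℝ] EuclideanSpace ℂ I where
  toFun g := WithLp.toLp 2 fun q => ∑ p, M p q * g p
  map_add' g h := by
    ext q
    simp [mul_add, Finset.sum_add_distrib]
  map_smul' c g := by
    ext q
    simp only [PiLp.smul_apply, Complex.real_smul, RingHom.id_apply, Finset.mul_sum]
    exact Finset.sum_congr rfl fun p _ => by ring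

theorem inner_kernelMap (M : I → I → ℂ) (g : EuclideanSpace ℂ I) :
    ⟪kernelMap M g, g⟫_ℝ = (∑ p, ∑ q, M p q * (g p * conj (g q))).re := by
  rw [real_inner_comm, inner_real_euclidean, Finset.sum_comm]
  congr 1
  refine Finset.sum_congr rfl fun q _ => ?_
  change conj (g q) * ∑ p, M p q * g p = _
  rw [Finset.mul_sum]
  exact Finset.sum_congr rfl fun p _ => by ring

theorem norm_sum_sum_le {M : I → I → ℂ} {α : ℝ} (hrow : ∀ p, ∑ q, ‖M p q‖ ≤ α)
    (hcol : ∀ q, ∑ p, ‖M p q‖ ≤ α) (g : EuclideanSpace ℂ I) :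
    ‖∑ p, ∑ q, M p q * (g p * conj (g q))‖ ≤ α * ‖g‖ ^ 2 := by
  rw [EuclideanSpace.norm_sq_eq]
  refine le_trans ?_ (sum_sum_mul_le_of_row_col (fun p q => norm_nonneg (M p q)) hrow hcol
    fun p => ‖g p‖)
  refine (norm_sum_le _ _).trans (Finset.sum_le_sum fun p _ => ?_)
  refine (norm_sum_le _ _).trans (Finset.sum_le_sum fun q _ => ?_)
  rw [norm_mul, norm_mul, RCLike.norm_conj]

variable {Ω : Type*} [MeasurableSpace Ω] {P : Measure Ω} {V : Submodule ℝ (Ω → ℝ)}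
  (hV : IsGaussianSpace V P) {g : I → Ω → ℂ} (hg : ∀ p, g p ∈ complexify V)
include hV hg

theorem aemeasurable_toLp : AEMeasurable (fun ω => WithLp.toLp 2 fun p => g p ω) P := by
  have h1 : AEMeasurable (fun ω p => g p ω) P := aemeasurable_pi_lambda _ fun p =>
    (hV.memLp (hg p) (p := 1) (by norm_num)).aestronglyMeasurable.aemeasurable
  exact (PiLp.continuous_toLp 2 fun _ : I => ℂ).measurable.comp_aemeasurable h1

omit hV [MeasurableSpace Ω] in
theorem apply_toLp_mem (l : EuclideanSpace ℂ I →L[ℝ] ℝ) :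
    (fun ω => l (WithLp.toLp 2 fun p => g p ω)) ∈ V := by
  classical
  have e : (fun ω => l (WithLp.toLp 2 fun p => g p ω)) = ∑ p,
      ((l (EuclideanSpace.single p 1)) • (fun ω => (g p ω).re)
        + (l (EuclideanSpace.single p Complex.I)) • fun ω => (g p ω).im) := by
    ext ω
    have h1 : (WithLp.toLp 2 fun p => g p ω : EuclideanSpace ℂ I) = ∑ p,
        ((g p ω).re • EuclideanSpace.single p (1 : ℂ)
          + (g p ω).im • EuclideanSpace.single p Complex.I) := by
      ext q
      simp only [WithLp.ofLp_sum, Finset.sum_apply, PiLp.add_apply, PiLp.smul_apply, PiLp.single_apply]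
      rw [Finset.sum_eq_single q]
      · simp
      · intro p _ hp
        simp [hp.symm]
      · simp
    rw [h1, map_sum, Finset.sum_apply]
    refine Finset.sum_congr rfl fun p _ => ?_
    rw [map_add, map_smul, map_smul]
    simp only [Pi.add_apply, Pi.smul_apply, smul_eq_mul]
    ring
  rw [e]
  exact V.sum_mem fun p _ => V.add_mem (V.smul_mem _ (hg p).1) (V.smul_mem _ (hg p).2)

theorem hasGaussianLaw_toLp [IsProbabilityMeasure P] :
    HasGaussianLaw (fun ω => (WithLp.toLp 2 fun p => g p ω : EuclideanSpace ℂ I)) P := by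
  have hm := aemeasurable_toLp hV hg
  refine ⟨isGaussian_of_map_eq_gaussianReal fun l => ?_⟩
  rw [AEMeasurable.map_map_of_aemeasurable l.continuous.measurable.aemeasurable hm]
  exact ⟨_, _, (hV.hasGaussianLaw _ (apply_toLp_mem hg l)).map_eq_gaussianReal⟩

theorem integral_toLp [IsProbabilityMeasure P] :
    ∫ ω, (WithLp.toLp 2 fun p => g p ω : EuclideanSpace ℂ I) ∂P = 0 := by
  have hi := (hasGaussianLaw_toLp hV hg).integrable
  refine ext_inner_left ℝ fun v => ?_
  rw [← integral_inner hi, inner_zero_right]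
  exact hV.integral_eq_zero _ (apply_toLp_mem hg (innerSL ℝ v))

/-- The real inner product is a real part, so its square is at most the squared modulus of the
complex one. The mean of the latter is a quadratic form of the covariance matrix, to which Schur's
test applies. -/
theorem integral_inner_toLp_sq_le {s : ℝ}
    (hrow : ∀ p, ∑ q, ‖∫ ω, g p ω * conj (g q ω) ∂P‖ ≤ s)
    (hcol : ∀ q, ∑ p, ‖∫ ω, g p ω * conj (g q ω) ∂P‖ ≤ s) (v : EuclideanSpace ℂ I) :
    ∫ ω, ⟪v, WithLp.toLp 2 fun p => g p ω⟫_ℝ ^ 2 ∂P ≤ s * ‖v‖ ^ 2 := by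
  have hi : ∀ p q, Integrable (fun ω => g p ω * conj (g q ω)) P := fun p q =>
    hV.integrable_mul (hg p) (conj_mem_complexify (hg q))
  have e1 : ∀ ω, ((‖∑ p, conj (v p) * g p ω‖ ^ 2 : ℝ) : ℂ)
      = ∑ p, ∑ q, (conj (v p) * v q) * (g p ω * conj (g q ω)) := fun ω => by
    rw [Complex.ofReal_pow, ← Complex.mul_conj', map_sum, Finset.sum_mul_sum]
    refine Finset.sum_congr rfl fun p _ => Finset.sum_congr rfl fun q _ => ?_
    rw [map_mul, Complex.conj_conj]
    ring
  have hi2 : Integrable (fun ω => ∑ p, ∑ q, (conj (v p) * v q) * (g p ω * conj (g q ω))) P :=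
    integrable_finsetSum _ fun p _ => integrable_finsetSum _ fun q _ => (hi p q).const_mul _
  have hi3 : Integrable (fun ω => ‖∑ p, conj (v p) * g p ω‖ ^ 2) P := by
    refine (hi2.re).congr (ae_of_all _ fun ω => ?_)
    change (∑ p, ∑ q, (conj (v p) * v q) * (g p ω * conj (g q ω))).re = _
    rw [← e1, Complex.ofReal_re]
  have h1 : ∫ ω, ⟪v, WithLp.toLp 2 fun p => g p ω⟫_ℝ ^ 2 ∂P
      ≤ ∫ ω, ‖∑ p, conj (v p) * g p ω‖ ^ 2 ∂P := by
    refine integral_mono_of_nonneg (ae_of_all _ fun ω => sq_nonneg _) hi3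
      (ae_of_all _ fun ω => ?_)
    change ⟪v, WithLp.toLp 2 fun p => g p ω⟫_ℝ ^ 2 ≤ _
    rw [inner_real_euclidean, ← sq_abs]
    exact pow_le_pow_left₀ (abs_nonneg _) (Complex.abs_re_le_norm _) 2
  refine h1.trans ?_
  have h2 : ((∫ ω, ‖∑ p, conj (v p) * g p ω‖ ^ 2 ∂P : ℝ) : ℂ)
      = ∑ p, ∑ q, (conj (v p) * v q) * ∫ ω, g p ω * conj (g q ω) ∂P := by
    rw [← integral_complex_ofReal]
    simp_rw [e1]
    rw [integral_finsetSum _ fun p _ => integrable_finsetSum _ fun q _ => (hi p q).const_mul _]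
    refine Finset.sum_congr rfl fun p _ => ?_
    rw [integral_finsetSum _ fun q _ => (hi p q).const_mul _]
    exact Finset.sum_congr rfl fun q _ => integral_const_mul _ _
  have h3 : ∫ ω, ‖∑ p, conj (v p) * g p ω‖ ^ 2 ∂P
      = ‖∑ p, ∑ q, (conj (v p) * v q) * ∫ ω, g p ω * conj (g q ω) ∂P‖ := by
    rw [← h2, Complex.norm_real, Real.norm_eq_abs,
      abs_of_nonneg (integral_nonneg fun ω => by positivity)]
  rw [h3]
  have h4 := norm_sum_sum_le (M := fun p q => ∫ ω, g p ω * conj (g q ω) ∂P) hrow hcol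
    (WithLp.toLp 2 fun p => conj (v p))
  have h5 : ‖(WithLp.toLp 2 fun p => conj (v p) : EuclideanSpace ℂ I)‖ ^ 2 = ‖v‖ ^ 2 := by
    simp [EuclideanSpace.norm_sq_eq]
  rw [h5] at h4
  refine le_trans (le_of_eq ?_) h4
  congr 1
  refine Finset.sum_congr rfl fun p _ => Finset.sum_congr rfl fun q _ => ?_
  rw [Complex.conj_conj]
  ring

/-- Quadratic central limit theorem for complex quadratic forms in Gaussian variables. -/
theorem norm_integral_exp_quadratic_sub_le [IsProbabilityMeasure P] {M : I → I → ℂ} {α s η : ℝ}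
    (hα : 0 ≤ α) (hMrow : ∀ p, ∑ q, ‖M p q‖ ≤ α) (hMcol : ∀ q, ∑ p, ‖M p q‖ ≤ α)
    (hrow : ∀ p, ∑ q, ‖∫ ω, g p ω * conj (g q ω) ∂P‖ ≤ s)
    (hcol : ∀ q, ∑ p, ‖∫ ω, g p ω * conj (g q ω) ∂P‖ ≤ s)
    (hη : ∀ μ : ℝ, |μ| ≤ α * s → ‖chiSqCharFun μ - Complex.exp (-(μ ^ 2 : ℝ))‖ ≤ η * μ ^ 2)
    {Q : Ω → ℝ} (hQ : ∀ ω, Q ω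
      = (∑ p, ∑ q, M p q * (g p ω * conj (g q ω) - ∫ ω', g p ω' * conj (g q ω') ∂P)).re) :
    ‖∫ ω, Complex.exp (Complex.I * (Q ω : ℝ)) ∂P
      - Complex.exp (-((∫ ω, Q ω ^ 2 ∂P) / 2 : ℝ))‖ ≤ η * ((∫ ω, Q ω ^ 2 ∂P) / 2) := by
  have h := norm_charFun_quadratic_sub_le (hasGaussianLaw_toLp hV hg) (integral_toLp hV hg)
    (kernelMap M) hα (fun u => by
      rw [inner_kernelMap]
      exact (Complex.abs_re_le_norm _).trans (norm_sum_sum_le hMrow hMcol u))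
    (integral_inner_toLp_sq_le hV hg hrow hcol) hη
  have hi : ∀ p q, Integrable (fun ω => g p ω * conj (g q ω)) P := fun p q =>
    hV.integrable_mul (hg p) (conj_mem_complexify (hg q))
  have e1 : ∫ ω, ⟪kernelMap M (WithLp.toLp 2 fun p => g p ω), WithLp.toLp 2 fun p => g p ω⟫_ℝ ∂P
      = (∑ p, ∑ q, M p q * ∫ ω', g p ω' * conj (g q ω') ∂P).re := by
    simp_rw [inner_kernelMap]
    have hi2 : Integrable (fun ω => ∑ p, ∑ q, M p q * (g p ω * conj (g q ω))) P :=
      integrable_finsetSum _ fun p _ => integrable_finsetSum _ fun q _ => (hi p q).const_mul _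
    have h2 : ∫ ω, (∑ p, ∑ q, M p q * (g p ω * conj (g q ω))).re ∂P
        = (∫ ω, ∑ p, ∑ q, M p q * (g p ω * conj (g q ω)) ∂P).re := integral_re hi2
    rw [h2, integral_finsetSum _ fun p _ => integrable_finsetSum _ fun q _ => (hi p q).const_mul _]
    congr 1
    refine Finset.sum_congr rfl fun p _ => ?_
    rw [integral_finsetSum _ fun q _ => (hi p q).const_mul _]
    exact Finset.sum_congr rfl fun q _ => integral_const_mul _ _
  have e2 : ∀ ω, ⟪kernelMap M (WithLp.toLp 2 fun p => g p ω), WithLp.toLp 2 fun p => g p ω⟫_ℝ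
      - ∫ ω, ⟪kernelMap M (WithLp.toLp 2 fun p => g p ω), WithLp.toLp 2 fun p => g p ω⟫_ℝ ∂P
      = Q ω := fun ω => by
    rw [e1, inner_kernelMap, hQ, ← Complex.sub_re, ← Finset.sum_sub_distrib]
    congr 1
    refine Finset.sum_congr rfl fun p _ => ?_
    rw [← Finset.sum_sub_distrib]
    exact Finset.sum_congr rfl fun q _ => by ring
  simp_rw [e2] at h
  exact h

end ComplexQuadraticForm

end FunctionalCLT

namespace FunctionalCLT

/-! ### Real functionals of Hermitian data -/

section HermitianMoments

variable {F : Type*} [Fintype F]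

/-- The Hermitian part of a matrix. -/
noncomputable def hermPart (d : F × F → ℂ) (p : F × F) : ℂ := (d p + conj (d p.swap)) / 2

/-- For Hermitian data, a real functional equals the complex functional with Hermitian coefficients.
Its square then involves only the moments `W p · conj (W q)`, for which the limit is known. -/
theorem sum_hermPart_mul (d W : F × F → ℂ) (hW : ∀ p, conj (W p) = W p.swap) :
    ∑ p, conj (hermPart d p) * W p = ((∑ p, conj (d p) * W p).re : ℂ) := by
  have h1 : ∑ p, d p.swap * W p = conj (∑ p, conj (d p) * W p) := by
    rw [map_sum, ← (Equiv.prodComm F F).sum_comp]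
    refine Finset.sum_congr rfl fun p _ => ?_
    rw [map_mul, Complex.conj_conj, hW]
    rfl
  have h2 : ∑ p, conj (hermPart d p) * W p
      = ((∑ p, conj (d p) * W p) + ∑ p, d p.swap * W p) / 2 := by
    rw [← Finset.sum_add_distrib, Finset.sum_div]
    refine Finset.sum_congr rfl fun p _ => ?_
    simp only [hermPart, map_div₀, map_add, Complex.conj_conj, map_ofNat]
    ring
  rw [h2, h1, Complex.add_conj]
  push_cast
  ring

variable {Ω : Type*} [MeasurableSpace Ω] {P : Measure Ω}

theorem integral_re_sum_sq (d : F × F → ℂ) {W : F × F → Ω → ℂ}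
    (hW : ∀ᵐ ω ∂P, ∀ p, conj (W p ω) = W p.swap ω)
    (hi : ∀ p q, Integrable (fun ω => W p ω * conj (W q ω)) P) :
    ∫ ω, (∑ p, conj (d p) * W p ω).re ^ 2 ∂P
      = (∑ p, ∑ q, (conj (hermPart d p) * hermPart d q) * ∫ ω, W p ω * conj (W q ω) ∂P).re := by
  have h1 : ((∫ ω, (∑ p, conj (d p) * W p ω).re ^ 2 ∂P : ℝ) : ℂ)
      = ∑ p, ∑ q, (conj (hermPart d p) * hermPart d q) * ∫ ω, W p ω * conj (W q ω) ∂P := by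
    rw [← integral_complex_ofReal]
    have h2 : ∫ ω, (((∑ p, conj (d p) * W p ω).re ^ 2 : ℝ) : ℂ) ∂P = ∫ ω, ∑ p, ∑ q,
        (conj (hermPart d p) * hermPart d q) * (W p ω * conj (W q ω)) ∂P := by
      refine integral_congr_ae (hW.mono fun ω hω => ?_)
      have h3 := sum_hermPart_mul d (fun p => W p ω) hω
      change (((∑ p, conj (d p) * W p ω).re ^ 2 : ℝ) : ℂ) = _
      rw [Complex.ofReal_pow, sq]
      -- The functional is real, so one of the two factors may be conjugated before expanding.
      nth_rw 2 [← Complex.conj_ofReal]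
      rw [← h3, map_sum, Finset.sum_mul_sum]
      refine Finset.sum_congr rfl fun p _ => Finset.sum_congr rfl fun q _ => ?_
      rw [map_mul, Complex.conj_conj]
      ring
    rw [h2, integral_finsetSum _ fun p _ => integrable_finsetSum _ fun q _ => (hi p q).const_mul _]
    refine Finset.sum_congr rfl fun p _ => ?_
    rw [integral_finsetSum _ fun q _ => (hi p q).const_mul _]
    exact Finset.sum_congr rfl fun q _ => integral_const_mul _ _
  rw [← h1, Complex.ofReal_re]

end HermitianMoments

/-! ### Row and column sums over lags -/

section RowSums

theorem sum_sub_left_le {f : ℤ → ℝ} {C : ℝ} (h : ∀ S : Finset ℤ, ∑ a ∈ S, f a ≤ C) (S : Finset ℤ)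
    (i : ℤ) : ∑ j : S, f (i - j) ≤ C := by
  classical
  rw [Finset.sum_coe_sort S fun j => f (i - j)]
  have h1 := h (S.image fun j => i - j)
  rwa [Finset.sum_image (by intro a _ b _ h; simpa using h)] at h1

theorem sum_sub_right_le {f : ℤ → ℝ} {C : ℝ} (h : ∀ S : Finset ℤ, ∑ a ∈ S, f a ≤ C) (S : Finset ℤ)
    (j : ℤ) : ∑ i : S, f (i - j) ≤ C := by
  classical
  rw [Finset.sum_coe_sort S fun i => f (i - j)]
  have h1 := h (S.image fun i => i - j)
  rwa [Finset.sum_image (by intro a _ b _ h; simpa using h)] at h1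

end RowSums

/-! ### Finite-dimensional limits of the statistic -/

section FiniteDimensional

variable {H : Type*} [NormedAddCommGroup H] [InnerProductSpace ℂ H] [CompleteSpace H]
  [TopologicalSpace.SeparableSpace H] [MeasurableSpace H] [BorelSpace H]
  {Ω : Type*} [MeasurableSpace Ω] {P : Measure Ω} [IsProbabilityMeasure P]
  {κ κ' : Type*} {r : HilbertBasis κ ℂ H} {e₀ : HilbertBasis κ' ℂ H}
  {X : ℝ → Ω → H} (hX : IsStationaryGaussian P r X) {K : ℝ → ℝ} (hK : IsCLTKernel K)
  {δ Δ L : ℕ → ℝ} {δinf θ : ℝ} (hCLT : CLTCondition P r e₀ X δ Δ L δinf θ)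
include hX

-- The statistic is self-adjoint: conjugating the phase reverses the lag, under which the kernel is
-- even.
omit [IsProbabilityMeasure P] in
theorem conj_inner_outer_cltStat (hK : ∀ x, K (-x) = K x) (n : ℕ) (u v : H) (ω : Ω) :
    conj ⟪HS.outer u v, cltStat P X K δ Δ θ n ω⟫_ℂ
      = ⟪HS.outer v u, cltStat P X K δ Δ θ n ω⟫_ℂ := by
  rw [inner_outer_cltStat hX, inner_outer_cltStat hX, map_mul, Complex.conj_ofReal,
    conj_centeredForm]
  congr 1
  unfold centeredForm
  rw [Finset.sum_comm]
  refine Finset.sum_congr rfl fun i _ => Finset.sum_congr rfl fun j _ => ?_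
  have h1 : conj (phase θ (δ n) ^ (j - i)) = phase θ (δ n) ^ (i - j) := by
    have h2 : conj (phase θ (δ n)) = (phase θ (δ n))⁻¹ := by
      rw [Complex.inv_def, Complex.normSq_eq_norm_sq, norm_phase]
      simp
    rw [map_zpow₀, h2, inv_zpow', neg_sub]
  have h3 : gridKernel K (δ n) (Δ n) (j - i) = gridKernel K (δ n) (Δ n) (i - j) := by
    unfold gridKernel
    rw [← hK]
    congr 1
    push_cast
    ring
  simp only [map_mul, Complex.conj_ofReal, Complex.conj_conj, h1, h3]
  simp_rw [mul_comm (conj (gridCoord X (δ n) u j _)) (gridCoord X (δ n) v i _)]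

variable {F : Type*} [Fintype F] (a : F → κ')

/-- The scale of a quadratic form with sampled kernel. -/
noncomputable def formScale (δ Δ : ℝ) (n : ℕ) : ℝ := Real.sqrt (n * δ / Δ) * (δ / (2 * Real.pi * n))

-- Indexing the Gaussian vector by pairs of a grid time and a direction gathers all coordinates into
-- a single quadratic form.
omit [IsProbabilityMeasure P] in
theorem re_sum_inner_cltStat (n : ℕ) (d : F × F → ℂ) (ω : Ω) :
    (∑ p, conj (d p) * ⟪HS.outer (e₀ (a p.1)) (e₀ (a p.2)), cltStat P X K δ Δ θ n ω⟫_ℂ).re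
      = (∑ p : Finset.Icc (1 : ℤ) n × F, ∑ q : Finset.Icc (1 : ℤ) n × F,
        ((formScale (δ n) (Δ n) n : ℂ) * (phase θ (δ n) ^ ((p.1 : ℤ) - q.1) *
          (gridKernel K (δ n) (Δ n) (p.1 - q.1) : ℂ)) * conj (d (p.2, q.2))) *
        (gridCoord X (δ n) (e₀ (a p.2)) p.1 ω * conj (gridCoord X (δ n) (e₀ (a q.2)) q.1 ω)
          - ∫ ω', gridCoord X (δ n) (e₀ (a p.2)) p.1 ω' *
            conj (gridCoord X (δ n) (e₀ (a q.2)) q.1 ω') ∂P)).re := by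
  congr 1
  simp_rw [inner_outer_cltStat hX, centeredForm, Fintype.sum_prod_type]
  simp_rw [← Finset.sum_coe_sort (Finset.Icc (1 : ℤ) n), Finset.mul_sum]
  rw [Finset.sum_congr rfl fun x _ => Finset.sum_comm]
  rw [Finset.sum_comm]
  refine Finset.sum_congr rfl fun i _ => Finset.sum_congr rfl fun x _ => ?_
  rw [Finset.sum_comm]
  refine Finset.sum_congr rfl fun j _ => Finset.sum_congr rfl fun y _ => ?_
  rw [formScale]
  ring

omit [Fintype F] [TopologicalSpace.SeparableSpace H] [MeasurableSpace H] [BorelSpace H]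
  [IsProbabilityMeasure P] [MeasurableSpace Ω] hX [CompleteSpace H] in
theorem formScale_nonneg {δ Δ : ℝ} (hδ : 0 < δ) (n : ℕ) : 0 ≤ formScale δ Δ n := by
  unfold formScale
  positivity

omit [TopologicalSpace.SeparableSpace H] [MeasurableSpace H] [BorelSpace H]
  [IsProbabilityMeasure P] [MeasurableSpace Ω] hX [CompleteSpace H] in
/-- Row and column sums of a matrix built from a function of the lag. -/
theorem sum_lag_row_le {S : Finset ℤ} {k : ℤ → ℝ} {C c : ℝ} (hC : 0 ≤ C) (hc : 0 ≤ c)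
    (hk : ∀ T : Finset ℤ, ∑ a ∈ T, k a ≤ C) {D : F × F → ℝ} (hD : ∀ p, 0 ≤ D p) (p : S × F) :
    ∑ q : S × F, c * k (p.1 - q.1) * D (p.2, q.2) ≤ c * C * ∑ p, D p := by
  rw [Fintype.sum_prod_type, Finset.sum_comm]
  have h1 := sum_sub_left_le hk S p.1
  calc ∑ y, ∑ j : S, c * k (p.1 - j) * D (p.2, y)
      = ∑ y, (c * ∑ j : S, k (p.1 - j)) * D (p.2, y) := by
        refine Finset.sum_congr rfl fun y _ => ?_
        rw [Finset.mul_sum, Finset.sum_mul]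
    _ ≤ ∑ y, c * C * D (p.2, y) :=
        Finset.sum_le_sum fun y _ => by
          have := hD (p.2, y)
          gcongr
    _ = c * C * ∑ y, D (p.2, y) := by rw [Finset.mul_sum]
    _ ≤ c * C * ∑ p, D p := by
        refine mul_le_mul_of_nonneg_left ?_ (by positivity)
        rw [Fintype.sum_prod_type]
        exact Finset.single_le_sum (f := fun x => ∑ y, D (x, y))
          (fun x _ => Finset.sum_nonneg fun y _ => hD _) (Finset.mem_univ p.2)

omit [TopologicalSpace.SeparableSpace H] [MeasurableSpace H] [BorelSpace H]
  [IsProbabilityMeasure P] [MeasurableSpace Ω] hX [CompleteSpace H] in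
theorem sum_lag_col_le {S : Finset ℤ} {k : ℤ → ℝ} {C c : ℝ} (hC : 0 ≤ C) (hc : 0 ≤ c)
    (hk : ∀ T : Finset ℤ, ∑ a ∈ T, k a ≤ C) {D : F × F → ℝ} (hD : ∀ p, 0 ≤ D p) (q : S × F) :
    ∑ p : S × F, c * k (p.1 - q.1) * D (p.2, q.2) ≤ c * C * ∑ p, D p := by
  rw [Fintype.sum_prod_type, Finset.sum_comm]
  have h1 := sum_sub_right_le hk S q.1
  calc ∑ y, ∑ j : S, c * k (j - q.1) * D (y, q.2)
      = ∑ y, (c * ∑ j : S, k (j - q.1)) * D (y, q.2) := by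
        refine Finset.sum_congr rfl fun y _ => ?_
        rw [Finset.mul_sum, Finset.sum_mul]
    _ ≤ ∑ y, c * C * D (y, q.2) :=
        Finset.sum_le_sum fun y _ => by
          have := hD (y, q.2)
          gcongr
    _ = c * C * ∑ y, D (y, q.2) := by rw [Finset.mul_sum]
    _ ≤ c * C * ∑ p, D p := by
        refine mul_le_mul_of_nonneg_left ?_ (by positivity)
        rw [Fintype.sum_prod_type]
        exact Finset.sum_le_sum fun x _ => Finset.single_le_sum (f := fun y => D (x, y))
          (fun y _ => hD _) (Finset.mem_univ q.2)

include hK hCLT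

/-- Gaussian approximation of a real linear functional of the statistic, with the quality of the
approximation controlled by `ρ`. -/
theorem exists_tendsto_norm_integral_exp_sub_le (d : F × F → ℂ) :
    ∃ ρ : ℕ → ℝ, Tendsto ρ atTop (𝓝 0) ∧ ∀ᶠ n in atTop, ∀ η : ℝ,
      (∀ μ : ℝ, |μ| ≤ ρ n → ‖chiSqCharFun μ - Complex.exp (-(μ ^ 2 : ℝ))‖ ≤ η * μ ^ 2) →
      ∀ Q : Ω → ℝ, (∀ ω, Q ω = (∑ p, conj (d p) *
        ⟪HS.outer (e₀ (a p.1)) (e₀ (a p.2)), cltStat P X K δ Δ θ n ω⟫_ℂ).re) →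
      ‖∫ ω, Complex.exp (Complex.I * (Q ω : ℝ)) ∂P
        - Complex.exp (-((∫ ω, Q ω ^ 2 ∂P) / 2 : ℝ))‖ ≤ η * ((∫ ω, Q ω ^ 2 ∂P) / 2) := by
  have hs := hCLT.isScaling
  have hV := hX.isGaussianSpace
  obtain ⟨M, V, R, hR, hM, hsupp, hVar, hk⟩ := hK.exists_isSampledKernel
  have hk' : ∀ n, IsSampledKernel (gridKernel K (δ n) (Δ n)) M V ⌈R / (δ n / Δ n)⌉₊ :=
    fun n => hk _ (hs.step_pos n)
  have hM0 : 0 ≤ M := (hk' 0).bound_nonneg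
  have hu : ∀ x, ‖e₀ x‖ = 1 := e₀.orthonormal.1
  choose B τ hB using fun p : F × F => hCLT.isLagBound_covLag (hu (a p.1)) (hu (a p.2))
  have hB0 : ∀ p, 0 ≤ B p := fun p => by simpa using (hB p).bdd 0 ∅
  set Dn := ∑ p, ‖d p‖ with hDn
  have hDn0 : 0 ≤ Dn := Finset.sum_nonneg fun p _ => norm_nonneg _
  set Bn := ∑ p, B p with hBn
  have hBn0 : 0 ≤ Bn := Finset.sum_nonneg fun p _ => hB0 p
  -- This dominates the product of the two Schur bounds: `c M (2N + 1) Dn` for the coefficients,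
  -- where `2N + 1 ≤ (2R + 3) Δ/δ`, and `Bn/δ` for the covariances. With `c = √(nδ/Δ) · δ/(2πn)` all
  -- scales combine into `(nδ/Δ)^{-1/2}`.
  refine ⟨fun n => (M * (2 * R + 3) * Dn * Bn / (2 * Real.pi)) * (Real.sqrt (n * δ n / Δ n))⁻¹,
    ?_, ?_⟩
  · have h1 := (tendsto_inv_atTop_zero.comp
      (Real.tendsto_sqrt_atTop.comp hs.domain_tendsto)).const_mul
      (M * (2 * R + 3) * Dn * Bn / (2 * Real.pi))
    rw [mul_zero] at h1
    exact h1
  filter_upwards [eventually_step_mul_le hs hR, eventually_ge_atTop 1] with n hn hn1 η hη Q hQ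
  have hδ := hs.grid_pos n
  have hΔ := hs.bandwidth_pos n
  have hn0 : (0 : ℝ) < n := by exact_mod_cast hn1
  set N := ⌈R / (δ n / Δ n)⌉₊ with hN
  set c := formScale (δ n) (Δ n) n with hcdef
  have hc0 : 0 ≤ c := formScale_nonneg hδ n
  have hrw := hQ
  simp_rw [re_sum_inner_cltStat hX a n d] at hrw
  have hnorm : ∀ p q : Finset.Icc (1 : ℤ) n × F,
      ‖(c : ℂ) * (phase θ (δ n) ^ ((p.1 : ℤ) - q.1) *
          (gridKernel K (δ n) (Δ n) (p.1 - q.1) : ℂ)) * conj (d (p.2, q.2))‖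
        = c * gridKernel K (δ n) (Δ n) (p.1 - q.1) * ‖d (p.2, q.2)‖ := fun p q => by
    rw [norm_mul, norm_mul, norm_mul, norm_zpow, norm_phase, one_zpow, one_mul, RCLike.norm_conj,
      Complex.norm_real, Complex.norm_real, Real.norm_of_nonneg hc0,
      Real.norm_of_nonneg ((hk' n).nonneg _)]
  have hγ : ∀ p q : Finset.Icc (1 : ℤ) n × F,
      ‖∫ ω, gridCoord X (δ n) (e₀ (a p.2)) p.1 ω * conj (gridCoord X (δ n) (e₀ (a q.2)) q.1 ω) ∂P‖
        = ‖covLag P X θ (δ n) (e₀ (a p.2)) (e₀ (a q.2)) (p.1 - q.1)‖ := fun p q => by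
    rw [integral_gridCoord_mul_conj hX, norm_covLag]
  have hMN0 : 0 ≤ M * (2 * N + 1) := by positivity
  have hlag : ∀ p : F × F, ∀ T : Finset ℤ,
      ∑ x ∈ T, ‖covLag P X θ (δ n) (e₀ (a p.1)) (e₀ (a p.2)) x‖ ≤ B p / δ n := fun p T => by
    rw [le_div_iff₀ hδ, mul_comm]
    exact (hB p).bdd n T
  have hrow : ∀ p : Finset.Icc (1 : ℤ) n × F, ∑ q : Finset.Icc (1 : ℤ) n × F,
      ‖covLag P X θ (δ n) (e₀ (a p.2)) (e₀ (a q.2)) (p.1 - q.1)‖ ≤ Bn / δ n := fun p => by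
    rw [Fintype.sum_prod_type, Finset.sum_comm, hBn, Finset.sum_div, Fintype.sum_prod_type]
    refine (Finset.sum_le_sum fun y _ => sum_sub_left_le (hlag (p.2, y)) _ p.1).trans ?_
    exact Finset.single_le_sum (f := fun x => ∑ y, B (x, y) / δ n)
      (fun x _ => Finset.sum_nonneg fun y _ => div_nonneg (hB0 _) hδ.le) (Finset.mem_univ p.2)
  have hcol : ∀ q : Finset.Icc (1 : ℤ) n × F, ∑ p : Finset.Icc (1 : ℤ) n × F,
      ‖covLag P X θ (δ n) (e₀ (a p.2)) (e₀ (a q.2)) (p.1 - q.1)‖ ≤ Bn / δ n := fun q => by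
    rw [Fintype.sum_prod_type, Finset.sum_comm, hBn, Finset.sum_div, Fintype.sum_prod_type]
    refine (Finset.sum_le_sum fun y _ => sum_sub_right_le (hlag (y, q.2)) _ q.1).trans ?_
    exact Finset.sum_le_sum fun x _ => Finset.single_le_sum (f := fun y => B (x, y) / δ n)
      (fun y _ => div_nonneg (hB0 _) hδ.le) (Finset.mem_univ q.2)
  refine norm_integral_exp_quadratic_sub_le hV
    (g := fun (p : Finset.Icc (1 : ℤ) n × F) ω => gridCoord X (δ n) (e₀ (a p.2)) p.1 ω)
    (fun p => gridCoord_mem _ _ _) (α := c * (M * (2 * N + 1)) * Dn) (s := Bn / δ n)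
    (by positivity) (fun p => ?_) (fun q => ?_) (fun p => ?_) (fun q => ?_) (fun μ hμ => hη μ ?_) hrw
  · exact le_of_eq_of_le (Finset.sum_congr rfl fun q _ => hnorm p q)
      (sum_lag_row_le hMN0 hc0 (hk' n).sum_le (fun p => norm_nonneg (d p)) p)
  · exact le_of_eq_of_le (Finset.sum_congr rfl fun p _ => hnorm p q)
      (sum_lag_col_le hMN0 hc0 (hk' n).sum_le (fun p => norm_nonneg (d p)) q)
  · exact le_of_eq_of_le (Finset.sum_congr rfl fun q _ => hγ p q) (hrow p)
  · exact le_of_eq_of_le (Finset.sum_congr rfl fun p _ => hγ p q) (hcol q)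
  · refine hμ.trans ?_
    set x := (n : ℝ) * δ n / Δ n with hx
    have hx0 : 0 < x := by positivity
    have hsq : Real.sqrt x * Real.sqrt x = x := Real.mul_self_sqrt hx0.le
    have hsx : 0 < Real.sqrt x := Real.sqrt_pos.mpr hx0
    have h1 : (2 * (N : ℝ) + 1) ≤ (2 * R + 3) * (Δ n / δ n) := by
      rw [← div_le_iff₀ (by positivity), div_div_eq_mul_div, mul_div_assoc, mul_comm]
      exact hn
    have h2 : c * (M * ((2 * R + 3) * (Δ n / δ n))) * Dn * (Bn / δ n)
        = M * (2 * R + 3) * Dn * Bn / (2 * Real.pi) * (Real.sqrt x)⁻¹ := by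
      have h3 : (Real.sqrt x)⁻¹ = Real.sqrt x * (Δ n / (n * δ n)) := by
        rw [inv_eq_iff_eq_inv, mul_inv, inv_div, ← hx]
        field_simp
        rw [sq, hsq]
      rw [h3, hcdef, formScale, ← hx]
      have := Real.pi_pos
      field_simp
    rw [← h2]
    gcongr

/-- The variances converge by the covariance limit, and the error of the Gaussian approximation is
at most `η` times half the variance, with `η` arbitrarily small since the spectral bound tends to
zero. -/
theorem tendsto_integral_exp_cltStat (hθ : 0 < δinf → θ ∈ Set.Icc (-(Real.pi / δinf)) (Real.pi / δinf))
    (hc : cIndicator δinf θ = 0) (d : F × F → ℂ) :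
    Tendsto (fun n => ∫ ω, Complex.exp (Complex.I * ((∑ p, conj (d p) *
      ⟪HS.outer (e₀ (a p.1)) (e₀ (a p.2)), cltStat P X K δ Δ θ n ω⟫_ℂ).re : ℝ)) ∂P) atTop
      (𝓝 (Complex.exp (-((∑ p, ∑ q, (conj (hermPart d p) * hermPart d q) *
        (((kernelNorm K ^ 2 : ℝ) : ℂ) * ⟪e₀ (a p.1), specDensity P X θ δinf (e₀ (a q.1))⟫_ℂ *
          conj ⟪e₀ (a p.2), specDensity P X θ δinf (e₀ (a q.2))⟫_ℂ)).re / 2 : ℝ)))) := by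
  have hs := hCLT.isScaling
  have hu : ∀ x, ‖e₀ x‖ = 1 := e₀.orthonormal.1
  obtain ⟨ρ, hρ, hbound⟩ := exists_tendsto_norm_integral_exp_sub_le hX hK hCLT a d
  set Q : ℕ → Ω → ℝ := fun n ω => (∑ p, conj (d p) *
      ⟪HS.outer (e₀ (a p.1)) (e₀ (a p.2)), cltStat P X K δ Δ θ n ω⟫_ℂ).re with hQ
  set v := (∑ p, ∑ q, (conj (hermPart d p) * hermPart d q) *
        (((kernelNorm K ^ 2 : ℝ) : ℂ) * ⟪e₀ (a p.1), specDensity P X θ δinf (e₀ (a q.1))⟫_ℂ *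
          conj ⟪e₀ (a p.2), specDensity P X θ δinf (e₀ (a q.2))⟫_ℂ)).re with hv
  have hvar : Tendsto (fun n => ∫ ω, Q n ω ^ 2 ∂P) atTop (𝓝 v) := by
    have h1 : ∀ n, ∫ ω, Q n ω ^ 2 ∂P = _ := fun n => integral_re_sum_sq d
      (W := fun p ω => ⟪HS.outer (e₀ (a p.1)) (e₀ (a p.2)), cltStat P X K δ Δ θ n ω⟫_ℂ)
      (ae_of_all _ fun ω p => conj_inner_outer_cltStat hX hK.even n _ _ ω)
      (fun p q => (integral_inner_cltStat_mul_conj hX hK.even θ n (hs.grid_pos n)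
        (hs.bandwidth_pos n) _ _ _ _).1)
    simp_rw [h1]
    refine (Complex.continuous_re.tendsto _).comp ?_
    refine tendsto_finsetSum _ fun p _ => tendsto_finsetSum _ fun q _ => ?_
    exact (tendsto_integral_inner_cltStat_mul_conj hCLT hX hK hθ hc (hu _) (hu _) (hu _)
      (hu _)).const_mul _
  have hexp : Tendsto (fun n => Complex.exp (-((∫ ω, Q n ω ^ 2 ∂P) / 2 : ℝ))) atTop
      (𝓝 (Complex.exp (-(v / 2 : ℝ)))) := by
    have hcont : Continuous fun t : ℝ => Complex.exp (-(t / 2 : ℝ)) := by fun_prop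
    exact (hcont.tendsto _).comp hvar
  have hdiff : Tendsto (fun n => ∫ ω, Complex.exp (Complex.I * (Q n ω : ℝ)) ∂P
      - Complex.exp (-((∫ ω, Q n ω ^ 2 ∂P) / 2 : ℝ))) atTop (𝓝 0) := by
    rw [Metric.tendsto_nhds]
    intro ε hε
    -- Eventually the variances stay below `v + 1`. The absolute value in the witness keeps the
    -- denominator positive without using the sign of `v`.
    obtain ⟨η, hη0, hηε⟩ : ∃ η > 0, η * ((v + 1) / 2) < ε := by
      refine ⟨ε / (|v + 1| / 2 + 1), by positivity, ?_⟩
      rw [div_mul_eq_mul_div, div_lt_iff₀ (by positivity)]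
      have := le_abs_self (v + 1)
      nlinarith
    obtain ⟨ε', hε', hchi⟩ := exists_norm_chiSqCharFun_sub_exp_le hη0
    filter_upwards [hbound, hρ.eventually_lt_const hε', hvar.eventually_lt_const (lt_add_one v)]
      with n h1 h2 h3
    rw [dist_zero_right]
    refine (h1 η (fun μ hμ => hchi μ (hμ.trans_lt h2)) (Q n) fun _ => rfl).trans_lt (lt_of_le_of_lt
      ?_ hηε)
    gcongr
  have h := hdiff.add hexp
  simp only [sub_add_cancel, zero_add] at h
  exact h

end FiniteDimensional

end FunctionalCLT

namespace FunctionalCLT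

/-! ### Convergence in distribution by truncation -/

section Truncation

variable {E : Type*} [NormedAddCommGroup E] [InnerProductSpace ℂ E] {J : Type*}
  (B : HilbertBasis J ℂ E)

/-- The projection onto the span of finitely many basis vectors. -/
noncomputable def truncate (S : Finset J) (x : E) : E := ∑ p ∈ S, ⟪B p, x⟫_ℂ • B p

theorem continuous_truncate (S : Finset J) : Continuous (truncate B S) := by
  unfold truncate
  fun_prop

theorem inner_truncate [DecidableEq J] (S : Finset J) (p : J) (x : E) :
    ⟪B p, truncate B S x⟫_ℂ = if p ∈ S then ⟪B p, x⟫_ℂ else 0 := by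
  unfold truncate
  simp_rw [inner_sum, inner_smul_right, orthonormal_iff_ite.mp B.orthonormal]
  simp

variable [CompleteSpace E] [MeasurableSpace E] [BorelSpace E] [SecondCountableTopology E]
  {Ω : Type*} [MeasurableSpace Ω] {P : Measure Ω}

omit [MeasurableSpace E] [BorelSpace E] [SecondCountableTopology E] in
theorem lintegral_enorm_sub_truncate_sq_le [Countable J] {T : Ω → E} (hT : MemLp T 2 P) {g : J → ℝ}
    (hg : ∀ p, ∫ ω, ‖⟪B p, T ω⟫_ℂ‖ ^ 2 ∂P ≤ g p) (S : Finset J) :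
    ∫⁻ ω, ‖T ω - truncate B S (T ω)‖ₑ ^ 2 ∂P ≤ ∑' p : {p // p ∉ S}, ENNReal.ofReal (g p) := by
  classical
  have hm : AEStronglyMeasurable (fun ω => T ω - truncate B S (T ω)) P :=
    hT.aestronglyMeasurable.sub
      ((continuous_truncate B S).comp_aestronglyMeasurable hT.aestronglyMeasurable)
  have hsub := tsum_subtype {p | p ∉ S} fun p => ENNReal.ofReal (g p)
  rw [lintegral_enorm_sq_eq_tsum B hm]
  refine le_of_le_of_eq ?_ hsub.symm
  refine ENNReal.tsum_le_tsum fun p => ?_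
  by_cases hp : p ∈ S
  · simp [inner_truncate, hp]
  · have hi : MemLp (fun ω => ⟪B p, T ω⟫_ℂ) 2 P := hT.const_inner _
    simp only [inner_sub_right, inner_truncate, hp, if_false, sub_zero]
    rw [Set.indicator_of_mem (by exact hp)]
    refine le_trans (le_of_eq ?_) (ENNReal.ofReal_le_ofReal (hg p))
    rw [ofReal_integral_eq_lintegral_ofReal (hi.integrable_norm_pow (by norm_num))
      (ae_of_all _ fun ω => by positivity)]
    refine lintegral_congr fun ω => ?_
    rw [ENNReal.ofReal_pow (norm_nonneg _), ofReal_norm]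

-- A Lipschitz function changes by at most `L` times the truncation error `y`, and `y ≤ η + y²/η`
-- reduces the mean error to the second moment tail `τ`.
omit [MeasurableSpace E] [BorelSpace E] [SecondCountableTopology E] in
theorem abs_integral_sub_truncate_le [IsProbabilityMeasure P] [Countable J] {T : Ω → E}
    (hT : MemLp T 2 P) {g : J → ℝ}
    (hg : ∀ p, ∫ ω, ‖⟪B p, T ω⟫_ℂ‖ ^ 2 ∂P ≤ g p) (S : Finset J) {f : E → ℝ} {L : ℝ≥0}
    (hf : LipschitzWith L f) (hb : ∃ C : ℝ, ∀ x y, dist (f x) (f y) ≤ C) {η τ : ℝ} (hη : 0 < η)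
    (hτ : 0 ≤ τ) (hS : ∑' p : {p // p ∉ S}, ENNReal.ofReal (g p) ≤ ENNReal.ofReal τ) :
    |∫ ω, f (T ω) ∂P - ∫ ω, f (truncate B S (T ω)) ∂P| ≤ L * (η + τ / η) := by
  have hm : AEStronglyMeasurable T P := hT.aestronglyMeasurable
  have hm' : AEStronglyMeasurable (fun ω => truncate B S (T ω)) P :=
    (continuous_truncate B S).comp_aestronglyMeasurable hm
  obtain ⟨C, hC⟩ := hb
  have hint : ∀ Y : Ω → E, AEStronglyMeasurable Y P → Integrable (fun ω => f (Y ω)) P := fun Y hY => by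
    refine Integrable.of_bound (hf.continuous.comp_aestronglyMeasurable hY) (C + ‖f 0‖)
      (ae_of_all _ fun ω => ?_)
    have h1 := hC (Y ω) 0
    rw [dist_eq_norm] at h1
    have h2 := norm_le_norm_sub_add (f (Y ω)) (f 0)
    linarith
  have hl := (lintegral_enorm_sub_truncate_sq_le B hT hg S).trans hS
  have hm2 : MemLp (fun ω => T ω - truncate B S (T ω)) 2 P :=
    (memLp_two_iff_lintegral (hm.sub hm')).mpr (hl.trans_lt ENNReal.ofReal_lt_top)
  have hi2 : Integrable (fun ω => ‖T ω - truncate B S (T ω)‖ ^ 2) P :=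
    hm2.integrable_norm_pow (by norm_num)
  have hi1 : Integrable (fun ω => ‖T ω - truncate B S (T ω)‖) P :=
    (hm2.integrable one_le_two).norm
  have h2 : ∫ ω, ‖T ω - truncate B S (T ω)‖ ^ 2 ∂P ≤ τ := by
    rw [← ENNReal.ofReal_le_ofReal_iff hτ, ofReal_integral_eq_lintegral_ofReal hi2
      (ae_of_all _ fun ω => by positivity)]
    refine le_trans (le_of_eq (lintegral_congr fun ω => ?_)) hl
    rw [ENNReal.ofReal_pow (norm_nonneg _), ofReal_norm]
  have h1 : ∫ ω, ‖T ω - truncate B S (T ω)‖ ∂P ≤ η + τ / η := by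
    calc ∫ ω, ‖T ω - truncate B S (T ω)‖ ∂P
        ≤ ∫ ω, (η + ‖T ω - truncate B S (T ω)‖ ^ 2 / η) ∂P := by
          refine integral_mono hi1 ((integrable_const η).add (hi2.div_const η)) fun ω => ?_
          change ‖T ω - truncate B S (T ω)‖ ≤ η + ‖T ω - truncate B S (T ω)‖ ^ 2 / η
          set y := ‖T ω - truncate B S (T ω)‖
          rw [← sub_nonneg]
          have : η + y ^ 2 / η - y = ((y - η / 2) ^ 2 + 3 / 4 * η ^ 2) / η := by
            field_simp
            ring
          rw [this]
          positivity
      _ = η + (∫ ω, ‖T ω - truncate B S (T ω)‖ ^ 2 ∂P) / η := by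
          rw [integral_add (integrable_const η) (hi2.div_const η), integral_const,
            integral_div]
          simp
      _ ≤ η + τ / η := by gcongr
  rw [← integral_sub (hint T hm) (hint _ hm')]
  calc |∫ ω, (f (T ω) - f (truncate B S (T ω))) ∂P|
      ≤ ∫ ω, |f (T ω) - f (truncate B S (T ω))| ∂P := abs_integral_le_integral_abs
    _ ≤ ∫ ω, L * ‖T ω - truncate B S (T ω)‖ ∂P := by
        refine integral_mono ((hint T hm).sub (hint _ hm')).abs (hi1.const_mul _) fun ω => ?_
        change |f (T ω) - f (truncate B S (T ω))| ≤ L * ‖T ω - truncate B S (T ω)‖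
        rw [← Real.dist_eq, ← dist_eq_norm]
        exact hf.dist_le_mul _ _
    _ ≤ L * (η + τ / η) := by
        rw [integral_const_mul]
        gcongr

omit [SecondCountableTopology E] in
/-- Convergence in distribution in a Hilbert space from convergence of the finite-dimensional
projections and uniformly small tails. -/
theorem tendstoInDistribution_of_truncate [IsProbabilityMeasure P] [Countable J]
    {Ω' : Type*} [MeasurableSpace Ω'] {P' : Measure Ω'} [IsProbabilityMeasure P']
    {T : ℕ → Ω → E} {Y : Ω' → E} (hT : ∀ n, MemLp (T n) 2 P) (hY : MemLp Y 2 P')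
    {g g' : J → ℝ} (hgs : Summable g) (hgs' : Summable g')
    (hg : ∀ᶠ n in atTop, ∀ p, ∫ ω, ‖⟪B p, T n ω⟫_ℂ‖ ^ 2 ∂P ≤ g p)
    (hg' : ∀ p, ∫ ω, ‖⟪B p, Y ω⟫_ℂ‖ ^ 2 ∂P' ≤ g' p)
    (hfin : ∀ S₀ : Finset J, ∃ S, S₀ ⊆ S ∧ TendstoInDistribution
      (fun n ω => truncate B S (T n ω)) atTop (fun ω => truncate B S (Y ω)) (fun _ => P) P') :
    TendstoInDistribution T atTop Y (fun _ => P) P' := by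
  refine ⟨fun n => (hT n).aestronglyMeasurable.aemeasurable, hY.aestronglyMeasurable.aemeasurable, ?_⟩
  refine tendsto_iff_forall_lipschitz_integral_tendsto.mpr ?_
  rintro f hb ⟨L, hf⟩
  change Tendsto (fun n => ∫ x, f x ∂(P.map (T n))) atTop (𝓝 (∫ x, f x ∂(P'.map Y)))
  rw [integral_map hY.aestronglyMeasurable.aemeasurable hf.continuous.aestronglyMeasurable]
  simp_rw [integral_map (hT _).aestronglyMeasurable.aemeasurable
    hf.continuous.aestronglyMeasurable]
  rw [Metric.tendsto_nhds]
  intro ε hε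
  -- The tails will be at most `η²`, so each of the two truncation errors is at most `L (η + η²/η) =
  -- L (η + η)`. The last third of `ε` goes to the truncated variables.
  obtain ⟨η, hη, hηε⟩ : ∃ η > 0, (L : ℝ) * (η + η) < ε / 3 := by
    refine ⟨ε / 3 / (2 * (L + 1)), by positivity, ?_⟩
    have hL : (0 : ℝ) ≤ L := L.2
    rw [← two_mul, ← mul_assoc, mul_div_assoc', div_lt_iff₀ (by positivity)]
    nlinarith
  have htail : ∀ {g : J → ℝ}, Summable g → ∀ᶠ S : Finset J in atTop,
      ∑' p : {p // p ∉ S}, ENNReal.ofReal (g p) ≤ ENNReal.ofReal (η ^ 2) := fun hg =>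
    (ENNReal.tendsto_tsum_compl_atTop_zero hg.tsum_ofReal_ne_top).eventually_le_const
      (ENNReal.ofReal_pos.mpr (by positivity))
  obtain ⟨S₀, hS₀⟩ := eventually_atTop.mp ((htail hgs).and (htail hgs'))
  obtain ⟨S, hS, hdist⟩ := hfin S₀
  have hlim := (tendsto_iff_forall_lipschitz_integral_tendsto.mp hdist.tendsto) f hb ⟨L, hf⟩
  change Tendsto (fun n => ∫ x, f x ∂(P.map fun ω => truncate B S (T n ω))) atTop
    (𝓝 (∫ x, f x ∂(P'.map fun ω => truncate B S (Y ω)))) at hlim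
  rw [integral_map hdist.aemeasurable_limit hf.continuous.aestronglyMeasurable] at hlim
  simp_rw [fun n => integral_map (hdist.forall_aemeasurable n)
    (hf.continuous.aestronglyMeasurable (μ := P.map fun ω => truncate B S (T n ω)))] at hlim
  have hη2 : η ^ 2 / η = η := by field_simp
  have hYb := abs_integral_sub_truncate_le B hY hg' S hf hb hη (sq_nonneg η) (hS₀ S hS).2
  filter_upwards [hg, (Metric.tendsto_nhds.mp hlim) (ε / 3) (by positivity)] with n hn hn2
  have hTb := abs_integral_sub_truncate_le B (hT n) hn S hf hb hη (sq_nonneg η) (hS₀ S hS).1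
  rw [hη2] at hYb hTb
  rw [Real.dist_eq] at hn2 ⊢
  rw [abs_lt] at hn2 ⊢
  rw [abs_le] at hYb hTb
  constructor <;> linarith [hYb.1, hYb.2, hTb.1, hTb.2, hn2.1, hn2.2]

end Truncation

end FunctionalCLT

namespace FunctionalCLT

/-! ### Covariances and characteristic functions of the limit -/

section LimitMoments

theorem hasSum_mul_prod {ι κ : Type*} {f : ι → ℂ} {g : κ → ℂ} {a b : ℂ} (hf : HasSum f a)
    (hg : HasSum g b) : HasSum (fun p : ι × κ => f p.1 * g p.2) (a * b) :=
  hf.mul hg (summable_mul_of_summable_norm hf.summable.norm hg.summable.norm)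

variable {H : Type*} [NormedAddCommGroup H] [InnerProductSpace ℂ H] [CompleteSpace H]
  [TopologicalSpace.SeparableSpace H]
  {ι : Type*} [LinearOrder ι] {Ω : Type*} [MeasurableSpace Ω] {P : Measure Ω}
  [IsProbabilityMeasure P] {Z : ι → ι → Ω → ℂ} (hZ : IsHermitianGaussianArray P Z)
  (e : HilbertBasis ι ℂ H) {lam : ι → ℝ} (h0 : ∀ i, 0 ≤ lam i) (hs : Summable lam) (K : ℝ → ℝ)
include hZ h0 hs

/-- The expansion of the covariance operator factors into the spectral expansions of `⟪u, A u'⟫` and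
of the conjugate of `⟪v, A v'⟫`. The vectors are arbitrary, so the system `e₀` of the assumptions
need not consist of eigenvectors. -/
theorem integral_inner_klSeries_mul_conj {A : H →L[ℂ] H}
    (hdiag : HasSum (fun i => (lam i : ℂ) • InnerProductSpace.rankOne ℂ (e i) (e i)) A)
    (u v u' v' : H) :
    ∫ ω, ⟪HS.outer u v, klSeries K e lam Z ω⟫_ℂ * conj ⟪HS.outer u' v', klSeries K e lam Z ω⟫_ℂ ∂P
      = ((kernelNorm K ^ 2 : ℝ) : ℂ) * ⟪u, A u'⟫_ℂ * conj ⟪v, A v'⟫_ℂ := by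
  have hm := memLp_klSeries hZ e h0 hs K
  simp_rw [inner_conj_symm]
  rw [← inner_crossCov hm hm]
  have hcov := hasSum_crossCov_klSeries hZ e h0 hs K
  simp_rw [← HS.outerBasis_apply] at hcov
  have h1 := hasSum_inner_of_diag (lam := fun p : ι × ι => kernelNorm K ^ 2 * (lam p.1 * lam p.2))
    hcov (HS.outer u v) (HS.outer u' v')
  refine h1.unique ?_
  have h2 := hasSum_inner_of_diag hdiag u u'
  have h3 : HasSum (fun j => (lam j : ℂ) * (⟪e j, v⟫_ℂ * ⟪v', e j⟫_ℂ)) (conj ⟪v, A v'⟫_ℂ) := by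
    have h := (hasSum_inner_of_diag hdiag v v').map (starRingEnd ℂ) Complex.continuous_conj
    refine h.congr_fun fun j => ?_
    simp only [Function.comp_apply, map_mul, Complex.conj_ofReal, inner_conj_symm]
  have h4 := (hasSum_mul_prod h2 h3).mul_left ((kernelNorm K ^ 2 : ℝ) : ℂ)
  rw [← mul_assoc, inner_conj_symm] at h4
  refine h4.congr_fun fun p => ?_
  rw [HS.outerBasis_apply, HS.inner_outer_outer, HS.inner_outer_outer]
  push_cast
  ring

theorem exists_summable_bound_klSeries {J : Type*} [Countable J] (B : HilbertBasis J ℂ (HS H)) :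
    ∃ g : J → ℝ, Summable g ∧ ∀ p, ∫ ω, ‖⟪B p, klSeries K e lam Z ω⟫_ℂ‖ ^ 2 ∂P ≤ g p := by
  have hm := memLp_klSeries hZ e h0 hs K
  have h1 := (memLp_two_iff_lintegral hm.aestronglyMeasurable).mp hm
  rw [lintegral_enorm_sq_eq_tsum B hm.aestronglyMeasurable] at h1
  refine ⟨_, ENNReal.summable_toReal h1.ne, fun p => le_of_eq ?_⟩
  have hmp : AEStronglyMeasurable (fun ω => ‖⟪B p, klSeries K e lam Z ω⟫_ℂ‖ ^ 2) P :=
    (hm.const_inner (B p)).aestronglyMeasurable.norm.pow 2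
  rw [integral_eq_lintegral_of_nonneg_ae (ae_of_all _ fun ω => by positivity) hmp]
  congr 1
  refine lintegral_congr fun ω => ?_
  rw [ENNReal.ofReal_pow (norm_nonneg _), ofReal_norm]

/-- A real functional of the series is centred Gaussian, so only its variance matters;
self-adjointness expresses this through the Hermitian part of `d`, in the same form as the limit for
the statistic. -/
theorem integral_exp_klSeries {A : H →L[ℂ] H}
    (hdiag : HasSum (fun i => (lam i : ℂ) • InnerProductSpace.rankOne ℂ (e i) (e i)) A)
    {F : Type*} [Fintype F] (u : F → H) (d : F × F → ℂ) :
    ∫ ω, Complex.exp (Complex.I * ((∑ p, conj (d p) *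
      ⟪HS.outer (u p.1) (u p.2), klSeries K e lam Z ω⟫_ℂ).re : ℝ)) ∂P
      = Complex.exp (-((∑ p, ∑ q, (conj (hermPart d p) * hermPart d q) *
        (((kernelNorm K ^ 2 : ℝ) : ℂ) * ⟪u p.1, A (u q.1)⟫_ℂ *
          conj ⟪u p.2, A (u q.2)⟫_ℂ)).re / 2 : ℝ)) := by
  have hm := memLp_klSeries hZ e h0 hs K
  have hG := hasGaussianLaw_klSeries hZ e h0 hs K
  let l : HS H →L[ℝ] ℝ := Complex.reCLM.comp ((∑ p : F × F, conj (d p) •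
    innerSL ℂ (HS.outer (u p.1) (u p.2))).restrictScalars ℝ)
  have hl : ∀ T, l T = (∑ p, conj (d p) * ⟪HS.outer (u p.1) (u p.2), T⟫_ℂ).re := fun T => by
    simp [l]
  have hGl : HasGaussianLaw (fun ω => l (klSeries K e lam Z ω)) P := hG.map_fun l
  have hl0 : ∫ ω, l (klSeries K e lam Z ω) ∂P = 0 := by
    rw [l.integral_comp_comm (hm.integrable one_le_two), integral_klSeries hZ e h0 hs K, map_zero]
  have h1 := integral_exp_of_hasGaussianLaw hGl hl0 1
  have h2 := integral_re_sum_sq (P := P) d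
    (W := fun p ω => ⟪HS.outer (u p.1) (u p.2), klSeries K e lam Z ω⟫_ℂ) (by
      filter_upwards [ae_conj_inner_klSeries hZ e h0 hs K] with ω hω p
      exact hω _ _) fun p q => (hm.const_inner _).integrable_mul (q := 2) (hm.const_inner _).star
  simp_rw [integral_inner_klSeries_mul_conj hZ e h0 hs K hdiag] at h2
  simp_rw [hl] at h1
  rw [h2] at h1
  have e1 : ∀ x : ℝ, ((1 : ℝ) : ℂ) * x * Complex.I = Complex.I * x := fun x => by
    rw [Complex.ofReal_one, one_mul, mul_comm]
  simp_rw [e1] at h1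
  rw [h1]
  congr 1
  push_cast
  ring

end LimitMoments

end FunctionalCLT

namespace FunctionalCLT

/-! ### Convergence of the statistic in the Hilbert-Schmidt space -/

section Convergence

variable {H : Type*} [NormedAddCommGroup H] [InnerProductSpace ℂ H] [CompleteSpace H]
  [TopologicalSpace.SeparableSpace H] [MeasurableSpace H] [BorelSpace H]
  {Ω : Type*} [MeasurableSpace Ω] {P : Measure Ω} [IsProbabilityMeasure P]
  {κ κ' : Type*} {r : HilbertBasis κ ℂ H} {e₀ : HilbertBasis κ' ℂ H}
  {X : ℝ → Ω → H} (hX : IsStationaryGaussian P r X) {K : ℝ → ℝ} (hK : IsCLTKernel K)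
  {δ Δ L : ℕ → ℝ} {δinf θ : ℝ} (hCLT : CLTCondition P r e₀ X δ Δ L δinf θ)
include hX

omit [IsProbabilityMeasure P] in
theorem memLp_outer (t s : ℝ) : MemLp (fun ω => HS.outer (X t ω) (X s ω)) 2 P := by
  have : ENNReal.HolderTriple 4 4 2 := ⟨by
    rw [← ENNReal.toReal_eq_toReal_iff' (by finiteness) (by finiteness),
      ENNReal.toReal_add (by finiteness) (by finiteness)]
    norm_num⟩
  have h4 : ∀ t, MemLp (fun ω => ‖X t ω‖) 4 P := fun t =>
    ((hX.gaussian.hasGaussianLaw_eval t).memLp (by finiteness)).norm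
  have h : MemLp (fun ω => ‖X t ω‖ * ‖X s ω‖) 2 P := (h4 s).mul (h4 t)
  refine h.of_le (integrable_outer hX t s).aestronglyMeasurable (ae_of_all _ fun ω => ?_)
  rw [HS.norm_outer, norm_mul, norm_norm, norm_norm]

theorem memLp_cltStat (K : ℝ → ℝ) (δ Δ : ℕ → ℝ) (θ : ℝ) (n : ℕ) :
    MemLp (cltStat P X K δ Δ θ n) 2 P := by
  have h1 : MemLp (specEstimator X K δ Δ θ n) 2 P := by
    unfold specEstimator
    exact (memLp_finsetSum _ fun i _ => memLp_finsetSum _ fun j _ =>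
      (memLp_outer hX _ _).const_smul (_ : ℂ)).const_smul (_ : ℂ)
  exact (h1.sub (memLp_const _)).const_smul (_ : ℂ)

/-- The coordinates of a Hilbert-Schmidt operator in finitely many directions. -/
noncomputable def coordVec (e₀ : HilbertBasis κ' ℂ H) (F : Finset κ') (T : HS H) :
    EuclideanSpace ℂ (F × F) :=
  WithLp.toLp 2 fun p => ⟪HS.outer (e₀ p.1) (e₀ p.2), T⟫_ℂ

omit hX [TopologicalSpace.SeparableSpace H] [MeasurableSpace H] [BorelSpace H] [MeasurableSpace Ω] in
theorem continuous_coordVec (F : Finset κ') : Continuous (coordVec e₀ F) := by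
  refine (PiLp.continuous_toLp 2 fun _ : F × F => ℂ).comp (continuous_pi fun p => ?_)
  fun_prop

omit hX [TopologicalSpace.SeparableSpace H] [MeasurableSpace H] [BorelSpace H] [MeasurableSpace Ω] in
theorem truncate_eq_coordVec (F : Finset κ') (T : HS H) :
    truncate (HS.outerBasis e₀) (F ×ˢ F) T
      = ∑ p : F × F, coordVec e₀ F T p • HS.outerBasis e₀ (p.1, p.2) := by
  unfold truncate
  rw [Finset.sum_product, Fintype.sum_prod_type, ← Finset.sum_coe_sort F]
  refine Finset.sum_congr rfl fun i _ => ?_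
  rw [← Finset.sum_coe_sort F]
  refine Finset.sum_congr rfl fun j _ => ?_
  rw [HS.outerBasis_apply]
  rfl

omit hX [TopologicalSpace.SeparableSpace H] [MeasurableSpace H] [BorelSpace H] [MeasurableSpace Ω] in
theorem charFun_map_coordVec {Ω : Type*} [MeasurableSpace Ω] {P : Measure Ω} (F : Finset κ')
    {T : Ω → HS H} (hT : AEMeasurable T P) (d : EuclideanSpace ℂ (F × F)) :
    charFun (P.map fun ω => coordVec e₀ F (T ω)) d = ∫ ω, Complex.exp (Complex.I *
      ((∑ p, conj (d p) * ⟪HS.outer (e₀ p.1) (e₀ p.2), T ω⟫_ℂ).re : ℝ)) ∂P := by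
  have hm : AEMeasurable (fun ω => coordVec e₀ F (T ω)) P :=
    (continuous_coordVec F).measurable.comp_aemeasurable hT
  rw [charFun_apply, integral_map hm (by fun_prop)]
  refine integral_congr_ae (ae_of_all _ fun ω => ?_)
  change Complex.exp (⟪coordVec e₀ F (T ω), d⟫_ℝ * Complex.I) = _
  rw [real_inner_comm, inner_real_euclidean, mul_comm]
  rfl

include hK hCLT

/-- Lévy's continuity theorem handles finitely many coordinates, and the truncation criterion does
the rest. Coordinates are taken along `e₀`, where the summable bound is available, rather than along
the eigenvectors `e`. -/
theorem tendstoInDistribution_cltStat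
    (hθ : 0 < δinf → θ ∈ Set.Icc (-(Real.pi / δinf)) (Real.pi / δinf))
    (hc : cIndicator δinf θ = 0)
    {ι : Type*} [LinearOrder ι] (e : HilbertBasis ι ℂ H) {lam : ι → ℝ} (h0 : ∀ i, 0 ≤ lam i)
    (hs : Summable lam)
    (hdiag : HasSum (fun i => (lam i : ℂ) • InnerProductSpace.rankOne ℂ (e i) (e i))
      (specDensity P X θ δinf))
    {Ω' : Type*} [MeasurableSpace Ω'] {P' : Measure Ω'} [IsProbabilityMeasure P']
    {Z : ι → ι → Ω' → ℂ} (hZ : IsHermitianGaussianArray P' Z) :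
    TendstoInDistribution (cltStat P X K δ Δ θ) atTop (klSeries K e lam Z) (fun _ => P) P' := by
  classical
  have := e₀.countable
  have hmT : ∀ n, AEMeasurable (cltStat P X K δ Δ θ n) P := fun n =>
    (memLp_cltStat hX K δ Δ θ n).aestronglyMeasurable.aemeasurable
  have hmY := aemeasurable_klSeries hZ e h0 hs K
  have hfdd : ∀ F : Finset κ', TendstoInDistribution
      (fun n ω => coordVec e₀ F (cltStat P X K δ Δ θ n ω)) atTop
      (fun ω => coordVec e₀ F (klSeries K e lam Z ω)) (fun _ => P) P' := fun F => by
    refine ⟨fun n => (continuous_coordVec F).measurable.comp_aemeasurable (hmT n),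
      (continuous_coordVec F).measurable.comp_aemeasurable hmY, ?_⟩
    refine ProbabilityMeasure.tendsto_iff_tendsto_charFun.mpr fun d => ?_
    change Tendsto (fun n => charFun (P.map fun ω => coordVec e₀ F (cltStat P X K δ Δ θ n ω)) d)
      atTop (𝓝 (charFun (P'.map fun ω => coordVec e₀ F (klSeries K e lam Z ω)) d))
    rw [charFun_map_coordVec F hmY]
    simp_rw [fun n => charFun_map_coordVec (e₀ := e₀) F (hmT n)]
    rw [integral_exp_klSeries hZ e h0 hs K hdiag (fun a : F => e₀ a) d]
    exact tendsto_integral_exp_cltStat hX hK hCLT (fun a : F => (a : κ')) hθ hc d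
  obtain ⟨g, hg, hgT⟩ := exists_summable_bound_cltStat hCLT hX hK
  obtain ⟨g', hg', hgY⟩ := exists_summable_bound_klSeries hZ e h0 hs K (HS.outerBasis e₀)
  refine tendstoInDistribution_of_truncate (HS.outerBasis e₀) (memLp_cltStat hX K δ Δ θ)
    (memLp_klSeries hZ e h0 hs K) hg hg' ?_ hgY fun S₀ => ?_
  · simp_rw [HS.outerBasis_apply]
    exact hgT
  -- Square index sets `F × F` are cofinal and closed under transposition, as the self-adjointness
  -- argument requires.
  · set F := S₀.image Prod.fst ∪ S₀.image Prod.snd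
    refine ⟨F ×ˢ F, fun p hp => Finset.mem_product.mpr
      ⟨Finset.mem_union_left _ (Finset.mem_image_of_mem _ hp),
        Finset.mem_union_right _ (Finset.mem_image_of_mem _ hp)⟩, ?_⟩
    have hcont : Continuous fun w : EuclideanSpace ℂ (F × F) =>
        ∑ p : F × F, w p • HS.outerBasis e₀ (p.1, p.2) := by fun_prop
    have h := (hfdd F).continuous_comp hcont
    simp_rw [truncate_eq_coordVec]
    exact h

end Convergence

end FunctionalCLT

/-! ### Transfer to an arbitrary limit variable -/

namespace FunctionalCLT

theorem _root_.ProbabilityTheory.IdentDistrib.crossCov_eq {E : Type*} [NormedAddCommGroup E]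
    [InnerProductSpace ℂ E] [CompleteSpace E] [SecondCountableTopology E] [MeasurableSpace E]
    [BorelSpace E] {Ω Ω' : Type*} [MeasurableSpace Ω] [MeasurableSpace Ω'] {P : Measure Ω}
    {P' : Measure Ω'} {T : Ω → E} {Y : Ω' → E} (h : IdentDistrib T Y P P') :
    crossCov P T T = crossCov P' Y Y := by
  have hc : Continuous fun x : E => InnerProductSpace.rankOne ℂ x x :=
    continuous_rankOne.comp (continuous_id.prodMk continuous_id)
  unfold crossCov
  rw [← integral_map (f := fun x : E => InnerProductSpace.rankOne ℂ x x) h.aemeasurable_fst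
      hc.aestronglyMeasurable, h.map_eq,
    integral_map h.aemeasurable_snd hc.aestronglyMeasurable]

end FunctionalCLT

theorem mainTheorem12
    {H : Type*} [NormedAddCommGroup H] [InnerProductSpace ℂ H] [CompleteSpace H]
    [TopologicalSpace.SeparableSpace H] [MeasurableSpace H] [BorelSpace H]
    {Ω : Type*} [MeasurableSpace Ω] (P : Measure Ω) [IsProbabilityMeasure P]
    {κ κ' : Type*} (r : HilbertBasis κ ℂ H) (e₀ : HilbertBasis κ' ℂ H)
    (X : ℝ → Ω → H) (hX : IsStationaryGaussian P r X)
    (K : ℝ → ℝ) (hK : IsCLTKernel K)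
    (δ Δ L : ℕ → ℝ) (δinf θ : ℝ) (hCLT : CLTCondition P r e₀ X δ Δ L δinf θ)
    (hθ : 0 < δinf → θ ∈ Set.Icc (-(Real.pi / δinf)) (Real.pi / δinf))
    (hc : cIndicator δinf θ = 0)
    {ι : Type*} [LinearOrder ι] (e : HilbertBasis ι ℂ H) (lam : ι → ℝ)
    (hdiag : HasSum (fun i => (lam i : ℂ) • InnerProductSpace.rankOne ℂ (e i) (e i))
      (specDensity P X θ δinf))
    {Ω' : Type*} [MeasurableSpace Ω'] (P' : Measure Ω') [IsProbabilityMeasure P']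
    (Z : ι → ι → Ω' → ℂ) (hZ : IsHermitianGaussianArray P' Z)
    {Ω'' : Type*} [MeasurableSpace Ω''] (P'' : Measure Ω'') [IsProbabilityMeasure P''] :
    (∀ᵐ ω ∂P', Summable (klTerm e lam Z ω)) ∧
    TendstoInDistribution (cltStat P X K δ Δ θ) atTop (klSeries K e lam Z) (fun _ => P) P' ∧
    (∃ B : HilbertBasis (ι × ι) ℂ (HS H), ∀ i j, B (i, j) = HS.outer (e i) (e j)) ∧
    ∀ T : Ω'' → HS H,
      TendstoInDistribution (cltStat P X K δ Δ θ) atTop T (fun _ => P) P'' →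
      HasGaussianLaw T P'' ∧
      IdentDistrib T (klSeries K e lam Z) P'' P' ∧
      MemLp T 2 P'' ∧ ∫ ω, T ω ∂P'' = 0 ∧
      HasSum (fun p : ι × ι => ((kernelNorm K ^ 2 * (lam p.1 * lam p.2) : ℝ) : ℂ) •
          InnerProductSpace.rankOne ℂ (HS.outer (e p.1) (e p.2)) (HS.outer (e p.1) (e p.2)))
        (crossCov P'' T T) ∧
      ∀ i j, crossCov P'' T T (HS.outer (e i) (e j)) =
        ((kernelNorm K ^ 2 * (lam i * lam j) : ℝ) : ℂ) • HS.outer (e i) (e j) := by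
  -- The eigenvalues are the diagonal entries of the spectral density along its unit eigenvectors.
  have h0 : ∀ i, 0 ≤ lam i := fun i => by
    have h := hCLT.re_inner_specDensity_nonneg hX (e.orthonormal.1 i)
    rwa [apply_eq_of_diag hdiag, inner_smul_right, inner_self_eq_norm_sq_to_K,
      e.orthonormal.1 i, RCLike.ofReal_one, one_pow, mul_one, Complex.ofReal_re] at h
  have hs : Summable lam := summable_of_trace hdiag h0 e₀ hCLT.tsum_enorm_inner_specDensity_ne_top
  have hlim := tendstoInDistribution_cltStat hX hK hCLT hθ hc e h0 hs hdiag hZ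
  refine ⟨ae_summable_klTerm hZ e h0 hs, hlim,
    ⟨HS.outerBasis e, fun i j => HS.outerBasis_apply e (i, j)⟩, fun T hT => ?_⟩
  -- Limits in distribution are unique, and Gaussianity, moments and covariance depend only on the
  -- law.
  have hident : IdentDistrib T (klSeries K e lam Z) P'' P' :=
    ⟨hT.aemeasurable_limit, hlim.aemeasurable_limit, tendstoInDistribution_unique _ hT hlim⟩
  have hcov : crossCov P'' T T = crossCov P' (klSeries K e lam Z) (klSeries K e lam Z) :=
    hident.crossCov_eq
  refine ⟨⟨?_⟩, hident, hident.memLp_iff.mpr (memLp_klSeries hZ e h0 hs K),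
    hident.integral_eq.trans (integral_klSeries hZ e h0 hs K), ?_, fun i j => ?_⟩
  · rw [hident.map_eq]
    exact (hasGaussianLaw_klSeries hZ e h0 hs K).isGaussian_map
  · rw [hcov]
    exact hasSum_crossCov_klSeries hZ e h0 hs K
  · have h := crossCov_klSeries_apply hZ e h0 hs K (i, j)
    rw [HS.outerBasis_apply] at h
    rw [hcov]
    exact h
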